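/- Let $E=\mathbb Q(\sqrt{-7})$ with ring of integers $\mathcal O_E$ and conjugation $x\mapsto\bar x$, and put $\rho_2=(1+\sqrt{-7})/2$, $\bar\rho_2=(1-\sqrt{-7})/2$. Let $p_0$ be an odd prime that splits in $E$ (that is, $p_0\equiv 1,2,4 \pmod 7$), and let $\rho_{p_0}\in\mathcal O_E$ with $\rho_{p_0}\bar\rho_{p_0}=p_0$. Let $M/\mathbb Q$ be a Galois extension of degree $5$ and discriminant $p_0^4$ in which the prime $2$ is inert, let $\delta\in\mathcal O_M$ with $N_{M/\mathbb Q}(\delta)=p_0$, let $L=EM$ be the compositum, and let $\sigma$ be an automorphism of $L$ over $E$ of order $5$. Assume that neither $\rho_{p_0}$ nor $\bar\rho_{p_0}$ is a norm from $L$ to $E$. Let $d\in\{0,1,2,3,4\}$ be such that $\rho_2/(\bar\rho_2\bar\rho_{p_0}^{2d})$ is a fifth power modulo $\rho_{p_0}$, let $e\in\{1,2,3,4\}$, and put $$a=\left(\frac{\rho_2\rho_{p_0}^d}{\bar\rho_2\bar\rho_{p_0}^d}\right)^e .$$ Let $b\in 2\mathcal O_E$ satisfy $\bar b\,b\equiv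 1\pmod{p_0}$, $b^5\equiv p_0^{de}a\pmod{\bar\rho_{p_0}}$ and $b^5\equiv p_0^{-de}a\pmod{\rho_{p_0}}$. Let $$D=D(L,a)=\bigoplus_{i=0}^4u^iL,\qquad u^5=a,\qquad ulu^{-1}=\sigma(l)\quad(l\in L),$$ be the cyclic algebra, and put $u_+=u\delta^{de}$, $u_-=u\delta^{-de}$, $y_+=(b-u_+)\delta^4/\bar\rho_{p_0}$, $y_-=(b-u_-)\delta^4/\rho_{p_0}$ (the factors $\delta^4/\bar\rho_{p_0}$ and $\delta^4/\rho_{p_0}\in L$ multiply on the right). With $c_i=\bar\rho_2^{\lceil ei/5\rceil}\rho_2^{\lceil -ei/5\rceil}$ define the lattices $$\Lambda_D=\bigoplus_{i=0}^4u^i c_i\,\bar\rho_{p_0}^{\lceil dei/5\rceil}\rho_{p_0}^{\lceil -dei/5\rceil}\mathcal O_L,$$ $$\Lambda_{D,+}=\bigoplus_{i=0}^4u_+^i c_i\,\rho_{p_0}^{\lceil -2dei/5\rceil}\mathcal O_L,\qquad \Lambda_{D,+}^{\max}=\bigoplus_{i=0}^4y_+^i c_i\,\rho_{p_0}^{\lceil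 -4i/5\rceil}\mathcal O_L,$$ $$\Lambda_{D,-}=\bigoplus_{i=0}^4u_-^i c_i\,\bar\rho_{p_0}^{\lceil 2dei/5\rceil}\mathcal O_L,\qquad \Lambda_{D,-}^{\max}=\bigoplus_{i=0}^4y_-^i c_i\,\bar\rho_{p_0}^{\lceil 2dei/5\rceil}\mathcal O_L,$$ and $\Lambda_D^{\max}=\Lambda_{D,+}^{\max}+\Lambda_{D,-}^{\max}$. For a finite place $v$ of $E$ write $D_v=D\otimes_EE_v$, and for an $\mathcal O_E$-lattice $\Lambda\subset D$ let $\Lambda_v\subset D_v$ be the $\mathcal O_{E_v}$-module generated by $\Lambda$. An order is a subring that is a finitely generated module over $\mathcal O_E$ (resp. $\mathcal O_{E_v}$) and spans the algebra over $E$ (resp. $E_v$); it is maximal if no other order properly contains it. Then $D$ is a division algebra, and the following hold. (1) For every finite place $v$ of $E$ not dividing $p_0$, $$(\Lambda_{D,+}^{\max})_v=(\Lambda_{D,-}^{\max})_v=(\Lambda_{D,+})_v=(\Lambda_{D,-})_v=(\Lambda_D)_v=(\Lambda_D^{\max})_v,$$ and this is a maximal order of $D_v$. (2) At the place $v=\bar\rho_{p_0}$,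 $(\Lambda_{D,+}^{\max})_v$ is a maximal order of $D_v$; it contains $(\Lambda_D)_v$, $(\Lambda_{D,+})_v$, $(\Lambda_{D,-})_v$ and $(\Lambda_{D,-}^{\max})_v$, and it equals $(\Lambda_D^{\max})_v$. (3) At the place $v=\rho_{p_0}$, $(\Lambda_{D,-}^{\max})_v$ is a maximal order of $D_v$; it contains $(\Lambda_D)_v$, $(\Lambda_{D,+})_v$, $(\Lambda_{D,-})_v$ and $(\Lambda_{D,+}^{\max})_v$, and it equals $(\Lambda_D^{\max})_v$. (4) $\Lambda_D^{\max}$ is a maximal order of $D$ and contains $\Lambda_D$. -/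

import Mathlib

open NumberField IsDedekindDomain
open scoped TensorProduct

/-! ### Orders and maximal orders -/

/-- Let `R` be a subring of a field `K` (via `Algebra R K`) and `A` a `K`-algebra. An `R`-submodule
`Λ` of `A` is an order if it is a finitely generated `R`-module, spans `A` over `K`, contains `1` and
is closed under multiplication. -/
structure IsOrderIn (R K : Type*) {A : Type*} [CommRing R] [Field K] [Ring A] [Algebra R K]
    [Algebra K A] [Module R A] (Λ : Submodule R A) : Prop where
  fg : Λ.FG
  span_eq_top : Submodule.span K (Λ : Set A) = ⊤
  one_mem : (1 : A) ∈ Λ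
  mul_mem : ∀ x ∈ Λ, ∀ y ∈ Λ, x * y ∈ Λ

/-- An order which is not properly contained in another order. -/
def IsMaximalOrderIn (R K : Type*) {A : Type*} [CommRing R] [Field K] [Ring A] [Algebra R K]
    [Algebra K A] [Module R A] (Λ : Submodule R A) : Prop :=
  IsOrderIn R K Λ ∧ ∀ Γ : Submodule R A, IsOrderIn R K Γ → Λ ≤ Γ → Γ = Λ

/-! ### The cyclic algebra `D(L, a) = ⨁ uⁱ L` of degree 5 -/

section CyclicAlgebra

variable {E L : Type*} [Field E] [Field L] [Algebra E L]

/-- The matrix of the cyclic generator `u`. -/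
def cyclicGen (a : L) : Matrix (Fin 5) (Fin 5) L :=
  !![0, 1, 0, 0, 0;
     0, 0, 1, 0, 0;
     0, 0, 0, 1, 0;
     0, 0, 0, 0, 1;
     a, 0, 0, 0, 0]

/-- The embedding `l ↦ diag(l, σ l, σ² l, σ³ l, σ⁴ l)`. -/
def twistedDiag (σ : L ≃ₐ[E] L) : L →ₐ[E] Matrix (Fin 5) (Fin 5) L :=
  (Matrix.diagonalAlgHom E).comp 
    (AlgHom.pi fun i : Fin 5 => ((σ ^ (i : ℕ) : L ≃ₐ[E] L) : L →ₐ[E] L))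

theorem twistedDiag_apply (σ : L ≃ₐ[E] L) (l : L) :
    twistedDiag σ l = Matrix.diagonal fun i : Fin 5 => (σ ^ (i : ℕ)) l := rfl

/-- The relation `u l = σ(l) u`. -/
theorem cyclicGen_mul_twistedDiag (σ : L ≃ₐ[E] L) (hσ : σ ^ 5 = 1) (a l : L) :
    cyclicGen a * twistedDiag σ l = twistedDiag σ (σ l) * cyclicGen a := by
  have h : ∀ n : ℕ, (σ ^ n) (σ l) = (σ ^ (n + 1)) l := fun n => by
    rw [pow_succ]; rfl
  ext i j
  rw [twistedDiag_apply, twistedDiag_apply, Matrix.mul_diagonal, Matrix.diagonal_mul, h]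
  fin_cases i <;> fin_cases j <;> simp [cyclicGen, hσ, mul_comm]

/-- The relation `u⁵ = a`. -/
theorem cyclicGen_pow_five (σ : L ≃ₐ[E] L) (a : E) :
    cyclicGen (algebraMap E L a) ^ 5 = twistedDiag σ (algebraMap E L a) := by
  rw [twistedDiag_apply]
  simp only [AlgEquiv.commutes]
  ext i j
  fin_cases i <;> fin_cases j <;>
    simp [cyclicGen, pow_succ, Matrix.mul_apply, Fin.sum_univ_five] <;>
    exact (Algebra.algebraMap_eq_smul_one a).symm

/-- The cyclic algebra `D(L, a) = ⨁_{i=0}^4 uⁱ L` with `u⁵ = a` and `u l u⁻¹ = σ(l)`,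
as the `E`-algebra of the `5 × 5` matrices over `L` of the form `∑ uⁱ lᵢ`. -/
def cyclicAlgebra (σ : L ≃ₐ[E] L) (hσ : σ ^ 5 = 1) (a : E) :
    Subalgebra E (Matrix (Fin 5) (Fin 5) L) where
  carrier := {z | ∃ l : Fin 5 → L,
    z = ∑ i : Fin 5, cyclicGen (algebraMap E L a) ^ (i : ℕ) * twistedDiag σ (l i)}
  add_mem' := by
    rintro _ _ ⟨l, rfl⟩ ⟨m, rfl⟩
    exact ⟨l + m, by simp [mul_add, Finset.sum_add_distrib]⟩
  algebraMap_mem' := by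
    intro r
    refine ⟨Pi.single 0 (algebraMap E L r), ?_⟩
    rw [Finset.sum_eq_single 0 (fun i _ hi => by simp [hi]) (by simp)]
    simp
  mul_mem' := by
    have hsum : ∀ (ι : Type) (s : Finset ι) (f : ι → Matrix (Fin 5) (Fin 5) L),
        (∀ i ∈ s, ∃ l : Fin 5 → L, f i =
          ∑ i : Fin 5, cyclicGen (algebraMap E L a) ^ (i : ℕ) * twistedDiag σ (l i)) →
        ∃ l : Fin 5 → L, ∑ i ∈ s, f i =
          ∑ i : Fin 5, cyclicGen (algebraMap E L a) ^ (i : ℕ) * twistedDiag σ (l i) := by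
      intro ι s f h
      classical
      induction s using Finset.induction_on with
      | empty => exact ⟨0, by simp⟩
      | insert i s hi ih =>
        obtain ⟨l, hl⟩ := ih fun j hj => h j (Finset.mem_insert_of_mem hj)
        obtain ⟨m, hm⟩ := h i (Finset.mem_insert_self i s)
        exact ⟨m + l, by
          rw [Finset.sum_insert hi, hl, hm]; simp [mul_add, Finset.sum_add_distrib]⟩
    have hcomm : ∀ (n : ℕ) (l : L), twistedDiag σ l * cyclicGen (algebraMap E L a) ^ n =
        cyclicGen (algebraMap E L a) ^ n * twistedDiag σ ((σ.symm ^ n) l) := by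
      intro n
      induction n with
      | zero => intro l; simp
      | succ n ih =>
        intro l
        have h1 := cyclicGen_mul_twistedDiag σ hσ (algebraMap E L a) ((σ.symm ^ (n + 1)) l)
        have h2 : σ ((σ.symm ^ (n + 1)) l) = (σ.symm ^ n) l := by
          rw [pow_succ']; exact σ.apply_symm_apply _
        rw [h2] at h1
        rw [pow_succ, ← mul_assoc, ih, mul_assoc, ← h1, mul_assoc]
    have hpow : ∀ (n : ℕ) (l : L), ∃ m : Fin 5 → L,
        cyclicGen (algebraMap E L a) ^ n * twistedDiag σ l =
          ∑ i : Fin 5, cyclicGen (algebraMap E L a) ^ (i : ℕ) * twistedDiag σ (m i) := by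
      intro n
      induction n using Nat.strong_induction_on with
      | _ n ih =>
        intro l
        by_cases hn : n < 5
        · refine ⟨Pi.single ⟨n, hn⟩ l, ?_⟩
          rw [Finset.sum_eq_single ⟨n, hn⟩ (fun i _ hi => by simp [hi]) (by simp)]
          simp
        · obtain ⟨m, rfl⟩ : ∃ m, n = m + 5 := ⟨n - 5, by omega⟩
          rw [pow_add, cyclicGen_pow_five σ, mul_assoc, ← map_mul]
          exact ih m (by omega) _
    rintro _ _ ⟨l, rfl⟩ ⟨m, rfl⟩
    rw [Finset.sum_mul]
    refine hsum _ _ _ fun i _ => ?_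
    rw [Finset.mul_sum]
    refine hsum _ _ _ fun j _ => ?_
    obtain ⟨k, hk⟩ := hpow ((i : ℕ) + j) ((σ.symm ^ (j : ℕ)) (l i) * m j)
    refine ⟨k, ?_⟩
    rw [← hk, map_mul, pow_add, mul_assoc, ← mul_assoc (twistedDiag σ (l i)), hcomm]
    simp only [mul_assoc]

/-- The decomposition `D = ⨁ uⁱ L` is direct. -/
theorem cyclicGen_sum_injective (σ : L ≃ₐ[E] L) (a : E) (l m : Fin 5 → L)
    (h : ∑ i : Fin 5, cyclicGen (algebraMap E L a) ^ (i : ℕ) * twistedDiag σ (l i) =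
      ∑ i : Fin 5, cyclicGen (algebraMap E L a) ^ (i : ℕ) * twistedDiag σ (m i)) : l = m := by
  funext j
  have h0 := congrFun (congrFun h 0) j
  fin_cases j <;>
    simpa [twistedDiag_apply, Matrix.sum_apply, Matrix.mul_diagonal, -Matrix.cons_mul,
      Fin.sum_univ_five, cyclicGen, pow_succ, Matrix.mul_apply] using h0

end CyclicAlgebra

/-! ### The number-theoretic data -/

/-- Congruence `x ≡ y (mod π)` between elements of the number field `E` that are integral at the
prime element `π` of `𝓞 E`: the difference `x - y` lies in `π` times the localization of `𝓞 E`
at `(π)`. -/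
def CongrMod {E : Type*} [Field E] (π : 𝓞 E) (x y : E) : Prop :=
  ∃ n s : 𝓞 E, ¬ π ∣ s ∧ (s : E) * (x - y) = (π : E) * (n : E)

/-- The objects and parameters that enter the construction of the lattices: a square root of `-7`
in `E`, the conjugation of `E`, a generator `σ` of the Galois group of `L / E`, the element
`ρ = ρ_{p₀}`, the element `δ`, the exponents `d`, `e`, and the element `b`. The conditions imposed
on them are hypotheses of the theorem. -/
structure CyclicData (E M L : Type*) [Field E] [NumberField E] [Field M] [NumberField M]
    [Field L] [NumberField L] [Algebra E L] [Algebra M L] where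
  sqrtNegSeven : E
  conj : E ≃ₐ[ℚ] E
  σ : L ≃ₐ[E] L
  orderOf_σ : orderOf σ = 5
  ρ : 𝓞 E
  δ : 𝓞 M
  d : ℕ
  e : ℕ
  b : 𝓞 E

namespace CyclicData

noncomputable section

variable {E M L : Type*} [Field E] [NumberField E] [Field M] [NumberField M]
  [Field L] [NumberField L] [Algebra E L] [Algebra M L] (x : CyclicData E M L)

/-- `ρ₂ = (1 + √-7) / 2`. -/
def ρ₂ : E := (1 + x.sqrtNegSeven) / 2

/-- `ρ̄₂ = (1 - √-7) / 2`. -/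
def ρ₂bar : E := (1 - x.sqrtNegSeven) / 2

/-- The conjugation on the ring of integers of `E`. -/
def conjInt : 𝓞 E ≃+* 𝓞 E := RingOfIntegers.mapRingEquiv x.conj.toRingEquiv

/-- The conjugate `ρ̄_{p₀}` of `ρ_{p₀}`. -/
def ρbar : 𝓞 E := x.conjInt x.ρ

/-- `a = a₁ᵉ`, where `a₁ = ρ₂ ρ_{p₀}ᵈ / (ρ̄₂ ρ̄_{p₀}ᵈ)`. -/
def a : E := (x.ρ₂ * (x.ρ : E) ^ x.d / (x.ρ₂bar * (x.ρbar : E) ^ x.d)) ^ x.e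

/-- The cyclic algebra `D = D(L, a)`. -/
def D : Subalgebra E (Matrix (Fin 5) (Fin 5) L) :=
  cyclicAlgebra x.σ (x.orderOf_σ ▸ pow_orderOf_eq_one x.σ) x.a

/-- The cyclic generator `u` of `D`. -/
def u : x.D :=
  ⟨cyclicGen (algebraMap E L x.a), Pi.single 1 1, by
    rw [Finset.sum_eq_single 1 (fun i _ hi => by simp [hi]) (by simp)]
    simp⟩

/-- The embedding of `L` into `D`. -/
def ofL : L →ₐ[E] x.D :=
  (twistedDiag x.σ).codRestrict x.D fun l => ⟨Pi.single 0 l, by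
    rw [Finset.sum_eq_single 0 (fun i _ hi => by simp [hi]) (by simp)]
    simp⟩

/-- The image of `δ` in `L`. -/
def δL : L := algebraMap M L x.δ

/-- `u₊ = u δ^{de}`. -/
def uPlus : x.D := x.u * x.ofL (x.δL ^ (x.d * x.e))

/-- `u₋ = u δ^{-de}`. -/
def uMinus : x.D := x.u * x.ofL ((x.δL ^ (x.d * x.e))⁻¹)

/-- `y₊ = (b - u₊) δ⁴ / ρ̄_{p₀}`. -/
def yPlus : x.D :=
  (x.ofL (algebraMap E L x.b) - x.uPlus) * x.ofL (x.δL ^ 4 / algebraMap E L x.ρbar)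

/-- `y₋ = (b - u₋) δ⁴ / ρ_{p₀}`. -/
def yMinus : x.D :=
  (x.ofL (algebraMap E L x.b) - x.uMinus) * x.ofL (x.δL ^ 4 / algebraMap E L x.ρ)

/-- The lattice `∑_{i=0}^4 yⁱ cᵢ 𝓞_L` in `D`, for `y ∈ D` and `c₀, …, c₄ ∈ E`. -/
def powerLattice (y : x.D) (c : Fin 5 → E) : Submodule (𝓞 E) x.D :=
  Submodule.span (𝓞 E)
    {z | ∃ (i : Fin 5) (l : 𝓞 L), z = y ^ (i : ℕ) * x.ofL (algebraMap E L (c i) * (l : L))}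

/-- The factor `ρ̄₂^⌈ei/5⌉ ρ₂^⌈-ei/5⌉`. -/
def c₂ (i : Fin 5) : E :=
  x.ρ₂bar ^ ⌈((x.e * i : ℕ) : ℚ) / 5⌉ * x.ρ₂ ^ ⌈-(((x.e * i : ℕ) : ℚ) / 5)⌉

/-- `Λ_D = ⨁ uⁱ ρ̄₂^⌈ei/5⌉ ρ̄_{p₀}^⌈dei/5⌉ ρ₂^⌈-ei/5⌉ ρ_{p₀}^⌈-dei/5⌉ 𝓞_L`. -/
def Λ : Submodule (𝓞 E) x.D :=
  x.powerLattice x.u fun i => x.c₂ i *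
    ((x.ρbar : E) ^ ⌈((x.d * x.e * i : ℕ) : ℚ) / 5⌉ *
      (x.ρ : E) ^ ⌈-(((x.d * x.e * i : ℕ) : ℚ) / 5)⌉)

/-- `Λ_{D,+} = ⨁ u₊ⁱ ρ̄₂^⌈ei/5⌉ ρ₂^⌈-ei/5⌉ ρ_{p₀}^⌈-2dei/5⌉ 𝓞_L`. -/
def ΛPlus : Submodule (𝓞 E) x.D :=
  x.powerLattice x.uPlus fun i => x.c₂ i *
    (x.ρ : E) ^ ⌈-(((2 * x.d * x.e * i : ℕ) : ℚ) / 5)⌉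

/-- `Λ_{D,+}^max = ⨁ y₊ⁱ ρ̄₂^⌈ei/5⌉ ρ₂^⌈-ei/5⌉ ρ_{p₀}^⌈-4i/5⌉ 𝓞_L`. -/
def ΛPlusMax : Submodule (𝓞 E) x.D :=
  x.powerLattice x.yPlus fun i => x.c₂ i * (x.ρ : E) ^ ⌈-(((4 * i : ℕ) : ℚ) / 5)⌉

/-- `Λ_{D,-} = ⨁ u₋ⁱ ρ̄₂^⌈ei/5⌉ ρ₂^⌈-ei/5⌉ ρ̄_{p₀}^⌈2dei/5⌉ 𝓞_L`. -/
def ΛMinus : Submodule (𝓞 E) x.D :=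
  x.powerLattice x.uMinus fun i => x.c₂ i *
    (x.ρbar : E) ^ ⌈((2 * x.d * x.e * i : ℕ) : ℚ) / 5⌉

/-- `Λ_{D,-}^max = ⨁ y₋ⁱ ρ̄₂^⌈ei/5⌉ ρ₂^⌈-ei/5⌉ ρ̄_{p₀}^⌈2dei/5⌉ 𝓞_L`. -/
def ΛMinusMax : Submodule (𝓞 E) x.D :=
  x.powerLattice x.yMinus fun i => x.c₂ i *
    (x.ρbar : E) ^ ⌈((2 * x.d * x.e * i : ℕ) : ℚ) / 5⌉

/-- `Λ_D^max = Λ_{D,+}^max + Λ_{D,-}^max`. -/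
def ΛMax : Submodule (𝓞 E) x.D := x.ΛPlusMax ⊔ x.ΛMinusMax

/-- The completion `D_v = E_v ⊗_E D` of `D` at a finite place `v` of `E`. -/
abbrev completionD (v : HeightOneSpectrum (𝓞 E)) : Type _ := v.adicCompletion E ⊗[E] x.D

/-- The completion `Λ_v ⊆ D_v` of a lattice `Λ` of `D`: the `𝓞_{E_v}`-module generated by `Λ`. -/
def localize (v : HeightOneSpectrum (𝓞 E)) (Λ : Submodule (𝓞 E) x.D) :
    Submodule (v.adicCompletionIntegers E) (x.completionD v) :=
  Submodule.span (v.adicCompletionIntegers E)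
    ((fun z : x.D => (1 : v.adicCompletion E) ⊗ₜ[E] z) '' (Λ : Set x.D))

end

end CyclicData

/-!
All assertions are local. A lattice is determined by its localizations inside `D` at the finite
places `v` of `E` (`le_of_forall_le_locAt`). As `D ⊗ E_v` is the sum of `D` and of the completion
of any lattice, an order of `D ⊗ E_v` that contains `Λ_v` is determined by its elements in `D`,
and these have bounded denominators with respect to `Λ`. The maximality of `Λ_v` can therefore be
tested with multiplicatively closed subsets of `D` with bounded denominators (`IsLocallyMaximal`).
This condition is verified at every place: it gives the local orders
(`IsLocallyMaximal.isMaximalOrderIn`) and the global one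
(`isMaximalOrderIn_of_forall_isLocallyMaximal`). Bounded denominators make the elements of such a
ring integral, hence their reduced traces too (`CyclicData.trace_coord_mem_locInt`).

At a place `v` above `2`, a prime element `π` of `E` stays prime in `L`, because `2` is inert in
`M`, and `a` has valuation `±e`, which is prime to `5`. In `∑ lᵢ uⁱ` the nonzero terms have
valuations that are distinct modulo `5` (with `v(u) = ±e` and `v(π) = 5`), so the minimum of the
valuations of the terms is multiplicative. Thus `D` has a valuation (`CyclicFrame.InertAt`); it
follows that `D` is a division algebra, that `⨁ uⁱ cᵢ 𝓞_L` is the valuation ring at `v`, and that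
it is maximal, since the powers of an element of negative valuation have unbounded denominators.

At the other places not dividing `p₀`, `a` is a unit and `L` is unramified, so that the integers
of `L` are their own trace dual; the integrality of reduced traces then bounds the coordinates of
every overring of `⨁ uⁱ 𝓞_L` (`CyclicFrame.isLocallyMaximal_of_unramified`). At all places not
dividing `p₀` the lattices coincide, because each of their generators is of the form `u m₁ + b m₀`
with `m₁` a unit and `m₀` integral, and `cₖ bᵏ⁻ʲ / cⱼ` is integral for `j ≤ k` as `2` divides `b`
(`CyclicFrame.powerSum_scaledInt_eq`).

At the places `ρ̄` and `ρ`, the extension `L` is totally and tamely ramified with uniformizer `δ`.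
Indeed an element of norm `p₀` that is not associated to its conjugates would make the trace form
of `M` nondegenerate modulo `p₀`, although `p₀` divides the discriminant
(`associated_map_of_dvd_discr`). With `U = u δ^{±de}`, the parameter `U⁵` is a unit congruent to
`b⁵` (`CyclicFrame.RamifiedAt`). Let `y = (b - U) δ⁴ / π`, an element with a simple pole in `δ`,
and let `R` be the lattice `⨁ yⁱ 𝓞_L`. The Cayley–Hamilton relation for `y` has integral
coefficients (`CyclicFrame.RamifiedAt.gen_pow_five_mem`), so that `R` is a ring, and it contains
`U`. By trace duality an overring of `R` has coordinates in `δ⁻⁴ 𝓞_L`. The leading term of an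
element `z` of the overring with a pole of order `m` is a polynomial `g` in `U` modulo `U⁵ - b⁵`;
that of `yᵐ` is a unit times `∏_{j < m} (b - ζʲ U)`, with `ζ` the residue of `σ(δ)/δ`, a primitive
fifth root of unity. As `z y⁵⁻ᵐ` cannot have a pole of order `5`, its leading term vanishes, and
this forces the product `∏_{j < m} (b - ζʲ U)` to divide `g`, so that the pole of `z` can be
removed by subtracting a multiple of `yᵐ`. Hence `R` is maximal
(`CyclicFrame.RamifiedAt.isLocallyMaximal`). The other lattices lie in `R` because `xⁱ cᵢ 𝓞_L`,
with `x` their generator and `cᵢ` their coefficients, has coordinates without poles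
(`CyclicFrame.RamifiedAt.powerSum_le_order`).
-/

/-! ### Lattices, their localizations and their completions -/

section Lattices

set_option linter.unusedSectionVars false

variable {R K : Type*} [CommRing R] [IsDedekindDomain R] [Field K] [Algebra R K]
  [IsFractionRing R K]

/-- The localization of a lattice `N` at the place `v`, inside the ambient space: all `z` such that
`s • z ∈ N` for some `s` outside the prime `v`. -/
def locAt (v : HeightOneSpectrum R) {V : Type*} [AddCommGroup V] [Module R V]
    (N : Submodule R V) : Submodule R V where
  carrier := {z | ∃ s : R, s ∉ v.asIdeal ∧ s • z ∈ N}
  add_mem' := by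
    rintro y z ⟨s, hs, hy⟩ ⟨t, ht, hz⟩
    refine ⟨s * t, v.isPrime.mul_notMem hs ht, ?_⟩
    rw [smul_add]
    refine N.add_mem ?_ ?_
    · rw [mul_comm, mul_smul]; exact N.smul_mem _ hy
    · rw [mul_smul]; exact N.smul_mem _ hz
  zero_mem' := ⟨1, fun h => v.isPrime.ne_top ((Ideal.eq_top_iff_one _).2 h), by simp⟩
  smul_mem' := by
    rintro r z ⟨s, hs, hz⟩
    exact ⟨s, hs, by rw [smul_comm]; exact N.smul_mem _ hz⟩

theorem HeightOneSpectrum.one_notMem (v : HeightOneSpectrum R) : (1 : R) ∉ v.asIdeal :=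
  fun h => v.isPrime.ne_top ((Ideal.eq_top_iff_one _).2 h)

theorem le_locAt (v : HeightOneSpectrum R) {V : Type*} [AddCommGroup V] [Module R V]
    (N : Submodule R V) : N ≤ locAt v N :=
  fun z hz => ⟨1, HeightOneSpectrum.one_notMem v, by simpa using hz⟩

theorem mem_locAt_of_smul_mem {v : HeightOneSpectrum R} {V : Type*} [AddCommGroup V] [Module R V]
    {N : Submodule R V} {s : R} (hs : s ∉ v.asIdeal) {z : V} (hz : s • z ∈ locAt v N) :
    z ∈ locAt v N := by
  obtain ⟨t, ht, h⟩ := hz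
  exact ⟨t * s, v.isPrime.mul_notMem ht hs, by rwa [mul_smul]⟩

theorem locAt_le_locAt_iff {v : HeightOneSpectrum R} {V : Type*} [AddCommGroup V] [Module R V]
    {N N' : Submodule R V} : locAt v N ≤ locAt v N' ↔ N ≤ locAt v N' := by
  refine ⟨fun h => (le_locAt v N).trans h, fun h z hz => ?_⟩
  obtain ⟨s, hs, hz⟩ := hz
  exact mem_locAt_of_smul_mem hs (h hz)

/-- A lattice is determined by its localizations. -/
theorem le_of_forall_le_locAt {V : Type*} [AddCommGroup V] [Module R V]
    {N N' : Submodule R V} (hR : ¬ IsField R) (h : ∀ v : HeightOneSpectrum R, N ≤ locAt v N') :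
    N ≤ N' := by
  intro z hz
  -- The ideal of the multipliers that carry `z` into `N'` lies in no maximal ideal.
  let I : Ideal R := N'.comap (LinearMap.toSpanSingleton R V z)
  suffices hI : I = ⊤ by
    have : (1 : R) ∈ I := hI ▸ Submodule.mem_top
    simpa [I] using this
  by_contra hI
  obtain ⟨m, hm, hle⟩ := Ideal.exists_le_maximal I hI
  obtain ⟨s, hs, hsz⟩ := h ⟨m, hm.isPrime, Ring.ne_bot_of_isMaximal_of_not_isField hm hR⟩ hz
  exact hs (hle (by simpa [I] using hsz))

variable {A : Type*} [Ring A] [Algebra K A] [Module R A] [IsScalarTower R K A]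

/-- The module generated by a lattice over the completed ring of integers. -/
noncomputable def completedSpan (v : HeightOneSpectrum R) (Λ : Submodule R A) :
    Submodule (v.adicCompletionIntegers K) (v.adicCompletion K ⊗[K] A) :=
  Submodule.span (v.adicCompletionIntegers K)
    ((fun z : A => (1 : v.adicCompletion K) ⊗ₜ[K] z) '' (Λ : Set A))

theorem tmul_algebraMap_smul (v : HeightOneSpectrum R) (r : R) (z : A) :
    (1 : v.adicCompletion K) ⊗ₜ[K] (r • z) =
      (algebraMap R (v.adicCompletionIntegers K) r) • ((1 : v.adicCompletion K) ⊗ₜ[K] z) := by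
  rw [← algebraMap_smul K r z, TensorProduct.tmul_smul, TensorProduct.smul_tmul',
    show ∀ (a : v.adicCompletionIntegers K) (x : v.adicCompletion K ⊗[K] A),
      a • x = (a : v.adicCompletion K) • x from fun _ _ => rfl, TensorProduct.smul_tmul']
  congr 1
  rw [algebraMap_smul, HeightOneSpectrum.algebraMap_adicCompletionIntegers_apply, Algebra.smul_def,
    smul_eq_mul]
  rfl

theorem isUnit_algebraMap_adicCompletionIntegers {v : HeightOneSpectrum R} {s : R}
    (hs : s ∉ v.asIdeal) : IsUnit (algebraMap R (v.adicCompletionIntegers K) s) := by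
  rw [HeightOneSpectrum.adicCompletionIntegers.isUnit_iff_valued_eq_one,
    HeightOneSpectrum.algebraMap_adicCompletionIntegers_apply,
    HeightOneSpectrum.valuedAdicCompletion_eq_valuation']
  exact v.valuation_eq_one_iff_notMem.2 hs

theorem mem_of_unit_smul_tmul_mem {v : HeightOneSpectrum R}
    {N : Submodule (v.adicCompletionIntegers K) (v.adicCompletion K ⊗[K] A)} {s : R}
    (hs : s ∉ v.asIdeal) {z : A} (h : (1 : v.adicCompletion K) ⊗ₜ[K] (s • z) ∈ N) :
    (1 : v.adicCompletion K) ⊗ₜ[K] z ∈ N := by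
  rw [tmul_algebraMap_smul] at h
  obtain ⟨w, hw⟩ := isUnit_algebraMap_adicCompletionIntegers (K := K) hs
  rw [← hw] at h
  have := N.smul_mem (↑w⁻¹ : v.adicCompletionIntegers K) h
  rwa [smul_smul, Units.inv_mul, one_smul] at this

theorem tmul_mem_completedSpan {v : HeightOneSpectrum R} {Λ : Submodule R A} {z : A}
    (hz : z ∈ locAt v Λ) : (1 : v.adicCompletion K) ⊗ₜ[K] z ∈ completedSpan v Λ := by
  obtain ⟨s, hs, hz⟩ := hz
  exact mem_of_unit_smul_tmul_mem hs (Submodule.subset_span ⟨_, hz, rfl⟩)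

theorem completedSpan_mono {v : HeightOneSpectrum R} {Λ Λ' : Submodule R A}
    (h : locAt v Λ ≤ locAt v Λ') : completedSpan (K := K) v Λ ≤ completedSpan v Λ' := by
  refine Submodule.span_le.2 ?_
  rintro _ ⟨z, hz, rfl⟩
  exact tmul_mem_completedSpan (h (le_locAt v Λ hz))

theorem completedSpan_congr {v : HeightOneSpectrum R} {Λ Λ' : Submodule R A}
    (h : locAt v Λ = locAt v Λ') : completedSpan (K := K) v Λ = completedSpan v Λ' :=
  le_antisymm (completedSpan_mono h.le) (completedSpan_mono h.ge)

/-- The completion of `K` is the sum of `K` and the ring of integers. -/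
theorem exists_sub_mem_adicCompletionIntegers (v : HeightOneSpectrum R) (x : v.adicCompletion K) :
    ∃ k : K, x - algebraMap K (v.adicCompletion K) k ∈ v.adicCompletionIntegers K := by
  obtain ⟨b, hb, h⟩ :=
    HeightOneSpectrum.adicCompletion.mul_nonZeroDivisor_mem_adicCompletionIntegers v x
  have hb0 := nonZeroDivisors.ne_zero hb
  -- `K` is dense in its completion, and the coset `x + 𝓞_v` is open.
  have hopen : IsOpen {y : v.adicCompletion K | x - y ∈ v.adicCompletionIntegers K} := by
    have : IsOpen ((v.adicCompletionIntegers K : Set (v.adicCompletion K))) :=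
      Valued.isOpen_valuationSubring _
    exact this.preimage (continuous_const.sub continuous_id)
  obtain ⟨y, hy, k, rfl⟩ :=
    (HeightOneSpectrum.denseRange_algebraMap (R := R) K v).inter_open_nonempty _ hopen ⟨x, by simp⟩
  exact ⟨k, hy⟩

/-- If a lattice spans `A`, then the completion of `A` is the sum of `A` and the completed
lattice. -/
theorem exists_sub_mem_completedSpan (v : HeightOneSpectrum R) {Λ : Submodule R A}
    (hΛ : Submodule.span K (Λ : Set A) = ⊤) (x : v.adicCompletion K ⊗[K] A) :
    ∃ z : A, x - (1 : v.adicCompletion K) ⊗ₜ[K] z ∈ completedSpan v Λ := by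
  induction x using TensorProduct.induction_on with
  | zero => exact ⟨0, by simp⟩
  | add x y hx hy =>
    obtain ⟨z, hz⟩ := hx
    obtain ⟨w, hw⟩ := hy
    refine ⟨z + w, ?_⟩
    rw [TensorProduct.tmul_add, add_sub_add_comm]
    exact add_mem hz hw
  | tmul e z =>
    have hz : z ∈ Submodule.span K (Λ : Set A) := hΛ ▸ Submodule.mem_top
    induction hz using Submodule.span_induction generalizing e with
    | mem z hz =>
      obtain ⟨k, hk⟩ := exists_sub_mem_adicCompletionIntegers v e
      refine ⟨k • z, ?_⟩
      have h := (completedSpan (K := K) v Λ).smul_mem ⟨_, hk⟩ (Submodule.subset_span ⟨z, hz, rfl⟩)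
      convert h using 1
      change _ = (e - algebraMap K (v.adicCompletion K) k) • ((1 : v.adicCompletion K) ⊗ₜ[K] z)
      rw [TensorProduct.smul_tmul', smul_eq_mul, mul_one, TensorProduct.sub_tmul,
        TensorProduct.tmul_smul, TensorProduct.smul_tmul', Algebra.smul_def, mul_one]
    | zero => exact ⟨0, by simp⟩
    | add y z _ _ hy hz =>
      obtain ⟨y', hy'⟩ := hy e
      obtain ⟨z', hz'⟩ := hz e
      refine ⟨y' + z', ?_⟩
      rw [TensorProduct.tmul_add, TensorProduct.tmul_add, add_sub_add_comm]
      exact add_mem hy' hz'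
    | smul k z _ hz =>
      obtain ⟨z', hz'⟩ := hz (k • e)
      exact ⟨z', by rwa [TensorProduct.tmul_smul, TensorProduct.smul_tmul']⟩

/-- The properties of a lattice `Λ` of `A` at the place `v` which ensure that its completion at `v`
is a maximal order: the localization is a ring, and it contains every multiplicatively closed
overlattice with bounded denominators. -/
structure IsLocallyMaximal (v : HeightOneSpectrum R) (Λ : Submodule R A) : Prop where
  one_mem : (1 : A) ∈ locAt v Λ
  mul_mem : ∀ x ∈ Λ, ∀ y ∈ Λ, x * y ∈ locAt v Λ
  maximal : ∀ Γ : Submodule R A, (∀ x ∈ Γ, ∀ y ∈ Γ, x * y ∈ Γ) → locAt v Γ ≤ Γ → Λ ≤ Γ →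
    (∃ r : R, r ≠ 0 ∧ ∀ z ∈ Γ, r • z ∈ locAt v Λ) → Γ ≤ locAt v Λ

theorem smul_mul_smul_of_tower (R K : Type*) {A : Type*} [CommRing R] [Field K] [Algebra R K]
    [Ring A] [Algebra K A] [Module R A] [IsScalarTower R K A] (s t : R) (x y : A) :
    (s • x) * (t • y) = (s * t) • (x * y) := by
  rw [← algebraMap_smul K s, ← algebraMap_smul K t, smul_mul_smul_comm, ← map_mul, algebraMap_smul]

theorem IsLocallyMaximal.mul_mem_locAt (K : Type*) [Field K] [Algebra R K] [Algebra K A]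
    [IsScalarTower R K A] {v : HeightOneSpectrum R} {Λ : Submodule R A}
    (h : IsLocallyMaximal v Λ) {x y : A} (hx : x ∈ locAt v Λ) (hy : y ∈ locAt v Λ) :
    x * y ∈ locAt v Λ := by
  obtain ⟨s, hs, hx⟩ := hx
  obtain ⟨t, ht, hy⟩ := hy
  refine mem_locAt_of_smul_mem (v.isPrime.mul_notMem hs ht) ?_
  rw [← smul_mul_smul_of_tower R K]
  exact h.mul_mem _ hx _ hy

theorem IsLocallyMaximal.congr (K : Type*) [Field K] [Algebra R K] [Algebra K A]
    [IsScalarTower R K A] {v : HeightOneSpectrum R} {Λ Λ' : Submodule R A}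
    (h : IsLocallyMaximal v Λ) (he : locAt v Λ' = locAt v Λ) : IsLocallyMaximal v Λ' where
  one_mem := he ▸ h.one_mem
  mul_mem x hx y hy := by
    rw [he]
    exact h.mul_mem_locAt K (he ▸ le_locAt v Λ' hx) (he ▸ le_locAt v Λ' hy)
  maximal Γ hm hs hle hb := by
    rw [he] at hb ⊢
    refine h.maximal Γ hm hs ?_ hb
    exact (le_locAt v Λ).trans (he ▸ (locAt_le_locAt_iff.2 (hle.trans (le_locAt v Γ))).trans hs)

theorem exists_basis_of_span_eq_top [FiniteDimensional K A] {Λ : Submodule R A}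
    (hΛ : Submodule.span K (Λ : Set A) = ⊤) :
    ∃ (ι : Type) (_ : Fintype ι) (e : Module.Basis ι K A), ∀ i, e i ∈ Λ := by
  obtain ⟨b, hb, hspan, hli⟩ := exists_linearIndependent K (Λ : Set A)
  let e := Module.Basis.mk hli (by rw [Subtype.range_coe, hspan, hΛ])
  have : Fintype b := FiniteDimensional.fintypeBasisIndex e
  refine ⟨Fin (Fintype.card b), inferInstance, e.reindex (Fintype.equivFin b), fun i => ?_⟩
  rw [Module.Basis.reindex_apply, Module.Basis.mk_apply]
  exact hb (Subtype.coe_prop _)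

/-- Finitely many conditions that are stable under multiples have a common nonzero solution. -/
theorem exists_ne_zero_forall_smul_mem {ι : Type*} (s : Finset ι) (P : ι → R → Prop)
    (hP : ∀ i r t, P i r → P i (t * r)) (h : ∀ i ∈ s, ∃ r ≠ 0, P i r) :
    ∃ r ≠ 0, ∀ i ∈ s, P i r := by
  classical
  induction s using Finset.induction_on with
  | empty => exact ⟨1, one_ne_zero, by simp⟩
  | insert a s _ ih =>
    obtain ⟨r, hr, h1⟩ := ih fun i hi => h i (Finset.mem_insert_of_mem hi)
    obtain ⟨t, ht, h2⟩ := h a (Finset.mem_insert_self a s)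
    refine ⟨r * t, mul_ne_zero hr ht, fun i hi => ?_⟩
    rcases Finset.mem_insert.1 hi with rfl | hi
    · exact hP _ _ _ h2
    · rw [mul_comm]; exact hP _ _ _ (h1 i hi)

/-- Elements of `A` lying in a finitely generated submodule of the completion of `A` have bounded
denominators with respect to a lattice spanning `A`. -/
theorem exists_smul_mem_locAt_of_fg [FiniteDimensional K A] (v : HeightOneSpectrum R)
    {Λ : Submodule R A} (hΛ : Submodule.span K (Λ : Set A) = ⊤)
    {N : Submodule (v.adicCompletionIntegers K) (v.adicCompletion K ⊗[K] A)} (hN : N.FG) :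
    ∃ r : R, r ≠ 0 ∧ ∀ z : A, (1 : v.adicCompletion K) ⊗ₜ[K] z ∈ N → r • z ∈ locAt v Λ := by
  obtain ⟨ι, _, e, he⟩ := exists_basis_of_span_eq_top hΛ
  let ê := Algebra.TensorProduct.basis (v.adicCompletion K) e
  obtain ⟨T, rfl⟩ := hN
  -- A common denominator for the coordinates of the generators of `N` in a basis contained in `Λ`.
  obtain ⟨r, hr, hrT⟩ := exists_ne_zero_forall_smul_mem (R := R) (T ×ˢ (Finset.univ : Finset ι))
    (fun p r => algebraMap R (v.adicCompletion K) r * ê.repr p.1 p.2 ∈ v.adicCompletionIntegers K)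
    (fun p r t h => by
      rw [map_mul, mul_assoc]
      exact mul_mem (HeightOneSpectrum.coe_mem_adicCompletionIntegers v t) h)
    (fun p _ => by
      obtain ⟨b, hb, h⟩ :=
        HeightOneSpectrum.adicCompletion.mul_nonZeroDivisor_mem_adicCompletionIntegers v
          (ê.repr p.1 p.2)
      exact ⟨b, nonZeroDivisors.ne_zero hb, by rw [mul_comm]; exact h⟩)
  refine ⟨r, hr, fun z hz => ?_⟩
  have key : ∀ w ∈ Submodule.span (v.adicCompletionIntegers K) (T : Set _), ∀ i,
      algebraMap R (v.adicCompletion K) r * ê.repr w i ∈ v.adicCompletionIntegers K := by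
    intro w hw i
    induction hw using Submodule.span_induction with
    | mem w hw => exact hrT (w, i) (by simpa using hw)
    | zero => simp
    | add x y _ _ hx hy => rw [map_add, Finsupp.add_apply, mul_add]; exact add_mem hx hy
    | smul a x _ hx =>
      change algebraMap R (v.adicCompletion K) r * ê.repr ((a : v.adicCompletion K) • x) i ∈ _
      rw [map_smul, Finsupp.smul_apply, smul_eq_mul, mul_left_comm]
      exact mul_mem a.2 hx
  rw [← e.sum_repr z, Finset.smul_sum]
  refine sum_mem fun i _ => ?_
  have h := key _ hz i
  rw [Algebra.TensorProduct.basis_repr_tmul, Finsupp.smul_apply, one_smul,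
    Finsupp.mapRange_apply, IsScalarTower.algebraMap_apply R K, ← map_mul,
    HeightOneSpectrum.mem_adicCompletionIntegers,
    show algebraMap K (v.adicCompletion K) (algebraMap R K r * e.repr z i) =
      ((algebraMap R K r * e.repr z i : K) : v.adicCompletion K) from rfl,
    HeightOneSpectrum.valuedAdicCompletion_eq_valuation'] at h
  -- An element of `K` that is integral in the completion has a denominator prime to `v`.
  obtain ⟨n, d, hnd⟩ := HeightOneSpectrum.exists_primeCompl_mul_eq_of_integer v _ h
  refine ⟨d, d.2, ?_⟩
  have : (d : R) • r • (e.repr z) i • e i = n • e i := by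
    rw [← algebraMap_smul K r, ← algebraMap_smul K (d : R), ← algebraMap_smul K n, smul_smul,
      smul_smul, ← hnd]
    congr 1; ring
  rw [this]
  exact Λ.smul_mem _ (he i)

theorem span_completedSpan (v : HeightOneSpectrum R) {Λ : Submodule R A}
    (hΛ : Submodule.span K (Λ : Set A) = ⊤) :
    Submodule.span (v.adicCompletion K)
      ((completedSpan (K := K) v Λ : Submodule _ _) : Set (v.adicCompletion K ⊗[K] A)) = ⊤ := by
  rw [eq_top_iff]
  rintro x -
  induction x using TensorProduct.induction_on with
  | zero => exact zero_mem _
  | add x y hx hy => exact add_mem hx hy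
  | tmul e z =>
    have hz : z ∈ Submodule.span K (Λ : Set A) := hΛ ▸ Submodule.mem_top
    induction hz using Submodule.span_induction generalizing e with
    | mem z hz =>
      have := Submodule.smul_mem (Submodule.span (v.adicCompletion K)
        ((completedSpan (K := K) v Λ : Submodule _ _) : Set (v.adicCompletion K ⊗[K] A))) e
        (Submodule.subset_span (Submodule.subset_span ⟨z, hz, rfl⟩))
      simpa [TensorProduct.smul_tmul'] using this
    | zero => simp
    | add y z _ _ hy hz => rw [TensorProduct.tmul_add]; exact add_mem (hy e) (hz e)
    | smul k z _ hz =>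
      rw [TensorProduct.tmul_smul, TensorProduct.smul_tmul']
      exact hz _

theorem isOrderIn_completedSpan {v : HeightOneSpectrum R} {Λ : Submodule R A} (hfg : Λ.FG)
    (hΛ : Submodule.span K (Λ : Set A) = ⊤) (h : IsLocallyMaximal v Λ) :
    IsOrderIn (v.adicCompletionIntegers K) (v.adicCompletion K) (completedSpan (K := K) v Λ) where
  fg := by
    classical
    obtain ⟨T, rfl⟩ := hfg
    refine ⟨T.image fun z : A => (1 : v.adicCompletion K) ⊗ₜ[K] z, le_antisymm ?_ ?_⟩
    · refine Submodule.span_mono ?_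
      rw [Finset.coe_image]
      exact Set.image_mono Submodule.subset_span
    · refine Submodule.span_le.2 ?_
      rintro _ ⟨z, hz, rfl⟩
      change (1 : v.adicCompletion K) ⊗ₜ[K] z ∈ Submodule.span _ _
      induction hz using Submodule.span_induction with
      | mem z hz => exact Submodule.subset_span (by
          rw [Finset.coe_image]; exact ⟨z, hz, rfl⟩)
      | zero => simp
      | add x y _ _ hx hy => rw [TensorProduct.tmul_add]; exact add_mem hx hy
      | smul r x _ hx => rw [tmul_algebraMap_smul]; exact Submodule.smul_mem _ _ hx
  span_eq_top := span_completedSpan v hΛ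
  one_mem := tmul_mem_completedSpan h.one_mem
  mul_mem := by
    intro x hx y hy
    induction hx using Submodule.span_induction with
    | mem x hx =>
      obtain ⟨x, hx, rfl⟩ := hx
      induction hy using Submodule.span_induction with
      | mem y hy =>
        obtain ⟨y, hy, rfl⟩ := hy
        change (1 : v.adicCompletion K) ⊗ₜ[K] x * (1 : v.adicCompletion K) ⊗ₜ[K] y ∈ _
        rw [Algebra.TensorProduct.tmul_mul_tmul, one_mul]
        exact tmul_mem_completedSpan (h.mul_mem x hx y hy)
      | zero => simp
      | add y z _ _ hy hz => rw [mul_add]; exact add_mem hy hz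
      | smul a y _ hy =>
        change _ * ((a : v.adicCompletion K) • y) ∈ _
        rw [mul_smul_comm]
        exact Submodule.smul_mem _ a hy
    | zero => simp
    | add x z _ _ hx hz => rw [add_mul]; exact add_mem hx hz
    | smul a x _ hx =>
      change ((a : v.adicCompletion K) • x) * _ ∈ _
      rw [smul_mul_assoc]
      exact Submodule.smul_mem _ a hx

/-- An order of the completed algebra containing the completed lattice is generated by the lattice
and by elements of `A`; hence the maximality can be tested inside `A`. -/
theorem IsLocallyMaximal.isMaximalOrderIn [FiniteDimensional K A] {v : HeightOneSpectrum R}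
    {Λ : Submodule R A} (h : IsLocallyMaximal v Λ) (hfg : Λ.FG)
    (hΛ : Submodule.span K (Λ : Set A) = ⊤) :
    IsMaximalOrderIn (v.adicCompletionIntegers K) (v.adicCompletion K)
      (completedSpan (K := K) v Λ) := by
  refine ⟨isOrderIn_completedSpan hfg hΛ h, fun Γ hΓ hle => le_antisymm ?_ hle⟩
  -- The elements of `A` that lie in the larger order `Γ`.
  let Γ' : Submodule R A :=
    { carrier := {z | (1 : v.adicCompletion K) ⊗ₜ[K] z ∈ Γ}
      add_mem' := fun {x y} hx hy => by
        change (1 : v.adicCompletion K) ⊗ₜ[K] (x + y) ∈ Γ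
        rw [TensorProduct.tmul_add]; exact add_mem hx hy
      zero_mem' := by simp
      smul_mem' := fun r x hx => by
        change (1 : v.adicCompletion K) ⊗ₜ[K] (r • x) ∈ Γ
        rw [tmul_algebraMap_smul]; exact Γ.smul_mem _ hx }
  have hΓ' : Γ' ≤ locAt v Λ := by
    refine h.maximal Γ' (fun x hx y hy => ?_) ?_ ?_ ?_
    · have := hΓ.mul_mem _ hx _ hy
      rwa [Algebra.TensorProduct.tmul_mul_tmul, one_mul] at this
    · rintro z ⟨s, hs, hz⟩
      exact mem_of_unit_smul_tmul_mem hs hz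
    · exact fun z hz => hle (tmul_mem_completedSpan (le_locAt v Λ hz))
    · exact exists_smul_mem_locAt_of_fg v hΛ hΓ.fg
  intro x hx
  -- Up to an element of the completed lattice, `x` lies in `A`, and then in `Γ'`.
  obtain ⟨z, hz⟩ := exists_sub_mem_completedSpan v hΛ x
  have hz' : z ∈ Γ' := by
    have := Γ.sub_mem hx (hle hz)
    rwa [sub_sub_cancel] at this
  have := add_mem hz (tmul_mem_completedSpan (hΓ' hz'))
  rwa [sub_add_cancel] at this

/-- A lattice has bounded denominators with respect to a lattice spanning `A`. -/
theorem exists_smul_mem_of_fg [FiniteDimensional K A]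
    {Λ Γ : Submodule R A} (hΛ : Submodule.span K (Λ : Set A) = ⊤) (hΓ : Γ.FG) :
    ∃ r : R, r ≠ 0 ∧ ∀ z ∈ Γ, r • z ∈ Λ := by
  have aux : ∀ z : A, ∃ r : R, r ≠ 0 ∧ r • z ∈ Λ := by
    intro z
    have hz : z ∈ Submodule.span K (Λ : Set A) := hΛ ▸ Submodule.mem_top
    induction hz using Submodule.span_induction with
    | mem z hz => exact ⟨1, one_ne_zero, by simpa using hz⟩
    | zero => exact ⟨1, one_ne_zero, by simp⟩
    | add x y _ _ hx hy =>
      obtain ⟨r, hr, hx⟩ := hx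
      obtain ⟨s, hs, hy⟩ := hy
      refine ⟨r * s, mul_ne_zero hr hs, ?_⟩
      rw [smul_add]
      refine add_mem ?_ ?_
      · rw [mul_comm, mul_smul]; exact Λ.smul_mem _ hx
      · rw [mul_smul]; exact Λ.smul_mem _ hy
    | smul k x _ hx =>
      obtain ⟨r, hr, hx⟩ := hx
      obtain ⟨⟨n, d⟩, hnd⟩ := IsLocalization.surj (nonZeroDivisors R) k
      refine ⟨d * r, mul_ne_zero (nonZeroDivisors.ne_zero d.2) hr, ?_⟩
      have : ((d : R) * r) • k • x = n • r • x := by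
        rw [← algebraMap_smul K ((d : R) * r), ← algebraMap_smul K n, ← algebraMap_smul K r,
          smul_smul, smul_smul, ← hnd, map_mul]
        congr 1; ring
      rw [this]
      exact Λ.smul_mem _ hx
  obtain ⟨T, rfl⟩ := hΓ
  obtain ⟨r, hr, h⟩ := exists_ne_zero_forall_smul_mem (R := R) T (fun z r => r • z ∈ Λ)
    (fun z r t h => by rw [mul_smul]; exact Λ.smul_mem _ h) (fun z _ => aux z)
  refine ⟨r, hr, fun z hz => ?_⟩
  induction hz using Submodule.span_induction with
  | mem z hz => exact h z hz
  | zero => simp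
  | add x y _ _ hx hy => rw [smul_add]; exact add_mem hx hy
  | smul a x _ hx => rw [smul_comm]; exact Λ.smul_mem _ hx

/-- A lattice that is locally maximal at every place is a maximal order. -/
theorem isMaximalOrderIn_of_forall_isLocallyMaximal [FiniteDimensional K A] (hR : ¬ IsField R)
    {Λ : Submodule R A} (hfg : Λ.FG) (hΛ : Submodule.span K (Λ : Set A) = ⊤)
    (h : ∀ v : HeightOneSpectrum R, IsLocallyMaximal v Λ) : IsMaximalOrderIn R K Λ := by
  have hmem : ∀ z : A, (∀ v : HeightOneSpectrum R, z ∈ locAt v Λ) → z ∈ Λ := fun z hz =>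
    le_of_forall_le_locAt (N := R ∙ z) hR
      (fun v => (Submodule.span_singleton_le_iff_mem _ _).2 (hz v))
      (Submodule.mem_span_singleton_self z)
  refine ⟨⟨hfg, hΛ, hmem _ fun v => (h v).one_mem,
    fun x hx y hy => hmem _ fun v => (h v).mul_mem x hx y hy⟩, fun Γ hΓ hle =>
    le_antisymm (le_of_forall_le_locAt hR fun v => (le_locAt v Γ).trans ?_) hle⟩
  refine (h v).maximal (locAt v Γ) ?_ ?_ (hle.trans (le_locAt v Γ)) ?_
  · rintro x ⟨s, hs, hx⟩ y ⟨t, ht, hy⟩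
    refine ⟨s * t, v.isPrime.mul_notMem hs ht, ?_⟩
    rw [← smul_mul_smul_of_tower R K]
    exact hΓ.mul_mem _ hx _ hy
  · exact locAt_le_locAt_iff.2 le_rfl
  · obtain ⟨r, hr, h⟩ := exists_smul_mem_of_fg hΛ hΓ.fg
    refine ⟨r, hr, ?_⟩
    rintro z ⟨s, hs, hz⟩
    exact ⟨s, hs, by rw [smul_comm]; exact h _ hz⟩

/-- Spanning is inherited by lattices that agree at one place. -/
theorem span_eq_top_of_le_locAt {v : HeightOneSpectrum R} {Λ Λ' : Submodule R A}
    (hΛ : Submodule.span K (Λ : Set A) = ⊤) (h : Λ ≤ locAt v Λ') :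
    Submodule.span K (Λ' : Set A) = ⊤ := by
  rw [eq_top_iff, ← hΛ, Submodule.span_le]
  intro z hz
  obtain ⟨s, hs, hsz⟩ := h hz
  have hs0 : algebraMap R K s ≠ 0 := by
    rw [Ne, FaithfulSMul.algebraMap_eq_zero_iff]
    rintro rfl
    exact hs (zero_mem _)
  have := Submodule.smul_mem (Submodule.span K (Λ' : Set A)) (algebraMap R K s)⁻¹
    (Submodule.subset_span hsz)
  rwa [← algebraMap_smul K s z, smul_smul, inv_mul_cancel₀ hs0, one_smul] at this

end Lattices

/-! ### Elements integral at a place -/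

theorem NumberField.RingOfIntegers.val_mul {E : Type*} [Field E] (a b : 𝓞 E) :
    ((a * b : 𝓞 E) : E) = a * b := map_mul _ a b

theorem NumberField.RingOfIntegers.val_add {E : Type*} [Field E] (a b : 𝓞 E) :
    ((a + b : 𝓞 E) : E) = a + b := map_add _ a b

theorem NumberField.RingOfIntegers.val_sub {E : Type*} [Field E] (a b : 𝓞 E) :
    ((a - b : 𝓞 E) : E) = a - b := map_sub _ a b

theorem NumberField.RingOfIntegers.val_sum {E ι : Type*} [Field E] (s : Finset ι) (f : ι → 𝓞 E) :
    ((∑ i ∈ s, f i : 𝓞 E) : E) = ∑ i ∈ s, (f i : E) := map_sum (algebraMap (𝓞 E) E) f s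

theorem NumberField.RingOfIntegers.val_prod {E ι : Type*} [Field E] (s : Finset ι) (f : ι → 𝓞 E) :
    ((∏ i ∈ s, f i : 𝓞 E) : E) = ∏ i ∈ s, (f i : E) := map_prod (algebraMap (𝓞 E) E) f s

theorem NumberField.RingOfIntegers.val_intCast {E : Type*} [Field E] (k : ℤ) :
    ((k : 𝓞 E) : E) = k := map_intCast (algebraMap (𝓞 E) E) k

theorem NumberField.RingOfIntegers.val_natCast {E : Type*} [Field E] (k : ℕ) :
    ((k : 𝓞 E) : E) = k := map_natCast (algebraMap (𝓞 E) E) k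

theorem NumberField.RingOfIntegers.val_two {E : Type*} [Field E] : ((2 : 𝓞 E) : E) = 2 :=
  map_ofNat (algebraMap (𝓞 E) E) 2

theorem NumberField.RingOfIntegers.val_pow {E : Type*} [Field E] (a : 𝓞 E) (n : ℕ) :
    ((a ^ n : 𝓞 E) : E) = (a : E) ^ n := map_pow _ a n

section LocInt

set_option linter.unusedSectionVars false

variable {E : Type*} [Field E] [NumberField E] (v : HeightOneSpectrum (𝓞 E))
  (L : Type*) [Field L] [Algebra E L]

/-- The elements of an extension `L` of `E` that are integral at the place `v` of `E`. For `L = E`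
this is the localization of `𝓞 E` at `v`. -/
def locInt : Subring L where
  carrier := {l | ∃ s : 𝓞 E, s ∉ v.asIdeal ∧ IsIntegral ℤ (algebraMap E L s * l)}
  mul_mem' := by
    rintro a b ⟨s, hs, ha⟩ ⟨t, ht, hb⟩
    refine ⟨s * t, v.isPrime.mul_notMem hs ht, ?_⟩
    have h := ha.mul hb
    rwa [show algebraMap E L s * a * (algebraMap E L t * b) =
      algebraMap E L ((s * t : 𝓞 E) : E) * (a * b) by
        rw [RingOfIntegers.val_mul, map_mul]; ring] at h
  one_mem' := ⟨1, HeightOneSpectrum.one_notMem v, by simpa using isIntegral_one⟩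
  add_mem' := by
    rintro a b ⟨s, hs, ha⟩ ⟨t, ht, hb⟩
    refine ⟨s * t, v.isPrime.mul_notMem hs ht, ?_⟩
    have h := (((RingOfIntegers.isIntegral_coe t).map (algebraMap E L).toIntAlgHom).mul ha).add
      (((RingOfIntegers.isIntegral_coe s).map (algebraMap E L).toIntAlgHom).mul hb)
    simp only [RingHom.toIntAlgHom_apply] at h
    rwa [show algebraMap E L t * (algebraMap E L s * a) + algebraMap E L s * (algebraMap E L t * b) =
      algebraMap E L ((s * t : 𝓞 E) : E) * (a + b) by
        rw [RingOfIntegers.val_mul, map_mul]; ring] at h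
  zero_mem' := ⟨1, HeightOneSpectrum.one_notMem v, by simpa using isIntegral_zero⟩
  neg_mem' := by
    rintro a ⟨s, hs, ha⟩
    exact ⟨s, hs, by rw [mul_neg]; exact ha.neg⟩

variable {v L}

theorem mem_locInt_of_isIntegral {l : L} (h : IsIntegral ℤ l) : l ∈ locInt v L :=
  ⟨1, HeightOneSpectrum.one_notMem v, by simpa using h⟩

theorem mem_locInt_self {e : E} :
    e ∈ locInt v E ↔ ∃ s n : 𝓞 E, s ∉ v.asIdeal ∧ (s : E) * e = n := by
  constructor
  · rintro ⟨s, hs, h⟩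
    exact ⟨s, ⟨_, h⟩, hs, rfl⟩
  · rintro ⟨s, n, hs, h⟩
    exact ⟨s, hs, by rw [Algebra.algebraMap_self_apply, h]; exact n.isIntegral_coe⟩

theorem coe_mem_locInt (n : 𝓞 E) : (n : E) ∈ locInt v E :=
  mem_locInt_of_isIntegral n.isIntegral_coe

theorem algebraMap_mem_locInt_iff {e : E} : algebraMap E L e ∈ locInt v L ↔ e ∈ locInt v E := by
  constructor
  · rintro ⟨s, hs, h⟩
    refine ⟨s, hs, ?_⟩
    rw [← map_mul] at h
    rwa [Algebra.algebraMap_self_apply, ← isIntegral_algHom_iff (algebraMap E L).toIntAlgHom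
      (algebraMap E L).injective]
  · rintro ⟨s, hs, h⟩
    refine ⟨s, hs, ?_⟩
    rw [← map_mul]
    exact h.map (algebraMap E L).toIntAlgHom

theorem algebraMap_mem_locInt {e : E} (h : e ∈ locInt v E) : algebraMap E L e ∈ locInt v L :=
  algebraMap_mem_locInt_iff.2 h

theorem algebraMap_coe_mem_locInt (n : 𝓞 E) : algebraMap E L (n : E) ∈ locInt v L :=
  algebraMap_mem_locInt (coe_mem_locInt n)

theorem ne_zero_of_notMem {s : 𝓞 E} (hs : s ∉ v.asIdeal) : (s : E) ≠ 0 := by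
  intro h
  rw [RingOfIntegers.coe_eq_zero_iff] at h
  exact hs (h ▸ zero_mem _)

theorem inv_coe_mem_locInt {s : 𝓞 E} (hs : s ∉ v.asIdeal) : (s : E)⁻¹ ∈ locInt v E :=
  mem_locInt_self.2 ⟨s, 1, hs, by simp [ne_zero_of_notMem hs]⟩

theorem coe_mul_ne_one_of_mem {p : 𝓞 E} (hp : p ∈ v.asIdeal) {e : E} (he : e ∈ locInt v E) :
    (p : E) * e ≠ 1 := by
  intro h
  obtain ⟨s, n, hs, hn⟩ := mem_locInt_self.1 he
  apply hs
  have : s = p * n := by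
    apply RingOfIntegers.coe_injective
    change (s : E) = ((p * n : 𝓞 E) : E)
    rw [RingOfIntegers.val_mul, ← hn, mul_left_comm, h, mul_one]
  rw [this]
  exact v.asIdeal.mul_mem_right _ hp

/-- An algebraic integer of `E` that is a multiple of `π` locally at `v = (π)` lies in `v`. -/
theorem mem_asIdeal_of_div_mem_locInt {π : 𝓞 E} (hπ : v.asIdeal = Ideal.span {π}) {n : 𝓞 E}
    {e : E} (he : e ∈ locInt v E) (h : (n : E) = π * e) : n ∈ v.asIdeal := by
  obtain ⟨s, m, hs, hm⟩ := mem_locInt_self.1 he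
  have h1 : s * n = π * m := by
    apply RingOfIntegers.coe_injective
    change ((s * n : 𝓞 E) : E) = ((π * m : 𝓞 E) : E)
    rw [RingOfIntegers.val_mul, RingOfIntegers.val_mul, h, ← hm]; ring
  refine (v.isPrime.mem_or_mem (x := s) (y := n) ?_).resolve_left hs
  rw [h1, hπ]
  exact Ideal.mul_mem_right _ _ (Ideal.mem_span_singleton_self _)

/-- The residue field of the localization at `v = (π)` is that of `𝓞 E`. -/
theorem exists_coe_sub_mem {π : 𝓞 E} (hπ : v.asIdeal = Ideal.span {π}) {e : E}
    (he : e ∈ locInt v E) : ∃ n : 𝓞 E, ∃ f ∈ locInt v E, e = n + π * f := by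
  obtain ⟨s, n, hs, hn⟩ := mem_locInt_self.1 he
  have hmax := v.isMaximal
  obtain ⟨t, ht⟩ : ∃ t, s * t - 1 ∈ v.asIdeal := by
    obtain ⟨y, i, hi, h⟩ := hmax.exists_inv hs
    exact ⟨y, by rw [← h]; simpa [mul_comm] using v.asIdeal.neg_mem hi⟩
  rw [hπ, Ideal.mem_span_singleton] at ht
  obtain ⟨k, hk⟩ := ht
  refine ⟨n * t, -(k * e), neg_mem (mul_mem (coe_mem_locInt _) he), ?_⟩
  have hk' : (s : E) * t - 1 = π * k := by exact_mod_cast congrArg (algebraMap (𝓞 E) E) hk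
  push_cast
  linear_combination (t : E) * hn - e * hk'

theorem map_mem_locInt (σ : L ≃ₐ[E] L) {l : L} (hl : l ∈ locInt v L) : σ l ∈ locInt v L := by
  obtain ⟨s, hs, h⟩ := hl
  refine ⟨s, hs, ?_⟩
  have := h.map (σ : L →+* L).toIntAlgHom
  simpa using this

theorem pow_map_mem_locInt (σ : L ≃ₐ[E] L) (i : ℕ) {l : L} (hl : l ∈ locInt v L) :
    (σ ^ i) l ∈ locInt v L := map_mem_locInt _ hl

theorem trace_mem_locInt [FiniteDimensional E L] {l : L} (hl : l ∈ locInt v L) :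
    Algebra.trace E L l ∈ locInt v E := by
  obtain ⟨s, hs, h⟩ := hl
  refine ⟨s, hs, ?_⟩
  rw [← Algebra.smul_def] at h
  have := Algebra.isIntegral_trace (L := E) h
  rwa [map_smul] at this

/-- Every element of `L` becomes integral after multiplication with a nonzero integer of `E`. -/
theorem exists_mul_mem_locInt [CharZero L] [Algebra.IsAlgebraic ℚ L]
    (v : HeightOneSpectrum (𝓞 E)) (l : L) :
    ∃ r : 𝓞 E, r ≠ 0 ∧ algebraMap E L r * l ∈ locInt v L := by
  have h1 : IsAlgebraic ℚ l := Algebra.IsAlgebraic.isAlgebraic l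
  have : IsAlgebraic ℤ l := (IsFractionRing.isAlgebraic_iff ℤ ℚ L).2 h1
  obtain ⟨r, hr, h⟩ := this.exists_integral_multiple
  refine ⟨r, by exact_mod_cast hr, mem_locInt_of_isIntegral ?_⟩
  simpa [zsmul_eq_mul] using h

theorem exists_pow_mul_unit {π : 𝓞 E} (hπ : v.asIdeal = Ideal.span {π}) {r : 𝓞 E} (hr : r ≠ 0) :
    ∃ (k : ℕ) (s : 𝓞 E), s ∉ v.asIdeal ∧ r = π ^ k * s := by
  have hp : Prime π := by
    rw [← Ideal.span_singleton_prime, ← hπ]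
    · exact v.isPrime
    · rintro rfl
      exact v.ne_bot (by rw [hπ]; simp)
  obtain ⟨k, s, hs, h⟩ := WfDvdMonoid.max_power_factor hr hp.irreducible
  exact ⟨k, s, by rwa [hπ, Ideal.mem_span_singleton], h⟩

open HeightOneSpectrum in
theorem mem_locInt_of_isIntegral_valuationSubring {l : L}
    (h : IsIntegral (valuationSubringAtPrime E v) l) : l ∈ locInt v L := by
  have : IsScalarTower (𝓞 E) (valuationSubringAtPrime E v) L :=
    IsScalarTower.of_algebraMap_eq fun x => rfl
  obtain ⟨s, hs⟩ := IsIntegral.exists_multiple_integral_of_isLocalization v.asIdeal.primeCompl l h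
  refine ⟨s, s.2, ?_⟩
  have h2 : IsIntegral ℤ ((s : 𝓞 E) • l) := isIntegral_trans (A := 𝓞 E) _ hs
  rw [← algebraMap_smul E (s : 𝓞 E) l, Algebra.smul_def] at h2
  exact h2

open HeightOneSpectrum in
/-- An element whose powers have bounded denominators is integral. -/
theorem isIntegral_of_forall_smul_pow_mem {A : Type*} [Ring A] [Algebra E A]
    {N : Submodule (𝓞 E) A} (hN : N.FG) {z : A} {r : 𝓞 E} (hr : r ≠ 0)
    (h : ∀ n : ℕ, r • z ^ n ∈ locAt v N) : IsIntegral (valuationSubringAtPrime E v) z := by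
  have tower : ∀ (a : 𝓞 E) (x : A),
      (algebraMap (𝓞 E) (valuationSubringAtPrime E v) a) • x = a • x := fun a x => by
    rw [← algebraMap_smul E a x]; rfl
  -- The localized lattice is a Noetherian module over the localization `V` of `𝓞 E`, and it
  -- contains `r V[z]`; hence `V[z]` is finitely generated.
  let NV : Submodule (valuationSubringAtPrime E v) A := Submodule.span _ (N : Set A)
  have hNV : NV.FG := by
    obtain ⟨T, rfl⟩ := hN
    refine ⟨T, le_antisymm (Submodule.span_mono Submodule.subset_span) (Submodule.span_le.2 ?_)⟩
    intro x hx
    change x ∈ Submodule.span _ _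
    induction hx using Submodule.span_induction with
    | mem z hz => exact Submodule.subset_span hz
    | zero => simp
    | add x y _ _ hx hy => exact add_mem hx hy
    | smul a x _ hx =>
      change a • x ∈ Submodule.span (valuationSubringAtPrime E v) (T : Set A)
      rw [← tower]; exact Submodule.smul_mem _ _ hx
  have hloc : ∀ x ∈ locAt v N, x ∈ NV := by
    rintro x ⟨s, hs, hx⟩
    obtain ⟨w, hw⟩ := IsLocalization.map_units (valuationSubringAtPrime E v)
      (⟨s, hs⟩ : v.asIdeal.primeCompl)
    have h1 : s • x ∈ NV := Submodule.subset_span (SetLike.mem_coe.2 hx)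
    rw [← tower, ← hw] at h1
    have := NV.smul_mem (↑w⁻¹ : valuationSubringAtPrime E v) h1
    rwa [smul_smul, Units.inv_mul, one_smul] at this
  have : IsNoetherian (valuationSubringAtPrime E v) NV := isNoetherian_of_fg_of_noetherian NV hNV
  rw [isNoetherian_submodule] at this
  refine IsIntegral.of_mem_of_fg (Algebra.adjoin (valuationSubringAtPrime E v) {z}) ?_ z
    (Algebra.self_mem_adjoin_singleton _ _)
  let f : A →ₗ[valuationSubringAtPrime E v] A :=
    LinearMap.lsmul _ A (algebraMap (𝓞 E) (valuationSubringAtPrime E v) r)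
  have hf : Function.Injective f := by
    intro x y hxy
    have h1 : (algebraMap (𝓞 E) (valuationSubringAtPrime E v) r) • x =
      (algebraMap (𝓞 E) (valuationSubringAtPrime E v) r) • y := hxy
    rw [tower, tower, ← algebraMap_smul E r x, ← algebraMap_smul E r y] at h1
    exact smul_right_injective A (by simpa using hr) h1
  refine Submodule.fg_of_fg_map_injective f hf (this _ ?_)
  rw [Submodule.map_le_iff_le_comap]
  intro x hx
  rw [Subalgebra.mem_toSubmodule, Algebra.adjoin_singleton_eq_range_aeval] at hx
  obtain ⟨p, rfl⟩ := hx
  change Polynomial.aeval z p ∈ _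
  rw [Polynomial.aeval_eq_sum_range, Submodule.mem_comap, map_sum]
  refine sum_mem fun i _ => ?_
  rw [map_smul]
  refine NV.smul_mem _ (hloc _ ?_)
  change (algebraMap (𝓞 E) (valuationSubringAtPrime E v) r) • z ^ i ∈ locAt v N
  rw [tower]
  exact h i

/-- The trace of an integral matrix is integral: it is the sum of the eigenvalues. -/
theorem Matrix.isIntegral_trace_of_isIntegral {V F n : Type*} [CommRing V] [Field F] [Algebra V F]
    [Fintype n] [DecidableEq n] {Z : Matrix n n F} (hZ : IsIntegral V Z) :
    IsIntegral V Z.trace := by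
  let Ω := AlgebraicClosure F
  let f : F →ₐ[V] Ω := IsScalarTower.toAlgHom V F Ω
  have hZ' : IsIntegral V (f.mapMatrix Z) := hZ.map f.mapMatrix
  obtain ⟨p, hp, hpZ⟩ := hZ'
  rw [← isIntegral_algHom_iff f (algebraMap F Ω).injective]
  have htr : f Z.trace = (f.mapMatrix Z).trace := by
    simp [Matrix.trace]
  rw [htr, Matrix.trace_eq_sum_roots_charpoly]
  refine IsIntegral.multiset_sum fun μ hμ => ⟨p, hp, ?_⟩
  have hμ' : μ ∈ spectrum Ω (f.mapMatrix Z) :=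
    Matrix.mem_spectrum_iff_isRoot_charpoly.2 (Polynomial.isRoot_of_mem_roots hμ)
  -- An eigenvalue is a root of every polynomial that annihilates the matrix.
  have h := spectrum.subset_polynomial_aeval (f.mapMatrix Z) (p.map (algebraMap V Ω))
    ⟨μ, hμ', rfl⟩
  have h0 : Polynomial.aeval (f.mapMatrix Z) (p.map (algebraMap V Ω)) = 0 := by
    rw [Polynomial.aeval_map_algebraMap]
    exact hpZ
  rw [h0] at h
  have : (p.map (algebraMap V Ω)).eval μ = 0 := by
    by_contra hne
    rw [spectrum.mem_iff, sub_zero] at h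
    exact h ((isUnit_iff_ne_zero.2 hne).map (algebraMap Ω _))
  rwa [Polynomial.eval_map] at this

end LocInt

/-! ### Cyclic extensions of degree five -/

section CyclicExtension

variable {E L : Type*} [Field E] [Field L] [Algebra E L]

theorem pow_bijective_of_orderOf_eq_finrank [FiniteDimensional E L] {σ : L ≃ₐ[E] L}
    (hσ : orderOf σ = 5) (h : Module.finrank E L = 5) :
    Function.Bijective fun j : Fin 5 => σ ^ (j : ℕ) := by
  have hinj : Function.Injective fun j : Fin 5 => σ ^ (j : ℕ) := by
    intro i j hij
    exact Fin.ext (pow_injOn_Iio_orderOf (by simp [hσ]) (by simp [hσ]) hij)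
  -- There are at most `[L : E] = 5` automorphisms.
  refine (Fintype.bijective_iff_injective_and_card _).2 ⟨hinj, le_antisymm ?_ ?_⟩
  · exact Fintype.card_le_of_injective _ hinj
  · simpa [h] using AlgEquiv.card_le (F := E) (K := L)

theorem isGalois_of_orderOf_eq_finrank [FiniteDimensional E L] {σ : L ≃ₐ[E] L}
    (hσ : orderOf σ = 5) (h : Module.finrank E L = 5) : IsGalois E L := by
  refine IsGalois.of_card_aut_eq_finrank E L ?_
  rw [h, Nat.card_eq_fintype_card,
    ← Fintype.card_of_bijective (pow_bijective_of_orderOf_eq_finrank hσ h), Fintype.card_fin]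

theorem algebraMap_trace_eq_sum_pow [FiniteDimensional E L] {σ : L ≃ₐ[E] L}
    (hσ : orderOf σ = 5) (h : Module.finrank E L = 5) (l : L) :
    algebraMap E L (Algebra.trace E L l) = ∑ j : Fin 5, (σ ^ (j : ℕ)) l := by
  have := isGalois_of_orderOf_eq_finrank hσ h
  rw [trace_eq_sum_automorphisms]
  exact ((pow_bijective_of_orderOf_eq_finrank hσ h).sum_comp fun g => g l).symm

theorem algebraMap_norm_eq_prod_pow [FiniteDimensional E L] {σ : L ≃ₐ[E] L}
    (hσ : orderOf σ = 5) (h : Module.finrank E L = 5) (l : L) :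
    algebraMap E L (Algebra.norm E l) = ∏ j : Fin 5, (σ ^ (j : ℕ)) l := by
  have := isGalois_of_orderOf_eq_finrank hσ h
  rw [Algebra.norm_eq_prod_automorphisms]
  exact ((pow_bijective_of_orderOf_eq_finrank hσ h).prod_comp fun g => g l).symm

end CyclicExtension

/-! ### Cyclic generators of an algebra -/

/-- A presentation `D = ⨁_{i < 5} L Uⁱ` of an algebra `D` as a cyclic algebra, with the relations
`U l = σ(l) U` and `U⁵ = α`. The coordinates are the left coefficients of the powers of `U`. -/
structure CyclicFrame {E L : Type*} [Field E] [Field L] [Algebra E L] (σ : L ≃ₐ[E] L)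
    (D : Type*) [Ring D] [Algebra E D] where
  ι : L →ₐ[E] D
  U : D
  α : E
  U_mul : ∀ l, U * ι l = ι (σ l) * U
  U_pow : U ^ 5 = algebraMap E D α
  coord : D →ₗ[E] (Fin 5 → L)
  sum_coord : ∀ z, ∑ i : Fin 5, ι (coord z i) * U ^ (i : ℕ) = z
  coord_sum : ∀ l : Fin 5 → L, coord (∑ i : Fin 5, ι (l i) * U ^ (i : ℕ)) = l

namespace CyclicFrame

variable {E L : Type*} [Field E] [Field L] [Algebra E L] {σ : L ≃ₐ[E] L}
  {D : Type*} [Ring D] [Algebra E D] (F : CyclicFrame σ D)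

theorem ext_coord {z w : D} (h : ∀ i, F.coord z i = F.coord w i) : z = w := by
  rw [← F.sum_coord z, ← F.sum_coord w]
  exact Finset.sum_congr rfl fun i _ => by rw [h i]

theorem pow_mul (n : ℕ) (l : L) : F.U ^ n * F.ι l = F.ι ((σ ^ n) l) * F.U ^ n := by
  induction n generalizing l with
  | zero => simp
  | succ n ih =>
    rw [pow_succ, mul_assoc, F.U_mul, ← mul_assoc, ih, mul_assoc, pow_succ]
    rfl

theorem mul_pow (n : ℕ) (l : L) : F.ι l * F.U ^ n = F.U ^ n * F.ι ((σ.symm ^ n) l) := by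
  rw [F.pow_mul]
  congr 2
  have : σ ^ n * σ.symm ^ n = 1 := by
    rw [show σ.symm = σ⁻¹ from rfl, inv_pow, mul_inv_cancel]
  exact (congrArg (fun g : L ≃ₐ[E] L => g l) this).symm

theorem coord_ι_mul (l : L) (z : D) (i : Fin 5) : F.coord (F.ι l * z) i = l * F.coord z i := by
  have : F.ι l * z = ∑ i : Fin 5, F.ι (l * F.coord z i) * F.U ^ (i : ℕ) := by
    conv_lhs => rw [← F.sum_coord z, Finset.mul_sum]
    exact Finset.sum_congr rfl fun i _ => by rw [map_mul, mul_assoc]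
  rw [this, F.coord_sum]

theorem coord_pow (i : Fin 5) : F.coord (F.U ^ (i : ℕ)) = Pi.single i 1 := by
  have : F.U ^ (i : ℕ) = ∑ j : Fin 5, F.ι ((Pi.single i 1 : Fin 5 → L) j) * F.U ^ (j : ℕ) := by
    rw [Finset.sum_eq_single i (fun j _ hj => by simp [hj]) (by simp)]
    simp
  rw [this, F.coord_sum]

theorem coord_ι (l : L) : F.coord (F.ι l) = Pi.single 0 l := by
  funext i
  have := F.coord_ι_mul l (F.U ^ ((0 : Fin 5) : ℕ)) i
  rw [F.coord_pow] at this
  simp only [Fin.coe_ofNat_eq_mod, Nat.zero_mod, pow_zero, mul_one] at this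
  rw [this]
  by_cases h : i = 0
  · subst h; simp
  · simp [h]

theorem coord_one : F.coord 1 = Pi.single 0 1 := by
  rw [← map_one F.ι, F.coord_ι]

theorem coord_algebraMap_mul (e : E) (z : D) (i : Fin 5) :
    F.coord (algebraMap E D e * z) i = algebraMap E L e * F.coord z i := by
  rw [← F.ι.commutes, F.coord_ι_mul]

/-- The product in coordinates. -/
theorem coord_mul (z w : D) (k : Fin 5) :
    F.coord (z * w) k = ∑ i : Fin 5, F.coord z i * (σ ^ (i : ℕ)) (F.coord w (k - i)) *
      (if i ≤ k then 1 else algebraMap E L F.α) := by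
  have key : ∀ i k : Fin 5, F.coord (F.U ^ (i : ℕ) * w) k =
      (σ ^ (i : ℕ)) (F.coord w (k - i)) * (if i ≤ k then 1 else algebraMap E L F.α) := by
    intro i k
    have h1 : F.U ^ (i : ℕ) * w = ∑ k : Fin 5, F.ι ((σ ^ (i : ℕ)) (F.coord w (k - i)) *
        (if i ≤ k then 1 else algebraMap E L F.α)) * F.U ^ (k : ℕ) := by
      conv_lhs => rw [← F.sum_coord w, Finset.mul_sum]
      conv_rhs => rw [← Equiv.sum_comp (Equiv.addRight i)]
      refine Finset.sum_congr rfl fun j _ => ?_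
      rw [← mul_assoc, F.pow_mul, mul_assoc, ← pow_add, Equiv.coe_addRight, add_sub_cancel_right,
        map_mul, mul_assoc]
      congr 1
      -- The factor `α = U⁵` appears when the sum of the exponents exceeds `4`.
      by_cases h : (i : ℕ) + j < 5
      · have h2 : ((j + i : Fin 5) : ℕ) = i + j := by
          rw [Fin.val_add, Nat.mod_eq_of_lt (by omega), add_comm]
        rw [if_pos (by rw [Fin.le_def, h2]; omega), h2, map_one, one_mul]
      · have h2 : ((j + i : Fin 5) : ℕ) = i + j - 5 := by
          rw [Fin.val_add]; omega
        rw [if_neg (by rw [Fin.le_def, h2]; omega), h2, F.ι.commutes, ← F.U_pow, ← pow_add]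
        congr 1
        omega
    rw [h1, F.coord_sum]
  conv_lhs => rw [← F.sum_coord z, Finset.sum_mul, map_sum, Finset.sum_apply]
  refine Finset.sum_congr rfl fun i _ => ?_
  rw [mul_assoc, F.coord_ι_mul, key, mul_assoc]

theorem twist_pow (θ : L) (n : ℕ) :
    (F.ι θ * F.U) ^ n = F.ι (∏ j ∈ Finset.range n, (σ ^ j) θ) * F.U ^ n := by
  induction n with
  | zero => simp
  | succ n ih =>
    rw [pow_succ, ih, mul_assoc, ← mul_assoc (F.U ^ n), F.pow_mul, Finset.prod_range_succ, map_mul,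
      pow_succ]
    simp only [mul_assoc]

/-- The change of the cyclic generator `U` into `θ U`, for `θ ∈ Lˣ` of norm `N`. -/
noncomputable def twist {θ : L} (hθ : θ ≠ 0) (N : E)
    (hN : algebraMap E L N = ∏ j ∈ Finset.range 5, (σ ^ j) θ) : CyclicFrame σ D where
  ι := F.ι
  U := F.ι θ * F.U
  α := N * F.α
  U_mul l := by
    rw [mul_assoc, F.U_mul, ← mul_assoc, ← map_mul, mul_comm θ, map_mul, mul_assoc]
  U_pow := by
    rw [F.twist_pow, ← hN, F.U_pow, F.ι.commutes, map_mul]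
  coord := LinearMap.pi fun i =>
    (LinearMap.mulLeft E (∏ j ∈ Finset.range i, (σ ^ j) θ)⁻¹).comp
      ((LinearMap.proj i).comp F.coord)
  sum_coord z := by
    conv_rhs => rw [← F.sum_coord z]
    refine Finset.sum_congr rfl fun i _ => ?_
    have h0 : (∏ j ∈ Finset.range i, (σ ^ j) θ) ≠ 0 :=
      Finset.prod_ne_zero_iff.2 fun j _ => (map_ne_zero (σ ^ j)).2 hθ
    rw [F.twist_pow, ← mul_assoc, ← map_mul]
    congr 2
    simp only [LinearMap.pi_apply, LinearMap.comp_apply, LinearMap.mulLeft_apply,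
      LinearMap.proj_apply]
    field_simp
  coord_sum l := by
    have h1 : ∑ i : Fin 5, F.ι (l i) * (F.ι θ * F.U) ^ (i : ℕ) =
        ∑ i : Fin 5, F.ι (l i * ∏ j ∈ Finset.range i, (σ ^ j) θ) * F.U ^ (i : ℕ) :=
      Finset.sum_congr rfl fun i _ => by rw [F.twist_pow, ← mul_assoc, map_mul]
    rw [h1]
    funext i
    have h0 : (∏ j ∈ Finset.range i, (σ ^ j) θ) ≠ 0 :=
      Finset.prod_ne_zero_iff.2 fun j _ => (map_ne_zero (σ ^ j)).2 hθ
    simp only [LinearMap.pi_apply, LinearMap.comp_apply, LinearMap.mulLeft_apply,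
      LinearMap.proj_apply, F.coord_sum]
    field_simp

theorem twist_coord {θ : L} (hθ : θ ≠ 0) (N : E)
    (hN : algebraMap E L N = ∏ j ∈ Finset.range 5, (σ ^ j) θ) (z : D) (i : Fin 5) :
    (F.twist hθ N hN).coord z i = (∏ j ∈ Finset.range i, (σ ^ j) θ)⁻¹ * F.coord z i := rfl

end CyclicFrame

namespace CyclicData

variable {E M L : Type*} [Field E] [NumberField E] [Field M] [NumberField M]
  [Field L] [NumberField L] [Algebra E L] [Algebra M L] (x : CyclicData E M L)

theorem σ_pow_five : x.σ ^ 5 = 1 := x.orderOf_σ ▸ pow_orderOf_eq_one x.σ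

theorem u_mul_ofL (l : L) : x.u * x.ofL l = x.ofL (x.σ l) * x.u :=
  Subtype.ext (cyclicGen_mul_twistedDiag x.σ x.σ_pow_five _ l)

theorem exists_eq_sum (z : x.D) :
    ∃ l : Fin 5 → L, z = ∑ i : Fin 5, x.u ^ (i : ℕ) * x.ofL (l i) := by
  obtain ⟨l, hl⟩ := z.2
  refine ⟨l, Subtype.ext ?_⟩
  rw [hl]
  simp only [AddSubmonoidClass.coe_finsetSum, MulMemClass.coe_mul, SubmonoidClass.coe_pow]
  rfl

theorem coe_ofL_mul_u_pow_zero_apply (i j : Fin 5) (l : L) :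
    ((x.ofL l * x.u ^ (i : ℕ) : x.D) : Matrix (Fin 5) (Fin 5) L) 0 j = if i = j then l else 0 := by
  change (twistedDiag x.σ l * cyclicGen (algebraMap E L x.a) ^ (i : ℕ)) 0 j = _
  rw [twistedDiag_apply, Matrix.diagonal_mul]
  fin_cases i <;> fin_cases j <;>
    simp [Fin.sum_univ_five, cyclicGen, pow_succ, Matrix.mul_apply]

/-- The defining presentation of `D`, with the cyclic generator `u`. -/
noncomputable def frame : CyclicFrame x.σ x.D where
  ι := x.ofL
  U := x.u
  α := x.a
  U_mul := x.u_mul_ofL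
  U_pow := by
    refine Subtype.ext ?_
    change cyclicGen (algebraMap E L x.a) ^ 5 = _
    rw [cyclicGen_pow_five x.σ x.a, ← x.ofL.commutes]
    rfl
  coord :=
    { toFun := fun z j => (z : Matrix (Fin 5) (Fin 5) L) 0 j
      map_add' := fun _ _ => rfl
      map_smul' := fun _ _ => rfl }
  sum_coord z := by
    have hpow : ∀ (n : ℕ) (l : L), x.u ^ n * x.ofL l = x.ofL ((x.σ ^ n) l) * x.u ^ n := by
      intro n
      induction n with
      | zero => simp
      | succ n ih =>
        intro l
        rw [pow_succ, mul_assoc, x.u_mul_ofL, ← mul_assoc, ih, mul_assoc, pow_succ]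
        rfl
    obtain ⟨l, rfl⟩ := x.exists_eq_sum z
    refine Finset.sum_congr rfl fun i _ => ?_
    rw [hpow]
    congr 2
    simp only [hpow]
    change ((∑ i : Fin 5, x.ofL ((x.σ ^ (i : ℕ)) (l i)) * x.u ^ (i : ℕ) : x.D) :
      Matrix (Fin 5) (Fin 5) L) 0 i = _
    rw [AddSubmonoidClass.coe_finsetSum, Matrix.sum_apply]
    simp [coe_ofL_mul_u_pow_zero_apply]
  coord_sum l := by
    funext j
    change ((∑ i : Fin 5, x.ofL (l i) * x.u ^ (i : ℕ) : x.D) :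
      Matrix (Fin 5) (Fin 5) L) 0 j = _
    rw [AddSubmonoidClass.coe_finsetSum, Matrix.sum_apply]
    simp [coe_ofL_mul_u_pow_zero_apply]

@[simp] theorem frame_α : x.frame.α = x.a := rfl

theorem coe_apply_self (z : x.D) (i : Fin 5) :
    (z : Matrix (Fin 5) (Fin 5) L) i i = (x.σ ^ (i : ℕ)) ((z : Matrix (Fin 5) (Fin 5) L) 0 0) := by
  obtain ⟨l, hl⟩ := z.2
  rw [hl]
  fin_cases i <;>
    simp [twistedDiag_apply, Matrix.sum_apply, -Matrix.cons_mul,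
      Fin.sum_univ_five, cyclicGen, pow_succ, Matrix.mul_apply]

/-- The reduced trace of `z ∈ D` is the trace of its coordinate at `u⁰`. -/
theorem trace_coe (hL : Module.finrank E L = 5) (z : x.D) :
    (z : Matrix (Fin 5) (Fin 5) L).trace =
      algebraMap E L (Algebra.trace E L (x.frame.coord z 0)) := by
  have : FiniteDimensional E L := Module.finite_of_finrank_pos (by omega)
  rw [algebraMap_trace_eq_sum_pow x.orderOf_σ hL, Matrix.trace]
  exact Finset.sum_congr rfl fun i _ => x.coe_apply_self z i

/-- The reduced trace is integral on multiplicatively closed sets with bounded denominators. -/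
theorem trace_coord_mem_locInt (hL : Module.finrank E L = 5) {v : HeightOneSpectrum (𝓞 E)}
    {Λ Γ : Submodule (𝓞 E) x.D} (hΛ : Λ.FG) (hone : (1 : x.D) ∈ Γ)
    (hmul : ∀ y ∈ Γ, ∀ z ∈ Γ, y * z ∈ Γ) {r : 𝓞 E} (hr : r ≠ 0)
    (hb : ∀ z ∈ Γ, r • z ∈ locAt v Λ) {z : x.D} (hz : z ∈ Γ) :
    Algebra.trace E L (x.frame.coord z 0) ∈ locInt v E := by
  have hpow : ∀ n : ℕ, z ^ n ∈ Γ := fun n => by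
    induction n with
    | zero => simpa using hone
    | succ n ih => rw [pow_succ]; exact hmul _ ih _ hz
  have h1 := isIntegral_of_forall_smul_pow_mem hΛ hr fun n => hb _ (hpow n)
  have h2 : IsIntegral (HeightOneSpectrum.valuationSubringAtPrime E v)
      (z : Matrix (Fin 5) (Fin 5) L) :=
    h1.map (x.D.val.restrictScalars (HeightOneSpectrum.valuationSubringAtPrime E v))
  have h3 := mem_locInt_of_isIntegral_valuationSubring (Matrix.isIntegral_trace_of_isIntegral h2)
  rwa [x.trace_coe hL, algebraMap_mem_locInt_iff] at h3

end CyclicData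

/-! ### Fractional powers of a uniformizer -/

section FracPow

/-- The multiples `ϖᵏ B` of a subring `B` of a field, for `k ∈ ℤ`. -/
def fracPow {L : Type*} [Field L] (B : Subring L) (ϖ : L) (k : ℤ) : AddSubgroup L where
  carrier := {l | ϖ ^ (-k) * l ∈ B}
  add_mem' {a b} ha hb := by
    change ϖ ^ (-k) * (a + b) ∈ B
    rw [mul_add]; exact add_mem ha hb
  zero_mem' := by simp
  neg_mem' {a} ha := by
    change ϖ ^ (-k) * (-a) ∈ B
    rw [mul_neg]; exact neg_mem ha

variable {L : Type*} [Field L] {B : Subring L} {ϖ : L}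

theorem mem_fracPow {k : ℤ} {l : L} : l ∈ fracPow B ϖ k ↔ ϖ ^ (-k) * l ∈ B := Iff.rfl

theorem mem_fracPow_zero {l : L} : l ∈ fracPow B ϖ 0 ↔ l ∈ B := by simp [mem_fracPow]

theorem zpow_mul_mem_fracPow (h0 : ϖ ≠ 0) {k : ℤ} {l : L} (hl : l ∈ B) :
    ϖ ^ k * l ∈ fracPow B ϖ k := by
  rw [mem_fracPow, ← mul_assoc, ← zpow_add₀ h0, neg_add_cancel, zpow_zero, one_mul]
  exact hl

theorem mem_fracPow_iff_exists (h0 : ϖ ≠ 0) {k : ℤ} {l : L} :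
    l ∈ fracPow B ϖ k ↔ ∃ b ∈ B, l = ϖ ^ k * b := by
  constructor
  · intro h
    exact ⟨_, h, by rw [← mul_assoc, ← zpow_add₀ h0, add_neg_cancel, zpow_zero, one_mul]⟩
  · rintro ⟨b, hb, rfl⟩
    exact zpow_mul_mem_fracPow h0 hb

theorem fracPow_mul_mem (h0 : ϖ ≠ 0) {j k : ℤ} {l m : L} (hl : l ∈ fracPow B ϖ j)
    (hm : m ∈ fracPow B ϖ k) : l * m ∈ fracPow B ϖ (j + k) := by
  rw [mem_fracPow] at *
  have := mul_mem hl hm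
  rwa [neg_add, zpow_add₀ h0, show ϖ ^ (-j) * ϖ ^ (-k) * (l * m) =
    ϖ ^ (-j) * l * (ϖ ^ (-k) * m) by ring]

theorem zpow_mul_mem_fracPow_iff (h0 : ϖ ≠ 0) {j k : ℤ} {l : L} :
    ϖ ^ j * l ∈ fracPow B ϖ k ↔ l ∈ fracPow B ϖ (k - j) := by
  rw [mem_fracPow, mem_fracPow, ← mul_assoc, ← zpow_add₀ h0]
  congr! 3
  ring

theorem fracPow_le (h0 : ϖ ≠ 0) (hϖ : ϖ ∈ B) {j k : ℤ} (h : j ≤ k) :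
    fracPow B ϖ k ≤ fracPow B ϖ j := by
  intro l hl
  rw [mem_fracPow] at *
  obtain ⟨n, rfl⟩ := Int.le.dest h
  have := mul_mem (pow_mem hϖ n) hl
  rwa [← mul_assoc, ← zpow_natCast, ← zpow_add₀ h0, show (n : ℤ) + -(j + n) = -j by ring] at this

/-- An automorphism that preserves `B` and multiplies `ϖ` by a unit of `B` preserves `ϖᵏ B`. -/
theorem map_mem_fracPow {F : Type*} [FunLike F L L] [RingHomClass F L L] {σ : F} {η : L}
    (hσ : ∀ l ∈ B, σ l ∈ B) (hη : σ ϖ = ϖ * η) (hη1 : η ∈ B) (hη2 : η⁻¹ ∈ B) {k : ℤ} {l : L}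
    (hl : l ∈ fracPow B ϖ k) : σ l ∈ fracPow B ϖ k := by
  by_cases h0 : ϖ = 0
  · rw [mem_fracPow] at *
    by_cases hk : k = 0
    · subst hk; simpa using hσ _ (by simpa using hl)
    · rw [h0, zero_zpow _ (by simpa using hk)]; simp
  rw [mem_fracPow_iff_exists h0] at *
  obtain ⟨b, hb, rfl⟩ := hl
  refine ⟨η ^ k * σ b, mul_mem ?_ (hσ b hb), ?_⟩
  · rcases Int.eq_nat_or_neg k with ⟨n, rfl | rfl⟩
    · rw [zpow_natCast]; exact pow_mem hη1 n
    · rw [zpow_neg, zpow_natCast, ← inv_pow]; exact pow_mem hη2 n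
  · rw [map_mul, map_zpow₀, hη, mul_zpow, mul_assoc]

end FracPow

/-! ### The inert places: a valuation on the cyclic algebra -/

namespace CyclicFrame

variable {E L : Type*} [Field E] [NumberField E] [Field L] [Algebra E L] {σ : L ≃ₐ[E] L}
  {D : Type*} [Ring D] [Algebra E D] (F : CyclicFrame σ D)

/-- The situation at a place `v = (π)` that is inert in `L`, where `π` remains a prime element, and
where the valuation `ε` of `α = U⁵` is prime to `5`. -/
structure InertAt (v : HeightOneSpectrum (𝓞 E)) (π : 𝓞 E) (ε : ℤ) : Prop where
  asIdeal_eq : v.asIdeal = Ideal.span {π}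
  prime : ∀ l ∈ locInt v L, ∀ m ∈ locInt v L, l * m ∈ fracPow (locInt v L) (algebraMap E L π) 1 →
    l ∈ fracPow (locInt v L) (algebraMap E L π) 1 ∨ m ∈ fracPow (locInt v L) (algebraMap E L π) 1
  not_dvd : ¬ (5 : ℤ) ∣ ε
  α_eq : ∃ α₀ : E, α₀ ≠ 0 ∧ α₀ ∈ locInt v E ∧ α₀⁻¹ ∈ locInt v E ∧ F.α = (π : E) ^ ε * α₀

/-- The elements of valuation at least `n`, for the valuation of `D` with `v(U) = ε` and
`v(π) = 5`: the `i`-th coordinate is divisible by `π` to the power `⌈(n - ε i) / 5⌉`. -/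
def Level (v : HeightOneSpectrum (𝓞 E)) (π : 𝓞 E) (ε : ℤ) (n : ℤ) (z : D) : Prop :=
  ∀ i : Fin 5, F.coord z i ∈ fracPow (locInt v L) (algebraMap E L π) (-((ε * (i : ℕ) - n) / 5))

variable {F} {v : HeightOneSpectrum (𝓞 E)} {π : 𝓞 E} {ε : ℤ}

namespace InertAt

theorem mem (h : F.InertAt v π ε) : π ∈ v.asIdeal := by
  rw [h.asIdeal_eq]; exact Ideal.mem_span_singleton_self _

theorem coe_ne_zero (h : F.InertAt v π ε) : (π : E) ≠ 0 := by
  intro h0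
  rw [RingOfIntegers.coe_eq_zero_iff] at h0
  exact v.ne_bot (by rw [h.asIdeal_eq, h0]; simp)

theorem ne_zero (h : F.InertAt v π ε) : algebraMap E L π ≠ 0 := by
  simpa using h.coe_ne_zero

theorem mem_locInt (_ : F.InertAt v π ε) : algebraMap E L π ∈ locInt v L :=
  algebraMap_coe_mem_locInt π

theorem one_notMem (h : F.InertAt v π ε) : (1 : L) ∉ fracPow (locInt v L) (algebraMap E L π) 1 := by
  intro h1
  rw [mem_fracPow, mul_one, zpow_neg, zpow_one, ← map_inv₀, algebraMap_mem_locInt_iff] at h1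
  exact coe_mul_ne_one_of_mem h.mem h1 (mul_inv_cancel₀ h.coe_ne_zero)

theorem map_mem (h : F.InertAt v π ε) (τ : L ≃ₐ[E] L) {k : ℤ} {l : L}
    (hl : l ∈ fracPow (locInt v L) (algebraMap E L π) k) :
    τ l ∈ fracPow (locInt v L) (algebraMap E L π) k :=
  map_mem_fracPow (η := 1) (fun _ => map_mem_locInt τ) (by simp) (one_mem _) (by simp) hl

/-- Exact valuations of elements of `L` add up. -/
theorem mul_notMem (h : F.InertAt v π ε) {j k : ℤ} {l m : L}
    (hl : l ∈ fracPow (locInt v L) (algebraMap E L π) j)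
    (hl' : l ∉ fracPow (locInt v L) (algebraMap E L π) (j + 1))
    (hm : m ∈ fracPow (locInt v L) (algebraMap E L π) k)
    (hm' : m ∉ fracPow (locInt v L) (algebraMap E L π) (k + 1)) :
    l * m ∉ fracPow (locInt v L) (algebraMap E L π) (j + k + 1) := by
  intro hlm
  obtain ⟨b, hb, rfl⟩ := (mem_fracPow_iff_exists h.ne_zero).1 hl
  obtain ⟨c, hc, rfl⟩ := (mem_fracPow_iff_exists h.ne_zero).1 hm
  rw [zpow_mul_mem_fracPow_iff h.ne_zero, add_sub_cancel_left] at hl' hm'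
  rw [mul_mul_mul_comm, ← zpow_add₀ h.ne_zero, zpow_mul_mem_fracPow_iff h.ne_zero,
    add_sub_cancel_left] at hlm
  rcases h.prime b hb c hc hlm with h1 | h1
  · exact hl' h1
  · exact hm' h1

/-- The valuation of an element of `L` is bounded below. -/
theorem exists_mem [NumberField L] (h : F.InertAt v π ε) (l : L) :
    ∃ k : ℕ, l ∈ fracPow (locInt v L) (algebraMap E L π) (-k) := by
  obtain ⟨r, hr, hrl⟩ := exists_mul_mem_locInt v l
  obtain ⟨k, s, hs, rfl⟩ := exists_pow_mul_unit h.asIdeal_eq hr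
  refine ⟨k, ?_⟩
  rw [mem_fracPow, neg_neg, zpow_natCast]
  have := mul_mem (algebraMap_mem_locInt (L := L) (inv_coe_mem_locInt hs)) hrl
  rw [RingOfIntegers.val_mul, RingOfIntegers.val_pow, map_mul, map_pow, map_inv₀] at this
  have hs0 : algebraMap E L s ≠ 0 := by simpa using ne_zero_of_notMem hs
  rwa [show (algebraMap E L s)⁻¹ * (algebraMap E L π ^ k * algebraMap E L s * l) =
    algebraMap E L π ^ k * l by field_simp] at this

/-- The valuation of a nonzero element of `L` is bounded above. -/
theorem exists_notMem [NumberField L] (h : F.InertAt v π ε) {l : L} (hl : l ≠ 0) :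
    ∃ k : ℕ, ∀ j : ℤ, k < j → l ∉ fracPow (locInt v L) (algebraMap E L π) j := by
  obtain ⟨k, hk⟩ := h.exists_mem l⁻¹
  refine ⟨k, fun j hj hlj => h.one_notMem ?_⟩
  have := fracPow_mul_mem h.ne_zero hlj hk
  rw [mul_inv_cancel₀ hl] at this
  exact fracPow_le h.ne_zero h.mem_locInt (by omega) this

theorem level_anti (h : F.InertAt v π ε) {m n : ℤ} (hmn : m ≤ n) {z : D}
    (hz : F.Level v π ε n z) : F.Level v π ε m z := fun i =>
  fracPow_le h.ne_zero h.mem_locInt (by omega) (hz i)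

theorem algebraMap_α_mem (h : F.InertAt v π ε) :
    algebraMap E L F.α ∈ fracPow (locInt v L) (algebraMap E L π) ε := by
  obtain ⟨α₀, h0, h1, h2, h3⟩ := h.α_eq
  rw [h3, map_mul, map_zpow₀]
  exact zpow_mul_mem_fracPow h.ne_zero (algebraMap_mem_locInt h1)

theorem algebraMap_α_notMem (h : F.InertAt v π ε) :
    algebraMap E L F.α ∉ fracPow (locInt v L) (algebraMap E L π) (ε + 1) := by
  obtain ⟨α₀, h0, h1, h2, h3⟩ := h.α_eq
  rw [h3, map_mul, map_zpow₀, zpow_mul_mem_fracPow_iff h.ne_zero, add_sub_cancel_left]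
  intro h4
  apply h.one_notMem
  have := fracPow_mul_mem h.ne_zero h4 (mem_fracPow_zero.2 (algebraMap_mem_locInt (L := L) h2))
  rwa [← map_mul, mul_inv_cancel₀ h0, map_one, add_zero] at this

theorem val_add_val_sub (i k : Fin 5) :
    (((i : ℕ) : ℤ) + ((k - i : Fin 5) : ℕ) = (k : ℕ) ∧ i ≤ k) ∨
      (((i : ℕ) : ℤ) + ((k - i : Fin 5) : ℕ) = (k : ℕ) + 5 ∧ ¬ i ≤ k) := by
  revert i k
  decide

/-- The summands of a product in coordinates, with a lower bound for their valuation. -/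
theorem term_mem (h : F.InertAt v π ε) {i k : Fin 5} {a b : ℤ} {l m : L}
    (hl : l ∈ fracPow (locInt v L) (algebraMap E L π) a)
    (hm : m ∈ fracPow (locInt v L) (algebraMap E L π) b) :
    l * (σ ^ (i : ℕ)) m * (if i ≤ k then 1 else algebraMap E L F.α) ∈
      fracPow (locInt v L) (algebraMap E L π) (a + b + if i ≤ k then 0 else ε) := by
  refine fracPow_mul_mem h.ne_zero (fracPow_mul_mem h.ne_zero hl (h.map_mem _ hm)) ?_
  split_ifs
  · exact mem_fracPow_zero.2 (one_mem _)
  · exact h.algebraMap_α_mem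

theorem level_mul (h : F.InertAt v π ε) {m n : ℤ} {z w : D} (hz : F.Level v π ε m z)
    (hw : F.Level v π ε n w) : F.Level v π ε (m + n) (z * w) := by
  intro k
  rw [F.coord_mul]
  refine sum_mem fun i _ => fracPow_le h.ne_zero h.mem_locInt ?_ (h.term_mem (hz i) (hw (k - i)))
  rcases val_add_val_sub i k with ⟨h1, h2⟩ | ⟨h1, h2⟩
  · rw [if_pos h2, ← h1, mul_add]
    omega
  · rw [if_neg h2]
    have h3 : ε * (k : ℕ) = ε * (i : ℕ) + ε * ((k - i : Fin 5) : ℕ) - 5 * ε := by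
      linear_combination (-ε) * h1
    rw [h3]
    omega

/-- The valuation of an element of `D` is attained at some coordinate. -/
theorem exists_coord_notMem (h : F.InertAt v π ε) {n : ℤ} {z : D} (hz : F.Level v π ε n z)
    (hz' : ¬ F.Level v π ε (n + 1) z) : ∃ (i : Fin 5) (c : ℤ), n - ε * (i : ℕ) = 5 * c ∧
      F.coord z i ∈ fracPow (locInt v L) (algebraMap E L π) c ∧
      F.coord z i ∉ fracPow (locInt v L) (algebraMap E L π) (c + 1) := by
  rw [Level, not_forall] at hz'
  obtain ⟨i, hi⟩ := hz'
  have hi2 := hz i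
  refine ⟨i, -((ε * (i : ℕ) - n) / 5), ?_, hi2, ?_⟩
  · by_contra hne
    exact hi (by rwa [show (ε * (i : ℕ) - (n + 1)) / 5 = (ε * (i : ℕ) - n) / 5 by omega])
  · intro h3
    refine hi (fracPow_le h.ne_zero h.mem_locInt ?_ h3)
    omega

/-- Exact valuations of elements of `D` add up. -/
theorem not_level_mul (h : F.InertAt v π ε) {m n : ℤ} {z w : D} (hz : F.Level v π ε m z)
    (hz' : ¬ F.Level v π ε (m + 1) z) (hw : F.Level v π ε n w)
    (hw' : ¬ F.Level v π ε (n + 1) w) : ¬ F.Level v π ε (m + n + 1) (z * w) := by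
  obtain ⟨i, c, hc, hzi, hzi'⟩ := h.exists_coord_notMem hz hz'
  obtain ⟨j, d, hd, hwj, hwj'⟩ := h.exists_coord_notMem hw hw'
  intro hzw
  have hk := hzw (i + j)
  rw [F.coord_mul, ← Finset.add_sum_erase _ _ (Finset.mem_univ i)] at hk
  -- If the valuations of `z` and `w` are attained at the coordinates `i` and `j`, the term that
  -- they contribute to the coordinate `i + j` of `z w` has valuation exactly `N`.
  set N : ℤ := c + d + if i ≤ i + j then 0 else ε with hN
  have hval : ∀ a : Fin 5, ε * ((i + j : Fin 5) : ℕ) = ε * (a : ℕ) + ε * ((i + j - a : Fin 5) : ℕ)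
      - if a ≤ i + j then 0 else 5 * ε := by
    intro a
    rcases val_add_val_sub a (i + j) with ⟨h1, h2⟩ | ⟨h1, h2⟩
    · rw [if_pos h2]; linear_combination (-ε) * h1
    · rw [if_neg h2]; linear_combination (-ε) * h1
  have hN5 : m + n - ε * ((i + j : Fin 5) : ℕ) = 5 * N := by
    rw [hval i, add_sub_cancel_left, hN]
    split_ifs <;> linarith
  have hlevel : -((ε * ((i + j : Fin 5) : ℕ) - (m + n + 1)) / 5) = N + 1 := by omega
  rw [hlevel] at hk
  -- The other terms have larger valuations: `m - ε a` is divisible by `5` only for `a = i`, because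
  -- `5` does not divide `ε`.
  have hrest : ∑ a ∈ Finset.univ.erase i, F.coord z a * (σ ^ (a : ℕ)) (F.coord w (i + j - a)) *
      (if a ≤ i + j then 1 else algebraMap E L F.α) ∈
      fracPow (locInt v L) (algebraMap E L π) (N + 1) := by
    refine sum_mem fun a ha => fracPow_le h.ne_zero h.mem_locInt ?_
      (h.term_mem (hz a) (hw (i + j - a)))
    have hne : ¬ (5 : ℤ) ∣ m - ε * (a : ℕ) := by
      intro hdvd
      have h1 : (5 : ℤ) ∣ ε * ((a : ℕ) - (i : ℕ)) := by
        have : ε * (((a : ℕ) : ℤ) - (i : ℕ)) = 5 * c - (m - ε * (a : ℕ)) := by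
          rw [← hc]; ring
        rw [this]
        exact dvd_sub (dvd_mul_right _ _) hdvd
      have h2 := (Int.Prime.dvd_mul' Nat.prime_five h1).resolve_left h.not_dvd
      refine Finset.ne_of_mem_erase ha (Fin.ext ?_)
      have := a.2
      have := i.2
      push_cast at h2
      omega
    have h1 := hval a
    split_ifs at h1 ⊢ <;> omega
  refine absurd ((AddSubgroup.add_mem_cancel_right _ hrest).1 hk) ?_
  rw [add_sub_cancel_left, hN]
  have h1 : F.coord z i * (σ ^ (i : ℕ)) (F.coord w j) ∉
      fracPow (locInt v L) (algebraMap E L π) (c + d + 1) := by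
    refine h.mul_notMem hzi hzi' (h.map_mem _ hwj) fun h2 => hwj' ?_
    have := h.map_mem ((σ ^ (i : ℕ))⁻¹) h2
    rwa [← AlgEquiv.mul_apply, inv_mul_cancel, AlgEquiv.one_apply] at this
  split_ifs with h2
  · rwa [mul_one, add_zero]
  · exact h.mul_notMem (fracPow_mul_mem h.ne_zero hzi (h.map_mem _ hwj)) h1
      h.algebraMap_α_mem h.algebraMap_α_notMem

/-- Every nonzero element of `D` has a valuation. -/
theorem exists_level [NumberField L] (h : F.InertAt v π ε) {z : D} (hz : z ≠ 0) :
    ∃ n : ℤ, F.Level v π ε n z ∧ ¬ F.Level v π ε (n + 1) z := by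
  -- The valuation is the largest `n` for which `Level` holds; a lower bound exists.
  obtain ⟨N, hN⟩ : ∃ N : ℤ, F.Level v π ε N z := by
    choose k hk using fun i => h.exists_mem (F.coord z i)
    refine ⟨- ∑ i : Fin 5, (5 * k i + |ε * (i : ℕ)|), fun i =>
      fracPow_le h.ne_zero h.mem_locInt ?_ (hk i)⟩
    have h1 : (5 * (k i : ℤ) + |ε * (i : ℕ)|) ≤ ∑ i : Fin 5, (5 * (k i : ℤ) + |ε * (i : ℕ)|) :=
      Finset.single_le_sum (f := fun i : Fin 5 => 5 * (k i : ℤ) + |ε * (i : ℕ)|)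
        (fun i _ => by positivity) (Finset.mem_univ i)
    have h2 := neg_abs_le (ε * (i : ℕ))
    omega
  obtain ⟨i, hi⟩ : ∃ i, F.coord z i ≠ 0 := by
    by_contra! hne
    exact hz (F.ext_coord fun i => by rw [hne i, map_zero]; rfl)
  obtain ⟨k, hk⟩ := h.exists_notMem hi
  have hex : ∃ m : ℕ, ¬ F.Level v π ε (N + m) z := by
    refine ⟨(5 * (k + 1) + ε * (i : ℕ) - N).toNat, fun hl => hk _ ?_ (hl i)⟩
    omega
  classical
  have h0 : Nat.find hex ≠ 0 := fun h0 => by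
    have := Nat.find_spec hex
    rw [h0] at this
    simp only [Nat.cast_zero, add_zero] at this
    exact this hN
  obtain ⟨m, hm⟩ := Nat.exists_eq_succ_of_ne_zero h0
  refine ⟨N + m, ?_, ?_⟩
  · have := Nat.find_min hex (m := m) (by omega)
    rwa [not_not] at this
  · have := Nat.find_spec hex
    rwa [hm, Nat.cast_succ, ← add_assoc] at this

theorem mul_ne_zero [NumberField L] (h : F.InertAt v π ε) {z w : D} (hz : z ≠ 0) (hw : w ≠ 0) :
    z * w ≠ 0 := by
  obtain ⟨m, hm, hm'⟩ := h.exists_level hz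
  obtain ⟨n, hn, hn'⟩ := h.exists_level hw
  intro h0
  refine h.not_level_mul hm hm' hn hn' fun i => ?_
  rw [h0, map_zero]
  exact zero_mem _

/-- An inert place at which the valuation of `α` is prime to `5` forces `D` to be a division
algebra. -/
theorem isUnit [NumberField L] [FiniteDimensional E D] (h : F.InertAt v π ε) {z : D}
    (hz : z ≠ 0) : IsUnit z := by
  -- `D` is a finite-dimensional algebra without zero divisors.
  have hinj : Function.Injective (LinearMap.mulLeft E z) := by
    rw [← LinearMap.ker_eq_bot, LinearMap.ker_eq_bot']
    intro w hw
    by_contra hw0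
    exact h.mul_ne_zero hz hw0 hw
  obtain ⟨w, hw⟩ := LinearMap.surjective_of_injective hinj 1
  rw [LinearMap.mulLeft_apply] at hw
  refine ⟨⟨z, w, hw, ?_⟩, rfl⟩
  have h1 : z * (w * z - 1) = 0 := by rw [mul_sub, ← mul_assoc, hw]; simp
  by_contra h2
  exact h.mul_ne_zero hz (sub_ne_zero.2 h2) h1

theorem level_pow (h : F.InertAt v π ε) {n : ℤ} {z : D} (hz : F.Level v π ε n z)
    (hz' : ¬ F.Level v π ε (n + 1) z) (j : ℕ) :
    F.Level v π ε ((j + 1) * n) (z ^ (j + 1)) ∧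
      ¬ F.Level v π ε ((j + 1) * n + 1) (z ^ (j + 1)) := by
  induction j with
  | zero => simpa using ⟨hz, hz'⟩
  | succ j ih =>
    rw [pow_succ, show ((j + 1 : ℕ) + 1 : ℤ) * n = (j + 1) * n + n by push_cast; ring]
    exact ⟨h.level_mul ih.1 hz, h.not_level_mul ih.1 ih.2 hz hz'⟩

/-- The valuation ring of `D` at an inert place is locally maximal: the powers of an element of
negative valuation have unbounded denominators. -/
theorem isLocallyMaximal [NumberField L] (h : F.InertAt v π ε) {Λ : Submodule (𝓞 E) D}
    (hΛ : ∀ z, z ∈ locAt v Λ ↔ F.Level v π ε 0 z) : IsLocallyMaximal v Λ where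
  one_mem := by
    rw [hΛ]
    intro i
    rw [F.coord_one]
    by_cases hi : i = 0
    · subst hi
      simpa using mem_fracPow_zero.2 (one_mem _)
    · simp [hi]
  mul_mem y hy z hz := by
    rw [hΛ]
    have := h.level_mul ((hΛ y).1 (le_locAt v Λ hy)) ((hΛ z).1 (le_locAt v Λ hz))
    rwa [add_zero] at this
  maximal := by
    rintro Γ hmul - - ⟨r, hr, hb⟩ z hz
    rw [hΛ]
    by_contra hz0
    obtain ⟨n, hn, hn'⟩ := h.exists_level (z := z) (by
      rintro rfl
      exact hz0 fun i => by rw [map_zero]; exact zero_mem _)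
    have hneg : n < 0 := by
      by_contra! h0
      exact hz0 (h.level_anti h0 hn)
    obtain ⟨k, s, hs, rfl⟩ := exists_pow_mul_unit h.asIdeal_eq hr
    -- The elements of `Γ` have denominators dividing `πᵏ`, of valuation `5 k`, whereas `z⁵ᵏ⁺¹` has
    -- valuation at most `-(5 k + 1)`.
    have hpow : z ^ (5 * k + 1) ∈ Γ := by
      generalize 5 * k = j
      induction j with
      | zero => simpa using hz
      | succ j ih => rw [pow_succ]; exact hmul _ ih _ hz
    obtain ⟨t, ht, htz⟩ := hb _ hpow
    have h2 : (π ^ k) • z ^ (5 * k + 1) ∈ locAt v Λ := by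
      refine mem_locAt_of_smul_mem hs (mem_locAt_of_smul_mem ht (le_locAt v Λ ?_))
      rwa [← mul_smul s, mul_comm s]
    rw [hΛ] at h2
    refine (h.level_pow hn hn' (5 * k)).2 (h.level_anti (n := -(5 * k)) ?_ fun i => ?_)
    · push_cast
      nlinarith
    · have h3 := h2 i
      rw [← algebraMap_smul E (π ^ k), Algebra.smul_def, F.coord_algebraMap_mul,
        show algebraMap (𝓞 E) E (π ^ k) = (π : E) ^ k from map_pow _ _ _, map_pow, ← zpow_natCast,
        zpow_mul_mem_fracPow_iff h.ne_zero] at h3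
      exact fracPow_le h.ne_zero h.mem_locInt (by omega) h3

end InertAt

end CyclicFrame

/-! ### Trace duality in coordinates and the unramified places -/

namespace CyclicFrame

variable {E L : Type*} [Field E] [NumberField E] [Field L] [NumberField L] [Algebra E L]
  {σ : L ≃ₐ[E] L} {D : Type*} [Ring D] [Algebra E D] (F : CyclicFrame σ D)
  {v : HeightOneSpectrum (𝓞 E)}

/-- If the reduced trace is integral on a ring `Γ` that contains `U` and the integers of `L`, then
the coordinates of the elements of `Γ` lie in the trace dual of the integers of `L`. -/
theorem trace_mul_coord_mem {Γ : Set D} (hmul : ∀ y ∈ Γ, ∀ z ∈ Γ, y * z ∈ Γ)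
    (hι : ∀ l ∈ locInt v L, F.ι l ∈ Γ) (hU : ∀ n : ℕ, F.U ^ n ∈ Γ)
    (htr : ∀ z ∈ Γ, Algebra.trace E L (F.coord z 0) ∈ locInt v E)
    (hα0 : F.α ≠ 0) (hα : F.α⁻¹ ∈ locInt v E) {z : D} (hz : z ∈ Γ) (i : Fin 5) {l : L}
    (hl : l ∈ locInt v L) : Algebra.trace E L (F.coord z i * l) ∈ locInt v E := by
  -- The coordinate of `z` at `i` becomes the one at `0` after multiplication by `U⁻ⁱ`, that is, up
  -- to the unit `α`, by `U⁵⁻ⁱ`.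
  have h1 := htr _ (hmul _ (hmul _ (hι l hl) _ hz) _ (hU ((-i : Fin 5) : ℕ)))
  rw [F.coord_mul, Finset.sum_eq_single i] at h1
  · rw [F.coord_pow, zero_sub, Pi.single_eq_same, map_one, mul_one, F.coord_ι_mul,
      mul_comm l] at h1
    split_ifs at h1
    · rwa [mul_one] at h1
    · rw [mul_comm, ← Algebra.smul_def, map_smul, smul_eq_mul] at h1
      have := mul_mem hα h1
      rwa [← mul_assoc, inv_mul_cancel₀ hα0, one_mul] at this
  · intro j _ hj
    rw [F.coord_pow, zero_sub, Pi.single_eq_of_ne (fun h => hj (neg_injective h)), map_zero,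
      mul_zero, zero_mul]
  · simp

/-- At a place where the integers of `L` are their own trace dual and `α` is a unit, the lattice
`⨁ Uⁱ 𝓞_L` is locally maximal. -/
theorem isLocallyMaximal_of_unramified
    (hdual : ∀ l : L, (∀ m ∈ locInt v L, Algebra.trace E L (l * m) ∈ locInt v E) → l ∈ locInt v L)
    (hα0 : F.α ≠ 0) (hα : F.α ∈ locInt v E) (hα' : F.α⁻¹ ∈ locInt v E)
    {Λ : Submodule (𝓞 E) D} (hΛ : ∀ z, z ∈ locAt v Λ ↔ ∀ i, F.coord z i ∈ locInt v L)
    (htr : ∀ Γ : Submodule (𝓞 E) D, 1 ∈ Γ → (∀ y ∈ Γ, ∀ z ∈ Γ, y * z ∈ Γ) →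
      (∃ r : 𝓞 E, r ≠ 0 ∧ ∀ z ∈ Γ, r • z ∈ locAt v Λ) →
      ∀ z ∈ Γ, Algebra.trace E L (F.coord z 0) ∈ locInt v E) : IsLocallyMaximal v Λ := by
  have hι : ∀ l ∈ locInt v L, F.ι l ∈ locAt v Λ := by
    intro l hl
    rw [hΛ]
    intro i
    rw [F.coord_ι]
    by_cases hi : i = 0
    · subst hi; simpa using hl
    · simp [hi]
  have hone : (1 : D) ∈ locAt v Λ := by simpa using hι 1 (one_mem _)
  have hmul : ∀ y ∈ locAt v Λ, ∀ z ∈ locAt v Λ, y * z ∈ locAt v Λ := by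
    intro y hy z hz
    rw [hΛ] at *
    intro k
    rw [F.coord_mul]
    refine sum_mem fun i _ => mul_mem (mul_mem (hy i) (pow_map_mem_locInt _ _ (hz _))) ?_
    split_ifs
    · exact one_mem _
    · exact algebraMap_mem_locInt hα
  have hU : ∀ n : ℕ, F.U ^ n ∈ locAt v Λ := by
    intro n
    induction n with
    | zero => simpa using hone
    | succ n ih =>
      rw [pow_succ]
      refine hmul _ ih _ ?_
      rw [hΛ]
      intro i
      have := F.coord_pow 1
      simp only [Fin.val_one, pow_one] at this
      rw [this]
      by_cases hi : i = 1
      · subst hi; simp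
      · simp [hi]
  refine ⟨hone, fun y hy z hz => hmul y (le_locAt v Λ hy) z (le_locAt v Λ hz), ?_⟩
  intro Γ hΓ hsat hle hb z hz
  have hle' : locAt v Λ ≤ Γ := (locAt_le_locAt_iff.2 (hle.trans (le_locAt v Γ))).trans hsat
  rw [hΛ]
  refine fun i => hdual _ fun m hm => F.trace_mul_coord_mem (Γ := Γ) hΓ
    (fun l hl => hle' (hι l hl)) (fun n => hle' (hU n)) (htr Γ (hle' hone) hΓ hb) hα0 hα' hz i hm

end CyclicFrame

/-! ### A factorization of `b⁵ - X⁵` -/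

section FactorProd

open Polynomial

/-- The polynomial `∏_{j < m} (b - ζʲ X)`. -/
noncomputable def factorProd {k : Type*} [CommRing k] (b ζ : k) (m : ℕ) : k[X] :=
  ∏ j ∈ Finset.range m, (C b - C (ζ ^ j) * X)

variable {k : Type*} [CommRing k] (b ζ : k)

theorem factorProd_comp (n m : ℕ) : (factorProd b ζ m).comp (C (ζ ^ n) * X) =
    ∏ j ∈ Finset.range m, (C b - C (ζ ^ (n + j)) * X) := by
  rw [factorProd, prod_comp]
  refine Finset.prod_congr rfl fun j _ => ?_
  simp only [sub_comp, mul_comp, C_comp, X_comp]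
  rw [← mul_assoc, ← C_mul, ← pow_add, add_comm j]

theorem factorProd_mul_comp (m n : ℕ) :
    factorProd b ζ m * (factorProd b ζ n).comp (C (ζ ^ m) * X) = factorProd b ζ (m + n) := by
  rw [factorProd_comp, factorProd, factorProd, Finset.prod_range_add]

theorem factorProd_succ (m : ℕ) :
    (C b - X) * (factorProd b ζ m).comp (C ζ * X) = factorProd b ζ (m + 1) := by
  have := factorProd_mul_comp b ζ 1 m
  rw [add_comm 1 m, pow_one] at this
  rw [← this]
  simp [factorProd]

theorem factorProd_five (hζ : ζ ^ 4 + ζ ^ 3 + ζ ^ 2 + ζ + 1 = 0) :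
    factorProd b ζ 5 = C (b ^ 5) - X ^ 5 := by
  have h : (C ζ) ^ 4 + (C ζ) ^ 3 + (C ζ) ^ 2 + C ζ + (1 : k[X]) = 0 := by
    rw [← C_pow, ← C_pow, ← C_pow, ← C_add, ← C_add, ← C_add, ← C_1, ← C_add, hζ, C_0]
  simp only [factorProd, Finset.prod_range_succ, Finset.prod_range_zero, one_mul, pow_zero, pow_one,
    C_pow]
  generalize (C ζ : k[X]) = z at h ⊢
  generalize (C b : k[X]) = a
  linear_combination ((-1) * a ^ 4 * X + X ^ 5 + z * a ^ 3 * X ^ 2 - z * X ^ 5 +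
    z ^ 3 * a ^ 3 * X ^ 2 - z ^ 3 * a ^ 2 * X ^ 3 - z ^ 5 * a ^ 2 * X ^ 3 + z ^ 5 * X ^ 5 +
    z ^ 6 * a * X ^ 4 - z ^ 6 * X ^ 5) * h

/-- With `m + n = 5`, the polynomial `factorProd b ζ n` at `ζᵐ X` is the complementary factor of
`factorProd b ζ m` in `b⁵ - X⁵`. -/
theorem factorProd_dvd {k : Type*} [CommRing k] [IsDomain k] {b ζ : k}
    (hζ : ζ ^ 4 + ζ ^ 3 + ζ ^ 2 + ζ + 1 = 0) {m n : ℕ} (hmn : m + n = 5) {c : k} (hc : IsUnit c)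
    {g : k[X]} (h : X ^ 5 - C (b ^ 5) ∣ g * (C c * factorProd b ζ n).comp (C (ζ ^ m) * X)) :
    factorProd b ζ m ∣ g := by
  have h1 : factorProd b ζ m * (factorProd b ζ n).comp (C (ζ ^ m) * X) = C (b ^ 5) - X ^ 5 := by
    rw [factorProd_mul_comp, hmn, factorProd_five b ζ hζ]
  have h0 : (factorProd b ζ n).comp (C (ζ ^ m) * X) ≠ 0 := by
    intro h0
    rw [h0, mul_zero] at h1
    exact X_pow_sub_C_ne_zero (by norm_num : 0 < 5) (b ^ 5) (by rw [← neg_sub, ← h1, neg_zero])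
  have h2 : factorProd b ζ m * (factorProd b ζ n).comp (C (ζ ^ m) * X) ∣
      (C c * g) * (factorProd b ζ n).comp (C (ζ ^ m) * X) := by
    rw [h1, ← neg_dvd, neg_sub]
    refine h.trans (dvd_of_eq ?_)
    rw [mul_comp, C_comp]
    ring
  have h3 := (mul_dvd_mul_iff_right h0).1 h2
  rwa [(isUnit_C.2 hc).dvd_mul_left] at h3

/-- The form of `factorProd_dvd` for polynomials over a ring, modulo the kernel of `q`. -/
theorem exists_map_sub_mul_factorProd_eq_zero {R k : Type*} [CommRing R] [CommRing k] [IsDomain k]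
    {q : R →+* k} (hq : Function.Surjective q) {b ζ c : R}
    (hζ : q ζ ^ 4 + q ζ ^ 3 + q ζ ^ 2 + q ζ + 1 = 0) {m n : ℕ} (hmn : m + n = 5)
    (hc : IsUnit (q c)) {g : R[X]} (h : X ^ 5 - C (q b ^ 5) ∣
      (g * (C (c ^ n) * factorProd b ζ n).comp (C (ζ ^ m) * X)).map q) :
    ∃ p : R[X], (g - p * (C (c ^ m) * factorProd b ζ m)).map q = 0 := by
  have hmap : ∀ k, (factorProd b ζ k).map q = factorProd (q b) (q ζ) k := by
    intro k
    simp [factorProd, Polynomial.map_prod]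
  rw [Polynomial.map_mul, map_comp, Polynomial.map_mul, Polynomial.map_mul, map_C, map_C,
    map_X, map_pow q, map_pow q, hmap] at h
  obtain ⟨f, hf⟩ := factorProd_dvd hζ hmn (hc.pow n) h
  obtain ⟨d, hd⟩ := (hc.pow m).exists_right_inv
  obtain ⟨p, hp⟩ := Polynomial.map_surjective q hq (C d * f)
  refine ⟨p, ?_⟩
  have h1 : (C (q c ^ m) : k[X]) * C d = 1 := by rw [← C_mul, hd, C_1]
  rw [Polynomial.map_sub, Polynomial.map_mul, Polynomial.map_mul, map_C, hmap, hp, hf,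
    map_pow]
  linear_combination -(f * factorProd (q b) (q ζ) m) * h1

end FactorProd

/-! ### The totally ramified places: leading terms -/

namespace CyclicFrame

set_option linter.unusedSectionVars false

variable {E L : Type*} [Field E] [NumberField E] [Field L] [NumberField L] [Algebra E L]
  {σ : L ≃ₐ[E] L} {D : Type*} [Ring D] [Algebra E D] (F : CyclicFrame σ D)

/-- The situation at a place `v = (π)` that is totally ramified in `L`, with uniformizer `δ` of `L`:
`c` and `ζ` are the residues of `δ⁵/π` and `σ(δ)/δ`, and `α = U⁵` is a unit congruent to `b⁵`. -/
structure RamifiedAt (v : HeightOneSpectrum (𝓞 E)) (π : 𝓞 E) (δ : L) (ζ c b : 𝓞 E) : Prop where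
  asIdeal_eq : v.asIdeal = Ideal.span {π}
  δ_mem : δ ∈ locInt v L
  δ_pow : ∃ ε ∈ locInt v L, ε ≠ 0 ∧ ε⁻¹ ∈ locInt v L ∧ δ ^ 5 = algebraMap E L π * ε ∧
    ∃ m ∈ locInt v L, ε = algebraMap E L c + δ * m
  map_δ : ∃ η ∈ locInt v L, η ≠ 0 ∧ η⁻¹ ∈ locInt v L ∧ σ δ = δ * η ∧
    ∃ m ∈ locInt v L, η = algebraMap E L ζ + δ * m
  residue : ∀ l ∈ locInt v L, ∃ n : 𝓞 E, ∃ m ∈ locInt v L, l = algebraMap E L n + δ * m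
  dual : ∀ l : L, (∀ m ∈ locInt v L, Algebra.trace E L (l * m) ∈ locInt v E) →
    l ∈ fracPow (locInt v L) δ (-4)
  fixed : ∀ l : L, σ l = l → ∃ e : E, l = algebraMap E L e
  σ_pow : σ ^ 5 = 1
  ζ_pow : ζ ^ 5 - 1 ∈ v.asIdeal
  ζ_ne : ζ - 1 ∉ v.asIdeal
  α_ne : F.α ≠ 0
  α_mem : F.α ∈ locInt v E
  α_inv_mem : F.α⁻¹ ∈ locInt v E
  α_congr : ∃ f ∈ locInt v E, F.α - (b : E) ^ 5 = π * f

/-- The elements of `D` all of whose coordinates are divisible by `δᵏ`. -/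
def depth (v : HeightOneSpectrum (𝓞 E)) (δ : L) (k : ℤ) : AddSubgroup D where
  carrier := {z | ∀ i, F.coord z i ∈ fracPow (locInt v L) δ k}
  add_mem' {y z} hy hz i := by
    rw [map_add]
    exact add_mem (hy i) (hz i)
  zero_mem' i := by
    rw [map_zero]
    exact zero_mem _
  neg_mem' {y} hy i := by
    rw [map_neg]
    exact neg_mem (hy i)

open Polynomial in
/-- The element `z` has leading term `p(U) δ⁻ᵐ`, up to terms of smaller pole order in `δ`. -/
def Lead (v : HeightOneSpectrum (𝓞 E)) (δ : L) (m : ℕ) (z : D) (p : (𝓞 E)[X]) : Prop :=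
  z - aeval F.U p * F.ι (δ ^ (-(m : ℤ))) ∈ F.depth v δ (-(m : ℤ) + 1)

variable {F} {v : HeightOneSpectrum (𝓞 E)} {π : 𝓞 E} {δ : L} {ζ c b : 𝓞 E}

namespace RamifiedAt

theorem mem (h : F.RamifiedAt v π δ ζ c b) : π ∈ v.asIdeal := by
  rw [h.asIdeal_eq]; exact Ideal.mem_span_singleton_self _

theorem coe_ne_zero (h : F.RamifiedAt v π δ ζ c b) : (π : E) ≠ 0 := by
  intro h0
  rw [RingOfIntegers.coe_eq_zero_iff] at h0
  exact v.ne_bot (by rw [h.asIdeal_eq, h0]; simp)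

theorem algebraMap_ne_zero (h : F.RamifiedAt v π δ ζ c b) : algebraMap E L π ≠ 0 := by
  simpa using h.coe_ne_zero

theorem δ_ne_zero (h : F.RamifiedAt v π δ ζ c b) : δ ≠ 0 := by
  rintro rfl
  obtain ⟨ε, _, h0, _, h1, _⟩ := h.δ_pow
  rw [zero_pow (by norm_num)] at h1
  exact (mul_ne_zero h.algebraMap_ne_zero h0) h1.symm

theorem fracPow_le' (h : F.RamifiedAt v π δ ζ c b) {j k : ℤ} (hjk : j ≤ k) :
    fracPow (locInt v L) δ k ≤ fracPow (locInt v L) δ j :=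
  fracPow_le h.δ_ne_zero h.δ_mem hjk

theorem mem_fracPow_one_iff (h : F.RamifiedAt v π δ ζ c b) {l : L} :
    l ∈ fracPow (locInt v L) δ 1 ↔ ∃ m ∈ locInt v L, l = δ * m := by
  rw [mem_fracPow_iff_exists h.δ_ne_zero]; simp

theorem algebraMap_mem_fracPow_five (h : F.RamifiedAt v π δ ζ c b) :
    algebraMap E L π ∈ fracPow (locInt v L) δ 5 := by
  obtain ⟨ε, _, h0, h1, h2, _⟩ := h.δ_pow
  rw [mem_fracPow_iff_exists h.δ_ne_zero]
  refine ⟨ε⁻¹, h1, ?_⟩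
  rw [show (5 : ℤ) = (5 : ℕ) from rfl, zpow_natCast, h2, mul_assoc, mul_inv_cancel₀ h0, mul_one]

theorem algebraMap_coe_mem_of_mem (h : F.RamifiedAt v π δ ζ c b) {n : 𝓞 E} (hn : n ∈ v.asIdeal) :
    algebraMap E L n ∈ fracPow (locInt v L) δ 5 := by
  rw [h.asIdeal_eq, Ideal.mem_span_singleton] at hn
  obtain ⟨k, rfl⟩ := hn
  rw [RingOfIntegers.val_mul, map_mul]
  have := fracPow_mul_mem h.δ_ne_zero h.algebraMap_mem_fracPow_five
    (mem_fracPow_zero.2 (algebraMap_coe_mem_locInt (L := L) (v := v) k))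
  rwa [add_zero] at this

theorem zpow_mem_locInt (h : F.RamifiedAt v π δ ζ c b) {k : ℤ}
    (hk : (π : E) ^ k ∈ locInt v E) : 0 ≤ k := by
  by_contra! hneg
  obtain ⟨n, hn⟩ : ∃ n : ℕ, k = -(n + 1) := ⟨(-k - 1).toNat, by omega⟩
  subst hn
  refine coe_mul_ne_one_of_mem h.mem (mul_mem hk (pow_mem (coe_mem_locInt π) n)) ?_
  rw [← zpow_natCast, ← zpow_add₀ h.coe_ne_zero, ← zpow_one_add₀ h.coe_ne_zero]
  convert zpow_zero _ using 2
  ring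

/-- An element of `E` whose order of vanishing at the place of `L` exceeds `-5` is integral. -/
theorem mem_locInt_of_algebraMap_mem (h : F.RamifiedAt v π δ ζ c b) {e : E}
    (he : algebraMap E L e ∈ fracPow (locInt v L) δ (-4)) : e ∈ locInt v E := by
  by_cases he0 : e = 0
  · rw [he0]; exact zero_mem _
  obtain ⟨r, n, hr, hn⟩ : ∃ r n : 𝓞 E, r ≠ 0 ∧ (r : E) * e = n := by
    obtain ⟨⟨n, d⟩, hnd⟩ := IsLocalization.surj (nonZeroDivisors (𝓞 E)) e
    exact ⟨d, n, nonZeroDivisors.ne_zero d.2, by rw [mul_comm]; exact hnd⟩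
  have hr0 : (r : E) ≠ 0 := RingOfIntegers.coe_ne_zero_iff.2 hr
  have hn0 : n ≠ 0 := by
    rintro rfl
    exact mul_ne_zero hr0 he0 (by rw [hn]; simp)
  obtain ⟨i, s, hs, rfl⟩ := exists_pow_mul_unit h.asIdeal_eq hr
  obtain ⟨j, t, ht, rfl⟩ := exists_pow_mul_unit h.asIdeal_eq hn0
  have hs0 := ne_zero_of_notMem hs
  have ht0 := ne_zero_of_notMem ht
  have he1 : e = (π : E) ^ ((j : ℤ) - i) * (t * (s : E)⁻¹) := by
    rw [RingOfIntegers.val_mul, RingOfIntegers.val_mul, RingOfIntegers.val_pow,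
      RingOfIntegers.val_pow] at hn
    rw [zpow_sub₀ h.coe_ne_zero, zpow_natCast, zpow_natCast]
    have := h.coe_ne_zero
    field_simp
    linear_combination hn
  -- With `e` of valuation `k` at `v`, the exponent `4 + 5 k` is nonnegative, and hence so is `k`.
  have h20 : (π : E) ^ 4 * e ^ 5 ∈ locInt v E := by
    rw [← algebraMap_mem_locInt_iff (L := L), ← mem_fracPow_zero (ϖ := δ)]
    have h1 := h.algebraMap_mem_fracPow_five
    have h2 := fracPow_mul_mem h.δ_ne_zero (fracPow_mul_mem h.δ_ne_zero
      (fracPow_mul_mem h.δ_ne_zero h1 h1) (fracPow_mul_mem h.δ_ne_zero h1 h1))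
      (fracPow_mul_mem h.δ_ne_zero (fracPow_mul_mem h.δ_ne_zero
        (fracPow_mul_mem h.δ_ne_zero he he) (fracPow_mul_mem h.δ_ne_zero he he)) he)
    rw [map_mul, map_pow, map_pow]
    rw [show (5 + 5 + (5 + 5) + (-4 + -4 + (-4 + -4) + -4) : ℤ) = 0 by norm_num] at h2
    have h3 : algebraMap E L π ^ 4 * algebraMap E L e ^ 5 =
        algebraMap E L π * algebraMap E L π * (algebraMap E L π * algebraMap E L π) *
        (algebraMap E L e * algebraMap E L e * (algebraMap E L e * algebraMap E L e) *
          algebraMap E L e) := by ring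
    rw [h3]
    exact h2
  have hk : 0 ≤ 4 + 5 * ((j : ℤ) - i) := by
    refine h.zpow_mem_locInt ?_
    have h3 := mul_mem h20 (pow_mem (mul_mem (coe_mem_locInt s) (inv_coe_mem_locInt ht)) 5)
    rw [he1] at h3
    have h4 : (π : E) ^ (4 + 5 * ((j : ℤ) - i)) =
        (π : E) ^ 4 * ((π : E) ^ ((j : ℤ) - i)) ^ 5 := by
      rw [zpow_add₀ h.coe_ne_zero, mul_comm (5 : ℤ), zpow_mul]
      norm_cast
    have h5 : (t : E) * (s : E)⁻¹ * (s * (t : E)⁻¹) = 1 := by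
      field_simp
    rw [h4]
    convert h3 using 1
    rw [mul_assoc, ← _root_.mul_pow, mul_assoc _ ((t : E) * _), h5, mul_one]
  obtain ⟨k, hk⟩ : ∃ k : ℕ, (j : ℤ) - i = k := ⟨((j : ℤ) - i).toNat, by omega⟩
  rw [he1, hk, zpow_natCast]
  exact mul_mem (pow_mem (coe_mem_locInt π) k)
    (mul_mem (coe_mem_locInt t) (inv_coe_mem_locInt hs))

theorem mem_asIdeal_of_algebraMap_mem (h : F.RamifiedAt v π δ ζ c b) {n : 𝓞 E}
    (hn : algebraMap E L n ∈ fracPow (locInt v L) δ 1) : n ∈ v.asIdeal := by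
  -- `n / π` has order greater than `-5` in `δ`.
  have h1 : algebraMap E L ((n : E) / π) ∈ fracPow (locInt v L) δ (-4) := by
    obtain ⟨m, hm, h1⟩ := h.mem_fracPow_one_iff.1 hn
    obtain ⟨ε, hε, h0, _, h2, _⟩ := h.δ_pow
    have h3 : algebraMap E L ((n : E) / π) = δ ^ (-4 : ℤ) * (ε * m) := by
      have := h.δ_ne_zero
      have := h.algebraMap_ne_zero
      rw [map_div₀, h1, zpow_neg, show (4 : ℤ) = (4 : ℕ) from rfl, zpow_natCast]
      field_simp
      linear_combination m * h2
    rw [h3]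
    exact zpow_mul_mem_fracPow h.δ_ne_zero (mul_mem hε hm)
  refine mem_asIdeal_of_div_mem_locInt h.asIdeal_eq (h.mem_locInt_of_algebraMap_mem h1) ?_
  have := h.coe_ne_zero
  field_simp

theorem one_notMem (h : F.RamifiedAt v π δ ζ c b) : (1 : L) ∉ fracPow (locInt v L) δ 1 := by
  intro h1
  refine HeightOneSpectrum.one_notMem v (h.mem_asIdeal_of_algebraMap_mem ?_)
  simpa using h1

theorem c_notMem (h : F.RamifiedAt v π δ ζ c b) : c ∉ v.asIdeal := by
  intro hc
  obtain ⟨ε, hε, h0, h1, _, m, hm, h2⟩ := h.δ_pow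
  apply h.one_notMem
  have h3 : ε ∈ fracPow (locInt v L) δ 1 := by
    rw [h2]
    exact add_mem (h.fracPow_le' (by norm_num) (h.algebraMap_coe_mem_of_mem hc))
      (h.mem_fracPow_one_iff.2 ⟨m, hm, rfl⟩)
  have := fracPow_mul_mem h.δ_ne_zero h3 (mem_fracPow_zero.2 h1)
  rwa [mul_inv_cancel₀ h0, add_zero] at this

theorem map_mem (h : F.RamifiedAt v π δ ζ c b) {k : ℤ} {l : L}
    (hl : l ∈ fracPow (locInt v L) δ k) : σ l ∈ fracPow (locInt v L) δ k := by
  obtain ⟨η, h1, _, h2, h3, _⟩ := h.map_δ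
  exact map_mem_fracPow (fun _ => map_mem_locInt σ) h3 h1 h2 hl

theorem pow_map_mem (h : F.RamifiedAt v π δ ζ c b) (i : ℕ) {k : ℤ} {l : L}
    (hl : l ∈ fracPow (locInt v L) δ k) : (σ ^ i) l ∈ fracPow (locInt v L) δ k := by
  induction i with
  | zero => simpa using hl
  | succ i ih => rw [pow_succ']; exact h.map_mem ih

theorem symm_eq (h : F.RamifiedAt v π δ ζ c b) : σ.symm = σ ^ 4 := by
  rw [show σ.symm = σ⁻¹ from rfl]
  exact inv_eq_of_mul_eq_one_left (by rw [← pow_succ, h.σ_pow])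

theorem symm_map_mem (h : F.RamifiedAt v π δ ζ c b) {k : ℤ} {l : L}
    (hl : l ∈ fracPow (locInt v L) δ k) : σ.symm l ∈ fracPow (locInt v L) δ k := by
  rw [h.symm_eq]
  exact h.pow_map_mem 4 hl

/-- The ramification is total: `σ` acts trivially on residues. -/
theorem sub_symm_mem (h : F.RamifiedAt v π δ ζ c b) {l : L} (hl : l ∈ locInt v L) :
    l - σ.symm l ∈ fracPow (locInt v L) δ 1 := by
  obtain ⟨n, m, hm, rfl⟩ := h.residue l hl
  rw [map_add, AlgEquiv.commutes, add_sub_add_left_eq_sub]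
  have h1 : δ * m ∈ fracPow (locInt v L) δ 1 := h.mem_fracPow_one_iff.2 ⟨m, hm, rfl⟩
  exact sub_mem h1 (h.symm_map_mem h1)

theorem depth_le (h : F.RamifiedAt v π δ ζ c b) {j k : ℤ} (hjk : j ≤ k) :
    F.depth v δ k ≤ F.depth v δ j := fun _ hz i => h.fracPow_le' hjk (hz i)

theorem depth_mul (h : F.RamifiedAt v π δ ζ c b) {j k : ℤ} {z w : D} (hz : z ∈ F.depth v δ j)
    (hw : w ∈ F.depth v δ k) : z * w ∈ F.depth v δ (j + k) := by
  intro i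
  rw [F.coord_mul]
  refine sum_mem fun a _ => ?_
  have h1 := fracPow_mul_mem h.δ_ne_zero (hz a) (h.pow_map_mem (a : ℕ) (hw (i - a)))
  have h2 : (if a ≤ i then 1 else algebraMap E L F.α) ∈ fracPow (locInt v L) δ 0 := by
    rw [mem_fracPow_zero]
    split_ifs
    · exact one_mem _
    · exact algebraMap_mem_locInt h.α_mem
  have := fracPow_mul_mem h.δ_ne_zero h1 h2
  rwa [add_zero] at this

theorem ι_mem_depth (_ : F.RamifiedAt v π δ ζ c b) {k : ℤ} {l : L}
    (hl : l ∈ fracPow (locInt v L) δ k) : F.ι l ∈ F.depth v δ k := by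
  intro i
  rw [F.coord_ι]
  by_cases hi : i = 0
  · subst hi; simpa using hl
  · simp [hi]

theorem ι_zpow_mem_depth (h : F.RamifiedAt v π δ ζ c b) (k : ℤ) : F.ι (δ ^ k) ∈ F.depth v δ k :=
  h.ι_mem_depth (by simpa using zpow_mul_mem_fracPow h.δ_ne_zero (k := k) (one_mem (locInt v L)))

theorem U_pow_mem_depth (h : F.RamifiedAt v π δ ζ c b) (n : ℕ) : F.U ^ n ∈ F.depth v δ 0 := by
  induction n with
  | zero =>
    rw [pow_zero, ← map_one F.ι]
    exact h.ι_mem_depth (mem_fracPow_zero.2 (one_mem _))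
  | succ n ih =>
    have h1 : F.U ∈ F.depth v δ 0 := by
      intro i
      have := F.coord_pow 1
      simp only [Fin.val_one, pow_one] at this
      rw [this, mem_fracPow_zero]
      by_cases hi : i = 1
      · subst hi; simp
      · simp [hi]
    have := h.depth_mul ih h1
    rwa [add_zero, ← pow_succ] at this

open Polynomial in
theorem aeval_mem_depth (h : F.RamifiedAt v π δ ζ c b) (p : (𝓞 E)[X]) :
    aeval F.U p ∈ F.depth v δ 0 := by
  rw [aeval_eq_sum_range]
  refine sum_mem fun i _ => ?_
  rw [← algebraMap_smul E, Algebra.smul_def, ← F.ι.commutes]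
  have := h.depth_mul (h.ι_mem_depth (mem_fracPow_zero.2
    (algebraMap_coe_mem_locInt (L := L) (v := v) (p.coeff i)))) (h.U_pow_mem_depth i)
  rwa [add_zero] at this

end RamifiedAt

end CyclicFrame

namespace CyclicFrame

set_option linter.unusedSectionVars false

variable {E L : Type*} [Field E] [NumberField E] [Field L] [NumberField L] [Algebra E L]
  {σ : L ≃ₐ[E] L} {D : Type*} [Ring D] [Algebra E D] (F : CyclicFrame σ D)

/-- The element `(b - U) δ⁴ / π`. -/
def ramifiedGen (π : 𝓞 E) (δ : L) (b : 𝓞 E) : D :=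
  (F.ι (algebraMap E L b) - F.U) * F.ι (δ ^ 4 / algebraMap E L π)

theorem ι_coe (n : 𝓞 E) : F.ι (algebraMap E L n) = algebraMap (𝓞 E) D n := by
  rw [F.ι.commutes]; rfl

variable {F} {v : HeightOneSpectrum (𝓞 E)} {π : 𝓞 E} {δ : L} {ζ c b : 𝓞 E}

open Polynomial

theorem Lead.of_sub_mem {m : ℕ} {z w : D} {p : (𝓞 E)[X]} (hz : F.Lead v δ m z p)
    (h : w - z ∈ F.depth v δ (-(m : ℤ) + 1)) : F.Lead v δ m w p := by
  have := add_mem h hz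
  rwa [← add_sub_assoc, sub_add_cancel] at this

theorem Lead.sub {m : ℕ} {z w : D} {p q : (𝓞 E)[X]} (hz : F.Lead v δ m z p)
    (hw : F.Lead v δ m w q) : F.Lead v δ m (z - w) (p - q) := by
  have := sub_mem hz hw
  rwa [sub_sub_sub_comm, ← sub_mul, ← map_sub] at this

namespace RamifiedAt

theorem lead_mem (h : F.RamifiedAt v π δ ζ c b) {m : ℕ} {z : D} {p : (𝓞 E)[X]}
    (hz : F.Lead v δ m z p) : z ∈ F.depth v δ (-(m : ℤ)) := by
  have h1 := h.depth_mul (h.aeval_mem_depth p) (h.ι_zpow_mem_depth (-(m : ℤ)))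
  rw [zero_add] at h1
  have := add_mem (h.depth_le (by omega) hz) h1
  rwa [sub_add_cancel] at this

theorem lead_aeval_mul (h : F.RamifiedAt v π δ ζ c b) {m : ℕ} {z : D} {p : (𝓞 E)[X]}
    (hz : F.Lead v δ m z p) (q : (𝓞 E)[X]) : F.Lead v δ m (aeval F.U q * z) (q * p) := by
  have := h.depth_mul (h.aeval_mem_depth q) hz
  rwa [zero_add, mul_sub, ← mul_assoc, ← map_mul] at this

theorem lead_ι_mul (h : F.RamifiedAt v π δ ζ c b) {m : ℕ} {z : D} {p : (𝓞 E)[X]}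
    (hz : F.Lead v δ m z p) {l l' : L} {n : 𝓞 E} (hl' : l' ∈ locInt v L)
    (hl : l = algebraMap E L n + δ * l') : F.Lead v δ m (F.ι l * z) (C n * p) := by
  refine (h.lead_aeval_mul hz (C n)).of_sub_mem ?_
  rw [aeval_C, ← F.ι_coe, ← sub_mul, ← map_sub, hl, add_sub_cancel_left]
  have := h.depth_mul (h.ι_mem_depth (h.mem_fracPow_one_iff.2 ⟨l', hl', rfl⟩)) (h.lead_mem hz)
  rwa [add_comm] at this

theorem symm_inv_sub_mem (h : F.RamifiedAt v π δ ζ c b) :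
    σ.symm δ⁻¹ - algebraMap E L ζ * δ⁻¹ ∈ fracPow (locInt v L) δ 0 := by
  obtain ⟨η, _, h0, _, h1, m, hm, h2⟩ := h.map_δ
  have h3 : δ = σ.symm δ * σ.symm η := by rw [← map_mul, ← h1, σ.symm_apply_apply]
  have h4 : σ.symm δ⁻¹ = δ⁻¹ * σ.symm η := by
    have h5 : σ.symm δ ≠ 0 := by simpa using h.δ_ne_zero
    have := h.δ_ne_zero
    rw [map_inv₀]
    field_simp
    exact h3
  have h5 : σ.symm η - algebraMap E L ζ ∈ fracPow (locInt v L) δ 1 := by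
    rw [h2, map_add, AlgEquiv.commutes, add_sub_cancel_left]
    exact h.symm_map_mem (h.mem_fracPow_one_iff.2 ⟨m, hm, rfl⟩)
  have h6 : δ ^ (-1 : ℤ) ∈ fracPow (locInt v L) δ (-1) := by
    simpa using zpow_mul_mem_fracPow h.δ_ne_zero (k := -1) (one_mem (locInt v L))
  have := fracPow_mul_mem h.δ_ne_zero h6 h5
  rw [h4]
  rwa [zpow_neg_one, mul_sub, mul_comm _ (algebraMap E L ζ), neg_add_cancel] at this

/-- Moving `δ⁻¹` across a polynomial in `U` substitutes `ζ X` for `X` in its leading term. -/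
theorem ι_inv_mul_aeval_sub_mem (h : F.RamifiedAt v π δ ζ c b) (p : (𝓞 E)[X]) :
    F.ι δ⁻¹ * aeval F.U p - aeval F.U (p.comp (C ζ * X)) * F.ι δ⁻¹ ∈ F.depth v δ 0 := by
  induction p using Polynomial.induction_on with
  | C a =>
    rw [C_comp, aeval_C, ← F.ι_coe, ← map_mul, ← map_mul, mul_comm, sub_self]
    exact zero_mem _
  | add p q hp hq =>
    have := add_mem hp hq
    rwa [add_comp, map_add, map_add, mul_add, add_mul, add_sub_add_comm]
  | monomial n a ih =>
    set p : (𝓞 E)[X] := C a * X ^ n with hp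
    have h0 : C a * X ^ (n + 1) = p * X := by rw [hp, pow_succ, mul_assoc]
    clear_value p
    have h1 : F.ι δ⁻¹ * F.U = F.U * F.ι (σ.symm δ⁻¹) := by
      simpa using F.mul_pow 1 δ⁻¹
    have h2 : F.ι δ⁻¹ * aeval F.U (p * X) - aeval F.U ((p * X).comp (C ζ * X)) * F.ι δ⁻¹ =
        (F.ι δ⁻¹ * aeval F.U p - aeval F.U (p.comp (C ζ * X)) * F.ι δ⁻¹) * F.U ^ 1 +
        aeval F.U (p.comp (C ζ * X)) *
          (F.U ^ 1 * F.ι (σ.symm δ⁻¹ - algebraMap E L ζ * δ⁻¹)) := by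
      rw [mul_comp, X_comp, map_mul, map_mul, map_mul, aeval_X, aeval_C, pow_one, map_sub,
        map_mul, mul_sub, mul_sub, sub_mul, ← h1, F.ι_coe, ← mul_assoc F.U (algebraMap _ _ ζ),
        ← Algebra.commutes ζ F.U]
      simp only [mul_assoc]
      abel
    rw [h0, h2]
    have h3 := h.depth_mul ih (h.U_pow_mem_depth 1)
    have h4 := h.depth_mul (h.aeval_mem_depth (p.comp (C ζ * X)))
      (h.depth_mul (h.U_pow_mem_depth 1) (h.ι_mem_depth h.symm_inv_sub_mem))
    rw [zero_add] at h3
    rw [zero_add, zero_add] at h4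
    exact add_mem h3 h4

theorem lead_ι_inv_mul (h : F.RamifiedAt v π δ ζ c b) {m : ℕ} {z : D} {p : (𝓞 E)[X]}
    (hz : F.Lead v δ m z p) : F.Lead v δ (m + 1) (F.ι δ⁻¹ * z) (p.comp (C ζ * X)) := by
  have h1 := h.depth_mul (h.ι_zpow_mem_depth (-1)) hz
  have h2 := h.depth_mul (h.ι_inv_mul_aeval_sub_mem p) (h.ι_zpow_mem_depth (-(m : ℤ)))
  have h3 : δ ^ (-((m + 1 : ℕ) : ℤ)) = δ⁻¹ * δ ^ (-(m : ℤ)) := by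
    rw [← zpow_neg_one, ← zpow_add₀ h.δ_ne_zero]
    congr 1
    push_cast
    ring
  have h4 : F.ι δ⁻¹ * z - aeval F.U (p.comp (C ζ * X)) * F.ι (δ ^ (-((m + 1 : ℕ) : ℤ))) =
      F.ι (δ ^ (-1 : ℤ)) * (z - aeval F.U p * F.ι (δ ^ (-(m : ℤ)))) +
      (F.ι δ⁻¹ * aeval F.U p - aeval F.U (p.comp (C ζ * X)) * F.ι δ⁻¹) *
        F.ι (δ ^ (-(m : ℤ))) := by
    rw [h3, map_mul, mul_sub, sub_mul, zpow_neg_one]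
    simp only [mul_assoc]
    abel
  rw [Lead, h4]
  refine add_mem (h.depth_le ?_ h1) (h.depth_le ?_ h2) <;> push_cast <;> omega

theorem lead_ι_zpow_mul (h : F.RamifiedAt v π δ ζ c b) {m : ℕ} {z : D} {p : (𝓞 E)[X]}
    (hz : F.Lead v δ m z p) (k : ℕ) :
    F.Lead v δ (m + k) (F.ι (δ ^ (-(k : ℤ))) * z) (p.comp (C (ζ ^ k) * X)) := by
  induction k with
  | zero => simpa using hz
  | succ k ih =>
    have h1 := h.lead_ι_inv_mul ih
    have h3 : δ ^ (-((k + 1 : ℕ) : ℤ)) = δ⁻¹ * δ ^ (-(k : ℤ)) := by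
      rw [← zpow_neg_one, ← zpow_add₀ h.δ_ne_zero]
      congr 1
      push_cast
      ring
    have h4 : (p.comp (C (ζ ^ k) * X)).comp (C ζ * X) = p.comp (C (ζ ^ (k + 1)) * X) := by
      rw [comp_assoc, mul_comp, C_comp, X_comp, ← mul_assoc, ← C_mul, pow_succ]
    rw [h3, map_mul, mul_assoc, ← h4]
    exact h1

/-- The leading term of a product: `δ⁻ᵐ` has to be moved across the second factor. -/
theorem lead_mul (h : F.RamifiedAt v π δ ζ c b) {m k : ℕ} {y z : D} {g p : (𝓞 E)[X]}
    (hy : F.Lead v δ m y g) (hz : F.Lead v δ k z p) :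
    F.Lead v δ (m + k) (y * z) (g * p.comp (C (ζ ^ m) * X)) := by
  have h1 := h.lead_aeval_mul (h.lead_ι_zpow_mul hz m) g
  rw [add_comm k m] at h1
  refine h1.of_sub_mem ?_
  rw [← mul_assoc, ← sub_mul]
  have h2 := h.depth_mul hy (h.lead_mem hz)
  refine h.depth_le ?_ h2
  push_cast
  omega

/-- Multiplication by `(b - U) δ⁴ / π` multiplies leading terms by `c (b - X)`, after substituting
`ζ X` for `X`. -/
theorem lead_ramifiedGen_mul (h : F.RamifiedAt v π δ ζ c b) {m : ℕ} {z : D} {p : (𝓞 E)[X]}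
    (hz : F.Lead v δ m z p) :
    F.Lead v δ (m + 1) (F.ramifiedGen π δ b * z)
      ((C b - X) * (C c * p.comp (C ζ * X))) := by
  obtain ⟨ε, h1, h2, h3, h4, l, hl, h5⟩ := h.δ_pow
  have h6 : δ ^ 4 / algebraMap E L π = ε * δ⁻¹ := by
    have := h.δ_ne_zero
    have := h.algebraMap_ne_zero
    field_simp
    linear_combination h4
  have := h.lead_aeval_mul (h.lead_ι_mul (h.lead_ι_inv_mul hz) hl h5) (C b - X)
  rw [map_sub, aeval_C, aeval_X, ← F.ι_coe] at this
  rw [ramifiedGen, h6, map_mul, mul_assoc, mul_assoc]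
  exact this

theorem lead_ramifiedGen_pow (h : F.RamifiedAt v π δ ζ c b) (m : ℕ) :
    F.Lead v δ m (F.ramifiedGen π δ b ^ m) (C (c ^ m) * factorProd b ζ m) := by
  induction m with
  | zero =>
    simp [Lead, factorProd]
  | succ m ih =>
    have := h.lead_ramifiedGen_mul ih
    rw [pow_succ', ← factorProd_succ, pow_succ']
    rw [mul_comp, C_comp] at this
    rw [C_mul]
    convert this using 1
    ring

/-- Elements with a pole of order at most `m` have leading terms, as `L` has the same residues as
`E`. -/
theorem exists_lead (h : F.RamifiedAt v π δ ζ c b) {m : ℕ} {z : D}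
    (hz : z ∈ F.depth v δ (-(m : ℤ))) : ∃ p, F.Lead v δ m z p := by
  have h1 : ∀ i : Fin 5, ∃ p, F.Lead v δ m (F.ι (F.coord z i) * F.U ^ (i : ℕ)) p := by
    intro i
    rw [F.mul_pow]
    have h2 : (σ.symm ^ (i : ℕ)) (F.coord z i) ∈ fracPow (locInt v L) δ (-(m : ℤ)) := by
      rw [h.symm_eq, ← _root_.pow_mul]
      exact h.pow_map_mem _ (hz i)
    obtain ⟨l, hl, h3⟩ := (mem_fracPow_iff_exists h.δ_ne_zero).1 h2
    obtain ⟨n, l', hl', rfl⟩ := h.residue l hl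
    refine ⟨X ^ (i : ℕ) * C n, ?_⟩
    rw [h3, Lead, map_mul (aeval F.U), map_pow, aeval_X, aeval_C, mul_assoc, ← mul_sub, ← F.ι_coe,
      ← map_mul, ← map_sub, mul_add, mul_comm (algebraMap E L n), add_sub_cancel_left]
    have h4 := fracPow_mul_mem h.δ_ne_zero
      (zpow_mul_mem_fracPow h.δ_ne_zero (k := -(m : ℤ)) (one_mem (locInt v L)))
      (h.mem_fracPow_one_iff.2 ⟨l', hl', rfl⟩)
    rw [mul_one] at h4
    have := h.depth_mul (h.U_pow_mem_depth (i : ℕ)) (h.ι_mem_depth h4)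
    rwa [zero_add] at this
  choose p hp using h1
  refine ⟨∑ i, p i, ?_⟩
  rw [Lead, map_sum, Finset.sum_mul]
  nth_rewrite 1 [← F.sum_coord z]
  rw [← Finset.sum_sub_distrib]
  exact sum_mem fun i _ => hp i

theorem ι_zpow_cancel (h : F.RamifiedAt v π δ ζ c b) {m : ℕ} {k : ℤ} {z : D}
    (hz : z * F.ι (δ ^ (-(m : ℤ))) ∈ F.depth v δ (-(m : ℤ) + k)) : z ∈ F.depth v δ k := by
  have h1 := h.depth_mul hz (h.ι_zpow_mem_depth (m : ℤ))
  rw [mul_assoc, ← map_mul, ← zpow_add₀ h.δ_ne_zero, neg_add_cancel, zpow_zero, map_one, mul_one]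
    at h1
  exact h.depth_le (by omega) h1

theorem aeval_X_pow_sub_C_mem (h : F.RamifiedAt v π δ ζ c b) :
    aeval F.U (X ^ 5 - C (b ^ 5) : (𝓞 E)[X]) ∈ F.depth v δ 5 := by
  obtain ⟨f, hf, h1⟩ := h.α_congr
  rw [map_sub, map_pow, aeval_X, aeval_C, F.U_pow, ← F.ι_coe, ← F.ι.commutes, ← map_sub, ← map_sub,
    RingOfIntegers.val_pow, h1, map_mul]
  have := fracPow_mul_mem h.δ_ne_zero h.algebraMap_mem_fracPow_five
    (mem_fracPow_zero.2 (algebraMap_mem_locInt (L := L) hf))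
  rw [add_zero] at this
  exact h.ι_mem_depth this

/-- A leading term that cancels is divisible by `X⁵ - b⁵` modulo `v`. -/
theorem dvd_of_lead (h : F.RamifiedAt v π δ ζ c b) {m : ℕ} {z : D} {p : (𝓞 E)[X]}
    (hz : F.Lead v δ m z p) (hz' : z ∈ F.depth v δ (-(m : ℤ) + 1)) :
    X ^ 5 - C (Ideal.Quotient.mk v.asIdeal b ^ 5) ∣ p.map (Ideal.Quotient.mk v.asIdeal) := by
  have h1 : aeval F.U p ∈ F.depth v δ 1 := by
    refine h.ι_zpow_cancel (m := m) ?_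
    have := sub_mem hz' hz
    rwa [sub_sub_cancel] at this
  -- The remainder of `p` modulo `X⁵ - b⁵` has degree at most `4`, so that its coefficients are the
  -- coordinates of its value at `U`.
  set Q : (𝓞 E)[X] := X ^ 5 - C (b ^ 5) with hQ
  have hmon : Q.Monic := monic_X_pow_sub_C _ (by norm_num)
  have hdeg : Q.natDegree = 5 := natDegree_X_pow_sub_C
  set r := p %ₘ Q with hr
  have h2 : aeval F.U r ∈ F.depth v δ 1 := by
    have h3 : aeval F.U p = aeval F.U r + aeval F.U Q * aeval F.U (p /ₘ Q) := by
      rw [← map_mul, ← map_add, modByMonic_add_div]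
    have h4 := h.depth_mul h.aeval_X_pow_sub_C_mem (h.aeval_mem_depth (p /ₘ Q))
    have := sub_mem h1 (h.depth_le (by norm_num) h4 : _ ∈ F.depth v δ 1)
    rwa [h3, add_sub_cancel_right] at this
  have hlt : r.natDegree < 5 := by
    rw [← hdeg]
    exact natDegree_modByMonic_lt p hmon (by intro h1; rw [h1] at hdeg; simp at hdeg)
  have h3 : ∀ i : Fin 5, r.coeff (i : ℕ) ∈ v.asIdeal := by
    intro i
    refine h.mem_asIdeal_of_algebraMap_mem ?_
    convert h2 i
    rw [aeval_eq_sum_range' hlt, ← Fin.sum_univ_eq_sum_range fun i => r.coeff i • F.U ^ i]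
    have h5 : ∀ j : Fin 5, r.coeff (j : ℕ) • F.U ^ (j : ℕ) =
        F.ι (algebraMap E L (r.coeff (j : ℕ))) * F.U ^ (j : ℕ) := by
      intro j
      rw [F.ι_coe, Algebra.smul_def]
    rw [Finset.sum_congr rfl fun j _ => h5 j, F.coord_sum]
  have h4 : r.map (Ideal.Quotient.mk v.asIdeal) = 0 := by
    ext i
    rw [coeff_map, coeff_zero, Ideal.Quotient.eq_zero_iff_mem]
    by_cases hi : i < 5
    · exact h3 ⟨i, hi⟩
    · rw [coeff_eq_zero_of_natDegree_lt (by omega)]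
      exact zero_mem _
  refine ⟨(p /ₘ Q).map (Ideal.Quotient.mk v.asIdeal), ?_⟩
  conv_lhs => rw [← modByMonic_add_div p (q := Q)]
  rw [Polynomial.map_add, ← hr, h4, zero_add, Polynomial.map_mul, hQ, Polynomial.map_sub,
    Polynomial.map_pow, map_X, map_C, map_pow]

theorem mem_depth_of_lead (h : F.RamifiedAt v π δ ζ c b) {m : ℕ} {z : D} {p : (𝓞 E)[X]}
    (hz : F.Lead v δ m z p) (hp : p.map (Ideal.Quotient.mk v.asIdeal) = 0) :
    z ∈ F.depth v δ (-(m : ℤ) + 1) := by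
  have h1 : aeval F.U p ∈ F.depth v δ 1 := by
    rw [aeval_eq_sum_range]
    refine sum_mem fun i _ => ?_
    rw [Algebra.smul_def, ← F.ι_coe]
    have h2 : p.coeff i ∈ v.asIdeal := by
      rw [← Ideal.Quotient.eq_zero_iff_mem, ← coeff_map, hp, coeff_zero]
    have := h.depth_mul (h.ι_mem_depth (h.algebraMap_coe_mem_of_mem h2)) (h.U_pow_mem_depth i)
    exact h.depth_le (by norm_num) this
  have h2 := h.depth_mul h1 (h.ι_zpow_mem_depth (-(m : ℤ)))
  have := add_mem hz (h.depth_le (by omega) h2)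
  rwa [sub_add_cancel] at this

end RamifiedAt

end CyclicFrame

namespace CyclicFrame

set_option linter.unusedSectionVars false

variable {E L : Type*} [Field E] [NumberField E] [Field L] [NumberField L] [Algebra E L]
  {σ : L ≃ₐ[E] L} {D : Type*} [Ring D] [Algebra E D] (F : CyclicFrame σ D)

/-- The sums `∑_{i < 5} yⁱ lᵢ` with `lᵢ ∈ Iᵢ`. -/
def powerSum (y : D) (I : Fin 5 → AddSubgroup L) : AddSubgroup D where
  carrier := {z | ∃ l : Fin 5 → L, (∀ i, l i ∈ I i) ∧ z = ∑ i : Fin 5, y ^ (i : ℕ) * F.ι (l i)}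
  add_mem' := by
    rintro _ _ ⟨l, hl, rfl⟩ ⟨m, hm, rfl⟩
    exact ⟨l + m, fun i => add_mem (hl i) (hm i), by
      simp [mul_add, Finset.sum_add_distrib]⟩
  zero_mem' := ⟨0, fun i => zero_mem _, by simp⟩
  neg_mem' := by
    rintro _ ⟨l, hl, rfl⟩
    exact ⟨-l, fun i => neg_mem (hl i), by simp⟩

variable {F}

theorem pow_mul_mem_powerSum (y : D) {I : Fin 5 → AddSubgroup L} (i : Fin 5) {l : L}
    (hl : l ∈ I i) : y ^ (i : ℕ) * F.ι l ∈ F.powerSum y I := by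
  classical
  refine ⟨Pi.single i l, fun j => ?_, ?_⟩
  · by_cases hj : j = i
    · subst hj; simpa using hl
    · simp [hj]
  · rw [Finset.sum_eq_single i (fun j _ hj => by simp [hj]) (by simp)]
    simp

theorem powerSum_le {y : D} {I : Fin 5 → AddSubgroup L} {T : AddSubgroup D}
    (h : ∀ (i : Fin 5), ∀ l ∈ I i, y ^ (i : ℕ) * F.ι l ∈ T) : F.powerSum y I ≤ T := by
  rintro _ ⟨l, hl, rfl⟩
  exact sum_mem fun i _ => h i _ (hl i)

section RightEval

open Polynomial

variable (F)

/-- The right evaluation `∑ Xⁱ fᵢ ↦ ∑ yⁱ fᵢ` of polynomials over `L` at an element of `D`. -/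
noncomputable def rightEval (y : D) (f : L[X]) : D := f.sum fun i l => y ^ i * F.ι l

variable {F}

theorem rightEval_add (y : D) (f g : L[X]) :
    F.rightEval y (f + g) = F.rightEval y f + F.rightEval y g :=
  sum_add_index f g _ (by simp) (by simp [mul_add])

theorem rightEval_mul_X_sub_C (y : D) (f : L[X]) (l : L) :
    F.rightEval y (f * (X - C l)) = y * F.rightEval y f - F.rightEval y f * F.ι l := by
  induction f using Polynomial.induction_on' with
  | add f g hf hg =>
    rw [add_mul, rightEval_add, rightEval_add, hf, hg]
    noncomm_ring
  | monomial n a =>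
    have h1 : monomial n a * (X - C l) = monomial (n + 1) a + monomial n (-(a * l)) := by
      rw [mul_sub, monomial_mul_X, monomial_mul_C, sub_eq_add_neg, map_neg]
    rw [h1, rightEval_add]
    simp only [rightEval]
    rw [sum_monomial_index _ _ (by simp), sum_monomial_index _ _ (by simp),
      sum_monomial_index _ _ (by simp), map_neg, map_mul, pow_succ']
    noncomm_ring

/-- The polynomial `∏_{j < n} (X - σ⁻ʲ(l))`. For `n = 5` and `l = b t` it differs from the reduced
characteristic polynomial of `(b - U) t` only in the constant coefficient. -/
noncomputable def conjProd (σ : L ≃ₐ[E] L) (l : L) (n : ℕ) : L[X] :=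
  ∏ j ∈ Finset.range n, (X - C ((σ.symm ^ j) l))

theorem conjProd_succ (l : L) (n : ℕ) :
    conjProd σ l (n + 1) = conjProd σ l n * (X - C ((σ.symm ^ n) l)) :=
  Finset.prod_range_succ _ _

/-- Successive right evaluations at `y = (b - U) t` pile up the powers of `U` one by one. -/
theorem rightEval_conjProd (b : E) (t : L) (n : ℕ) :
    F.rightEval ((F.ι (algebraMap E L b) - F.U) * F.ι t) (conjProd σ (algebraMap E L b * t) n) =
      (-1) ^ n * (F.U ^ n * F.ι (∏ j ∈ Finset.range n, (σ.symm ^ j) t)) := by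
  induction n with
  | zero => simp [conjProd, rightEval, ← C_1, sum_C_index, -map_one]
  | succ n ih =>
    rw [conjProd_succ, rightEval_mul_X_sub_C, ih, Finset.prod_range_succ, map_mul, map_mul,
      AlgEquiv.commutes]
    set N := ∏ j ∈ Finset.range n, (σ.symm ^ j) t
    have h1 : F.ι t * F.U ^ n = F.U ^ n * F.ι ((σ.symm ^ n) t) := F.mul_pow n t
    have h2 : F.ι (algebraMap E L b) * F.U ^ n = F.U ^ n * F.ι (algebraMap E L b) := by
      rw [F.ι.commutes, Algebra.commutes]
    have h3 : F.ι ((σ.symm ^ n) t) * F.ι N = F.ι N * F.ι ((σ.symm ^ n) t) := by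
      rw [← map_mul, ← map_mul, mul_comm]
    have h4 : F.ι (algebraMap E L b) * F.ι N = F.ι N * F.ι (algebraMap E L b) := by
      rw [← map_mul, ← map_mul, mul_comm]
    have h5 : (F.ι (algebraMap E L b) - F.U) * F.ι t * (F.U ^ n * F.ι N) =
        F.U ^ n * F.ι N * (F.ι (algebraMap E L b) * F.ι ((σ.symm ^ n) t)) -
          F.U ^ (n + 1) * (F.ι N * F.ι ((σ.symm ^ n) t)) := by
      calc _ = (F.ι (algebraMap E L b) - F.U) * (F.ι t * F.U ^ n) * F.ι N := by noncomm_ring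
        _ = F.ι (algebraMap E L b) * F.U ^ n * F.ι ((σ.symm ^ n) t) * F.ι N -
            F.U * F.U ^ n * (F.ι ((σ.symm ^ n) t) * F.ι N) := by rw [h1]; noncomm_ring
        _ = F.U ^ n * (F.ι (algebraMap E L b) * (F.ι ((σ.symm ^ n) t) * F.ι N)) -
            F.U * F.U ^ n * (F.ι ((σ.symm ^ n) t) * F.ι N) := by rw [h2]; noncomm_ring
        _ = _ := by
          rw [h3, ← mul_assoc (F.ι (algebraMap E L b)), h4, ← pow_succ']
          noncomm_ring
    have h6 : ∀ w : D, w * ((-1) ^ n * (F.U ^ n * F.ι N)) =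
        (-1) ^ n * (w * (F.U ^ n * F.ι N)) := by
      intro w
      rw [← mul_assoc, ← mul_assoc ((-1) ^ n), ((Commute.neg_one_left w).pow_left n).eq]
    rw [h6, h5, pow_succ (-1 : D), map_mul F.ι N]
    noncomm_ring

theorem coeff_conjProd_mem {B : Subring L} {ϖ : L} (h0 : ϖ ≠ 0) {l : L}
    (hl : ∀ j, (σ.symm ^ j) l ∈ fracPow B ϖ (-1)) (n k : ℕ) :
    (conjProd σ l n).coeff k ∈ fracPow B ϖ ((k : ℤ) - n) := by
  induction n generalizing k with
  | zero =>
    rw [conjProd, Finset.prod_range_zero, coeff_one]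
    split_ifs with hk
    · subst hk
      rw [Nat.cast_zero, sub_zero, mem_fracPow_zero]
      exact one_mem _
    · exact zero_mem _
  | succ n ih =>
    rw [conjProd_succ]
    cases k with
    | zero =>
      rw [mul_coeff_zero, coeff_sub, coeff_X_zero, coeff_C_zero, zero_sub, mul_neg]
      have := neg_mem (fracPow_mul_mem h0 (ih 0) (hl n))
      convert this using 2
      push_cast
      ring
    | succ k =>
      rw [coeff_mul_X_sub_C]
      have h1 := fracPow_mul_mem h0 (ih (k + 1)) (hl n)
      have h2 := ih k
      have h3 : ((k + 1 : ℕ) : ℤ) - n + -1 = ((k + 1 : ℕ) : ℤ) - (n + 1 : ℕ) := by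
        push_cast; ring
      have h4 : (k : ℤ) - n = ((k + 1 : ℕ) : ℤ) - (n + 1 : ℕ) := by push_cast; ring
      rw [h3] at h1
      rw [h4] at h2
      exact sub_mem h2 h1

theorem map_conjProd_five (hσ : σ ^ 5 = 1) (l : L) :
    (conjProd σ l 5).map (σ : L →+* L) = conjProd σ l 5 := by
  have hs : σ.symm ^ 4 = σ := by
    have h1 : σ.symm ^ 5 = 1 := by
      rw [show σ.symm = σ⁻¹ from rfl, inv_pow, hσ, inv_one]
    have h2 : σ.symm ^ 4 * σ.symm = 1 := by rw [← pow_succ, h1]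
    rw [show σ.symm = σ⁻¹ from rfl] at *
    rw [eq_inv_of_mul_eq_one_left h2, inv_inv]
  have h1 : ∀ j, σ ((σ.symm ^ (j + 1)) l) = (σ.symm ^ j) l := by
    intro j
    rw [pow_succ']
    exact σ.apply_symm_apply _
  have h2 := h1 0
  have h3 := h1 1
  have h4 := h1 2
  have h5 := h1 3
  have h6 : σ l = (σ.symm ^ 4) l := by rw [hs]
  simp only [conjProd, Finset.prod_range_succ, Finset.prod_range_zero, one_mul,
    Polynomial.map_mul, Polynomial.map_sub, map_X, map_C, RingHom.coe_coe]
  rw [h2, h3, h4, h5, pow_zero, AlgEquiv.one_apply, h6]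
  ring

end RightEval

end CyclicFrame

/-! ### The totally ramified places: the maximal order -/

namespace CyclicFrame

set_option linter.unusedSectionVars false

variable {E L : Type*} [Field E] [NumberField E] [Field L] [NumberField L] [Algebra E L]
  {σ : L ≃ₐ[E] L} {D : Type*} [Ring D] [Algebra E D] (F : CyclicFrame σ D)

/-- The lattice `∑_{i < 5} yⁱ B` for `y = (b - U) δ⁴ / π`, with `B` the localization of `𝓞 L`. -/
def ramifiedOrder (v : HeightOneSpectrum (𝓞 E)) (π : 𝓞 E) (δ : L) (b : 𝓞 E) : AddSubgroup D :=
  F.powerSum (F.ramifiedGen π δ b) fun _ => (locInt v L).toAddSubgroup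

variable {F} {v : HeightOneSpectrum (𝓞 E)} {π : 𝓞 E} {δ : L} {ζ c b : 𝓞 E}

namespace RamifiedAt

open Polynomial

theorem ι_mem_order (_ : F.RamifiedAt v π δ ζ c b) {l : L} (hl : l ∈ locInt v L) :
    F.ι l ∈ F.ramifiedOrder v π δ b := by
  have := pow_mul_mem_powerSum (F := F) (F.ramifiedGen π δ b)
    (I := fun _ => (locInt v L).toAddSubgroup) 0 hl
  rw [Fin.val_zero, pow_zero, one_mul] at this
  exact this

theorem mul_ι_mem_order (_ : F.RamifiedAt v π δ ζ c b) {z : D}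
    (hz : z ∈ F.ramifiedOrder v π δ b) {l : L} (hl : l ∈ locInt v L) :
    z * F.ι l ∈ F.ramifiedOrder v π δ b := by
  obtain ⟨m, hm, rfl⟩ := hz
  refine ⟨fun i => m i * l, fun i => (locInt v L).mul_mem (hm i) hl, ?_⟩
  rw [Finset.sum_mul]
  exact Finset.sum_congr rfl fun i _ => by rw [map_mul, mul_assoc]

theorem gen_factor_mem (h : F.RamifiedAt v π δ ζ c b) :
    δ ^ 4 / algebraMap E L π ∈ fracPow (locInt v L) δ (-1) := by
  obtain ⟨ε, h1, h2, h3, h4, l, hl, h5⟩ := h.δ_pow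
  rw [mem_fracPow_iff_exists h.δ_ne_zero]
  refine ⟨ε, h1, ?_⟩
  have := h.δ_ne_zero
  have := h.algebraMap_ne_zero
  rw [zpow_neg_one]
  field_simp
  linear_combination h4

theorem gen_factor_inv_mem (h : F.RamifiedAt v π δ ζ c b) :
    (δ ^ 4 / algebraMap E L π)⁻¹ ∈ locInt v L := by
  obtain ⟨ε, h1, h2, h3, h4, l, hl, h5⟩ := h.δ_pow
  have h6 : (δ ^ 4 / algebraMap E L π)⁻¹ = δ * ε⁻¹ := by
    have := h.δ_ne_zero
    have := h.algebraMap_ne_zero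
    field_simp
    linear_combination -h4
  rw [h6]
  exact mul_mem h.δ_mem h3

theorem gen_factor_ne_zero (h : F.RamifiedAt v π δ ζ c b) : δ ^ 4 / algebraMap E L π ≠ 0 :=
  div_ne_zero (pow_ne_zero _ h.δ_ne_zero) h.algebraMap_ne_zero

/-- The Cayley–Hamilton relation for `y = (b - U) δ⁴ / π` has integral coefficients. -/
theorem gen_pow_five_mem (h : F.RamifiedAt v π δ ζ c b) :
    F.ramifiedGen π δ b ^ 5 ∈ F.ramifiedOrder v π δ b := by
  set t := δ ^ 4 / algebraMap E L π with ht
  set y := F.ramifiedGen π δ b with hy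
  set T := algebraMap E L (b : E) * t with hT
  have hsymm : ∀ j, (σ.symm ^ j) t ∈ fracPow (locInt v L) δ (-1) := by
    intro j
    rw [h.symm_eq, ← _root_.pow_mul]
    exact h.pow_map_mem _ h.gen_factor_mem
  have hb : algebraMap E L (b : E) ∈ fracPow (locInt v L) δ 0 :=
    mem_fracPow_zero.2 (algebraMap_coe_mem_locInt b)
  have hTmem : ∀ j, (σ.symm ^ j) T ∈ fracPow (locInt v L) δ (-1) := by
    intro j
    rw [hT, map_mul, AlgEquiv.commutes]
    have := fracPow_mul_mem h.δ_ne_zero hb (hsymm j)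
    rwa [zero_add] at this
  -- The coefficients lie in `E`, being fixed by `σ`, and those of positive index have poles of
  -- order at most `4` in `δ`; but orders of elements of `E` are multiples of `5`.
  have hcoeff : ∀ k : ℕ, 1 ≤ k → (conjProd σ T 5).coeff k ∈ locInt v L := by
    intro k hk
    have h1 := coeff_conjProd_mem h.δ_ne_zero hTmem 5 k
    have h2 : σ ((conjProd σ T 5).coeff k) = (conjProd σ T 5).coeff k := by
      conv_rhs => rw [← map_conjProd_five h.σ_pow T, coeff_map]
      rfl
    obtain ⟨e, he⟩ := h.fixed _ h2
    rw [he] at h1 ⊢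
    refine algebraMap_mem_locInt (h.mem_locInt_of_algebraMap_mem (h.fracPow_le' ?_ h1))
    push_cast
    omega
  have hmonic : (conjProd σ T 5).Monic := monic_prod_X_sub_C _ _
  have hdeg : (conjProd σ T 5).natDegree = 5 := by
    rw [conjProd, natDegree_finsetProd_X_sub_C_eq_card, Finset.card_range]
  set N := ∏ j ∈ Finset.range 5, (σ.symm ^ j) t with hN
  have hcoeff0 : (conjProd σ T 5).coeff 0 = -(algebraMap E L (b : E) ^ 5 * N) := by
    rw [coeff_zero_eq_eval_zero, conjProd, eval_prod, hN]
    simp only [eval_sub, eval_X, eval_C, zero_sub]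
    simp only [hT, map_mul, AlgEquiv.commutes]
    simp only [Finset.prod_range_succ, Finset.prod_range_zero]
    ring
  have h1 := rightEval_conjProd (F := F) (b : E) t 5
  have h2 : F.rightEval y (conjProd σ T 5) =
      ∑ i ∈ Finset.range 6, y ^ i * F.ι ((conjProd σ T 5).coeff i) :=
    sum_over_range' _ (by simp) 6 (by omega)
  have hlead : (conjProd σ T 5).coeff 5 = 1 := by
    have := hmonic.coeff_natDegree
    rwa [hdeg] at this
  change F.rightEval y (conjProd σ T 5) = _ at h1
  rw [h2, Finset.sum_range_succ, Finset.sum_range_succ', hlead, hcoeff0, pow_zero, one_mul,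
    map_one, mul_one, F.U_pow, ← F.ι.commutes, ← map_mul] at h1
  have h3 : y ^ 5 = -∑ k ∈ Finset.range 4, y ^ (k + 1) * F.ι ((conjProd σ T 5).coeff (k + 1)) +
      F.ι (-(algebraMap E L (F.α - (b : E) ^ 5) * N)) := by
    have h4 : F.ι (-(algebraMap E L (F.α - (b : E) ^ 5) * N)) =
        F.ι (algebraMap E L (b : E) ^ 5 * N) - F.ι (algebraMap E L F.α * N) := by
      rw [← map_sub, map_sub (algebraMap E L), map_pow]
      congr 1
      ring
    rw [h4, map_neg] at *
    have h5 : ((-1 : D) ^ 5 * F.ι (algebraMap E L F.α * N)) = -F.ι (algebraMap E L F.α * N) := by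
      noncomm_ring
    rw [h5] at h1
    rw [← sub_eq_zero] at h1 ⊢
    rw [← h1]
    abel
  have hNmem : N ∈ fracPow (locInt v L) δ (-5) := by
    have h5 : ∀ n : ℕ, ∏ j ∈ Finset.range n, (σ.symm ^ j) t ∈ fracPow (locInt v L) δ (-n) := by
      intro n
      induction n with
      | zero => simp [mem_fracPow_zero]
      | succ n ih =>
        rw [Finset.prod_range_succ]
        have := fracPow_mul_mem h.δ_ne_zero ih (hsymm n)
        convert this using 2
        push_cast
        ring
    exact h5 5
  -- `N` has a pole of order `5`, which `α ≡ b⁵` cancels.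
  have hconst : algebraMap E L (F.α - (b : E) ^ 5) * N ∈ locInt v L := by
    obtain ⟨f, hf, h5⟩ := h.α_congr
    have h6 := fracPow_mul_mem h.δ_ne_zero (fracPow_mul_mem h.δ_ne_zero
      h.algebraMap_mem_fracPow_five (mem_fracPow_zero.2 (algebraMap_mem_locInt (L := L) hf))) hNmem
    rw [← map_mul, ← h5] at h6
    exact mem_fracPow_zero.1 h6
  rw [h3]
  refine add_mem (neg_mem (sum_mem fun k hk => ?_)) (h.ι_mem_order (neg_mem hconst))
  have hk' : k + 1 < 5 := by have := Finset.mem_range.1 hk; omega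
  exact pow_mul_mem_powerSum (F := F) y (I := fun _ => (locInt v L).toAddSubgroup) ⟨k + 1, hk'⟩
    (hcoeff (k + 1) (by omega))

theorem gen_mul_mem_order (h : F.RamifiedAt v π δ ζ c b) {z : D}
    (hz : z ∈ F.ramifiedOrder v π δ b) :
    F.ramifiedGen π δ b * z ∈ F.ramifiedOrder v π δ b := by
  obtain ⟨m, hm, rfl⟩ := hz
  rw [Finset.mul_sum]
  refine sum_mem fun i _ => ?_
  rw [← mul_assoc, ← pow_succ']
  refine h.mul_ι_mem_order ?_ (hm i)
  by_cases hi : (i : ℕ) + 1 < 5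
  · have := pow_mul_mem_powerSum (F := F) (F.ramifiedGen π δ b)
      (I := fun _ => (locInt v L).toAddSubgroup) ⟨i + 1, hi⟩ (one_mem (locInt v L))
    rwa [map_one, mul_one] at this
  · rw [show (i : ℕ) + 1 = 5 by omega]
    exact h.gen_pow_five_mem

theorem gen_pow_mem_order (h : F.RamifiedAt v π δ ζ c b) (n : ℕ) :
    F.ramifiedGen π δ b ^ n ∈ F.ramifiedOrder v π δ b := by
  induction n with
  | zero => simpa using h.ι_mem_order (one_mem _)
  | succ n ih => rw [pow_succ']; exact h.gen_mul_mem_order ih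

/-- The commutation rule `l y = y σ⁻¹(l) + b t (l - σ⁻¹(l))` for `y = (b - U) t`. -/
theorem ι_mul_gen (l : L) : F.ι l * F.ramifiedGen π δ b =
    F.ramifiedGen π δ b * F.ι (σ.symm l) +
      F.ι (algebraMap E L b * ((δ ^ 4 / algebraMap E L π) * (l - σ.symm l))) := by
  set t := δ ^ 4 / algebraMap E L π with ht
  have h1 : F.ι l * F.U = F.U * F.ι (σ.symm l) := by simpa using F.mul_pow 1 l
  have h2 : F.ι (algebraMap E L b * (t * (l - σ.symm l))) =
      F.ι l * F.ι (algebraMap E L b) * F.ι t -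
        F.ι (algebraMap E L b) * (F.ι t * F.ι (σ.symm l)) := by
    rw [← map_mul, ← map_mul, ← map_mul, ← map_mul, ← map_sub]
    congr 1
    ring
  have h3 : F.ι t * F.ι (σ.symm l) = F.ι (σ.symm l) * F.ι t := by
    rw [← map_mul, ← map_mul, mul_comm]
  rw [ramifiedGen, ← ht, h2, ← mul_assoc, mul_sub, h1, mul_assoc _ (F.ι t), h3]
  noncomm_ring

theorem ι_mul_mem_order (h : F.RamifiedAt v π δ ζ c b) {z : D}
    (hz : z ∈ F.ramifiedOrder v π δ b) {l : L} (hl : l ∈ locInt v L) :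
    F.ι l * z ∈ F.ramifiedOrder v π δ b := by
  have h1 : ∀ n : ℕ, ∀ l ∈ locInt v L, ∀ m ∈ locInt v L,
      F.ι l * (F.ramifiedGen π δ b ^ n * F.ι m) ∈ F.ramifiedOrder v π δ b := by
    intro n
    induction n with
    | zero =>
      intro l hl m hm
      rw [pow_zero, one_mul, ← map_mul]
      exact h.ι_mem_order (mul_mem hl hm)
    | succ n ih =>
      intro l hl m hm
      rw [pow_succ', mul_assoc, ← mul_assoc, ι_mul_gen, add_mul, mul_assoc]
      have h2 : σ.symm l ∈ locInt v L :=
        mem_fracPow_zero.1 (h.symm_map_mem (mem_fracPow_zero.2 hl))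
      refine add_mem (h.gen_mul_mem_order (ih _ h2 m hm)) (ih _ ?_ m hm)
      have h3 := fracPow_mul_mem h.δ_ne_zero h.gen_factor_mem (h.sub_symm_mem hl)
      exact mul_mem (algebraMap_coe_mem_locInt b) (mem_fracPow_zero.1 h3)
  obtain ⟨m, hm, rfl⟩ := hz
  rw [Finset.mul_sum]
  exact sum_mem fun i _ => h1 i l hl _ (hm i)

theorem mul_mem_order (h : F.RamifiedAt v π δ ζ c b) {y z : D}
    (hy : y ∈ F.ramifiedOrder v π δ b) (hz : z ∈ F.ramifiedOrder v π δ b) :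
    y * z ∈ F.ramifiedOrder v π δ b := by
  obtain ⟨m, hm, rfl⟩ := hy
  rw [Finset.sum_mul]
  refine sum_mem fun i _ => ?_
  rw [mul_assoc]
  have h1 := h.ι_mul_mem_order hz (hm i)
  generalize (i : ℕ) = n
  induction n with
  | zero => simpa using h1
  | succ n ih => rw [pow_succ', mul_assoc]; exact h.gen_mul_mem_order ih

theorem U_pow_mem_order (h : F.RamifiedAt v π δ ζ c b) (n : ℕ) :
    F.U ^ n ∈ F.ramifiedOrder v π δ b := by
  have h1 : F.U = F.ι (algebraMap E L b) -
      F.ramifiedGen π δ b ^ 1 * F.ι (δ ^ 4 / algebraMap E L π)⁻¹ := by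
    rw [pow_one, ramifiedGen, mul_assoc, ← map_mul, mul_inv_cancel₀ h.gen_factor_ne_zero, map_one,
      mul_one, sub_sub_cancel]
  have h2 : F.U ∈ F.ramifiedOrder v π δ b := by
    rw [h1]
    exact sub_mem (h.ι_mem_order (algebraMap_coe_mem_locInt b))
      (h.mul_ι_mem_order (h.gen_pow_mem_order 1) h.gen_factor_inv_mem)
  induction n with
  | zero => simpa using h.ι_mem_order (one_mem _)
  | succ n ih => rw [pow_succ]; exact h.mul_mem_order ih h2

theorem depth_zero_le_order (h : F.RamifiedAt v π δ ζ c b) :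
    F.depth v δ 0 ≤ F.ramifiedOrder v π δ b := by
  intro z hz
  rw [← F.sum_coord z]
  exact sum_mem fun i _ => h.mul_mem_order (h.ι_mem_order (mem_fracPow_zero.1 (hz i)))
    (h.U_pow_mem_order _)

theorem zeta_sum (h : F.RamifiedAt v π δ ζ c b) :
    Ideal.Quotient.mk v.asIdeal ζ ^ 4 + Ideal.Quotient.mk v.asIdeal ζ ^ 3 +
      Ideal.Quotient.mk v.asIdeal ζ ^ 2 + Ideal.Quotient.mk v.asIdeal ζ + 1 = 0 := by
  have hp := v.isPrime
  have h1 := Ideal.Quotient.eq_zero_iff_mem.2 h.ζ_pow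
  have h2 : Ideal.Quotient.mk v.asIdeal ζ - 1 ≠ 0 := by
    rw [← map_one (Ideal.Quotient.mk v.asIdeal), ← map_sub, Ne, Ideal.Quotient.eq_zero_iff_mem]
    exact h.ζ_ne
  rw [map_sub, map_pow, map_one] at h1
  refine (mul_eq_zero.1 ?_).resolve_left h2
  linear_combination h1

theorem isUnit_mk_c (h : F.RamifiedAt v π δ ζ c b) : IsUnit (Ideal.Quotient.mk v.asIdeal c) := by
  have h1 := (Ideal.Quotient.maximal_ideal_iff_isField_quotient _).1 v.isMaximal
  obtain ⟨d, hd⟩ := h1.mul_inv_cancel (a := Ideal.Quotient.mk v.asIdeal c) (by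
    rw [Ne, Ideal.Quotient.eq_zero_iff_mem]
    exact h.c_notMem)
  exact .of_mul_eq_one d hd

/-- A ring that contains the lattice and whose elements have poles of order at most `4` is equal to
it: the leading term of an element with a pole of order `m` is, by `factorProd_dvd`, a multiple of
the one of `yᵐ`, so that the pole can be removed. -/
theorem mem_order_of_depth (h : F.RamifiedAt v π δ ζ c b) {Γ : AddSubgroup D}
    (hmul : ∀ y ∈ Γ, ∀ z ∈ Γ, y * z ∈ Γ) (hle : F.ramifiedOrder v π δ b ≤ Γ)
    (hΓ : Γ ≤ F.depth v δ (-4)) {z : D} (hz : z ∈ Γ) : z ∈ F.ramifiedOrder v π δ b := by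
  have key : ∀ m : ℕ, m ≤ 4 → ∀ z ∈ Γ, z ∈ F.depth v δ (-(m : ℤ)) →
      z ∈ F.ramifiedOrder v π δ b := by
    intro m
    induction m with
    | zero =>
      intro _ z _ hz
      exact h.depth_zero_le_order (by simpa using hz)
    | succ m ih =>
      intro hm z hz hzd
      -- The product `z y⁵⁻ᵐ⁻¹` lies in `Γ`, and therefore has no pole of order `5`.
      obtain ⟨g, hg⟩ := h.exists_lead hzd
      obtain ⟨n, hn⟩ : ∃ n, m + 1 + n = 5 := ⟨5 - (m + 1), by omega⟩
      have h1 := h.lead_mul hg (h.lead_ramifiedGen_pow n)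
      have h2 : z * F.ramifiedGen π δ b ^ n ∈ F.depth v δ (-((m + 1 + n : ℕ) : ℤ) + 1) := by
        rw [hn]
        exact hΓ (hmul z hz _ (hle (h.gen_pow_mem_order n)))
      have h3 := h.dvd_of_lead h1 h2
      have hprime := v.isPrime
      obtain ⟨p, hp⟩ := exists_map_sub_mul_factorProd_eq_zero Ideal.Quotient.mk_surjective
        h.zeta_sum hn h.isUnit_mk_c h3
      -- Subtracting `p(U) yᵐ⁺¹` lowers the order of the pole of `z`.
      have h4 := hg.sub (h.lead_aeval_mul (h.lead_ramifiedGen_pow (m + 1)) p)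
      have h5 : aeval F.U p * F.ramifiedGen π δ b ^ (m + 1) ∈ F.ramifiedOrder v π δ b :=
        h.mul_mem_order (h.depth_zero_le_order (h.aeval_mem_depth p)) (h.gen_pow_mem_order _)
      have h6 := h.mem_depth_of_lead h4 hp
      have h8 := ih (by omega) _ (sub_mem hz (hle h5)) (by
        convert h6 using 2
        push_cast
        ring)
      have := add_mem h8 h5
      rwa [sub_add_cancel] at this
  exact key 4 le_rfl z hz (hΓ hz)

theorem isLocallyMaximal (h : F.RamifiedAt v π δ ζ c b) {Λ : Submodule (𝓞 E) D}
    (hΛ : ∀ z, z ∈ locAt v Λ ↔ z ∈ F.ramifiedOrder v π δ b)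
    (htr : ∀ Γ : Submodule (𝓞 E) D, 1 ∈ Γ → (∀ y ∈ Γ, ∀ z ∈ Γ, y * z ∈ Γ) →
      (∃ r : 𝓞 E, r ≠ 0 ∧ ∀ z ∈ Γ, r • z ∈ locAt v Λ) →
      ∀ z ∈ Γ, Algebra.trace E L (F.coord z 0) ∈ locInt v E) : IsLocallyMaximal v Λ := by
  have hone : (1 : D) ∈ locAt v Λ := by
    rw [hΛ]
    simpa using h.ι_mem_order (one_mem _)
  refine ⟨hone, fun y hy z hz => ?_, ?_⟩
  · rw [hΛ]
    exact h.mul_mem_order ((hΛ y).1 (le_locAt v Λ hy)) ((hΛ z).1 (le_locAt v Λ hz))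
  intro Γ hΓ hsat hle hb z hz
  have hle' : locAt v Λ ≤ Γ := (locAt_le_locAt_iff.2 (hle.trans (le_locAt v Γ))).trans hsat
  rw [hΛ]
  have hle2 : ∀ w ∈ F.ramifiedOrder v π δ b, w ∈ Γ := fun w hw => hle' ((hΛ w).2 hw)
  refine h.mem_order_of_depth (Γ := Γ.toAddSubgroup) hΓ hle2 (fun w hw i => ?_) hz
  exact h.dual _ fun m hm => F.trace_mul_coord_mem (Γ := Γ) hΓ
    (fun l hl => hle2 _ (h.ι_mem_order hl)) (fun n => hle2 _ (h.U_pow_mem_order n))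
    (htr Γ (hle' hone) hΓ hb) h.α_ne h.α_inv_mem hw i hm

end RamifiedAt

end CyclicFrame

/-! ### The compositum with a cyclic quintic field -/

section Compositum

set_option linter.unusedSectionVars false

variable {E M L : Type*} [Field E] [NumberField E] [Field M] [NumberField M]
  [Field L] [NumberField L] [Algebra E L] [Algebra M L] {σ : L ≃ₐ[E] L}

theorem exists_restrict [IsGalois ℚ M] (hσ : orderOf σ = 5)
    (hL : (algebraMap E L).fieldRange ⊔ (algebraMap M L).fieldRange = ⊤) :
    ∃ τ : M ≃ₐ[ℚ] M, orderOf τ = 5 ∧ ∀ m, algebraMap M L (τ m) = σ (algebraMap M L m) := by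
  set τ : M ≃ₐ[ℚ] M := (σ.restrictScalars ℚ).restrictNormal M with hτ
  have h1 : ∀ m, algebraMap M L (τ m) = σ (algebraMap M L m) := fun m =>
    AlgEquiv.restrictNormal_commutes (σ.restrictScalars ℚ) M m
  have h2 : ∀ (n : ℕ) m, algebraMap M L ((τ ^ n) m) = (σ ^ n) (algebraMap M L m) := by
    intro n
    induction n with
    | zero => intro m; rfl
    | succ n ih =>
      intro m
      rw [pow_succ, AlgEquiv.mul_apply, ih, h1, pow_succ, AlgEquiv.mul_apply]
  have hinj : Function.Injective (algebraMap M L) := (algebraMap M L).injective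
  have : Fact (Nat.Prime 5) := ⟨by norm_num⟩
  refine ⟨τ, orderOf_eq_prime ?_ ?_, h1⟩
  · ext m
    apply hinj
    rw [h2, ← hσ, pow_orderOf_eq_one]
    rfl
  · intro h3
    -- If `σ` were trivial on `M`, it would be trivial on the compositum.
    have h4 : (algebraMap E L).fieldRange ⊔ (algebraMap M L).fieldRange ≤
        RingHom.eqLocusField (σ : L →+* L) (RingHom.id L) := by
      rw [sup_le_iff]
      constructor
      · rintro _ ⟨e, rfl⟩
        exact σ.commutes e
      · rintro _ ⟨m, rfl⟩
        have := h1 m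
        rw [h3] at this
        exact this.symm
    have h5 : σ = 1 := by
      ext l
      have : l ∈ RingHom.eqLocusField (σ : L →+* L) (RingHom.id L) := h4 (by rw [hL]; trivial)
      exact this
    rw [h5, orderOf_one] at hσ
    norm_num at hσ

theorem algebraMap_pow_apply {τ : M ≃ₐ[ℚ] M}
    (hτ : ∀ m, algebraMap M L (τ m) = σ (algebraMap M L m)) (n : ℕ) (m : M) :
    algebraMap M L ((τ ^ n) m) = (σ ^ n) (algebraMap M L m) := by
  induction n generalizing m with
  | zero => rfl
  | succ n ih => rw [pow_succ, AlgEquiv.mul_apply, ih, hτ, pow_succ, AlgEquiv.mul_apply]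

theorem span_integralBasis_eq_top
    (hL : (algebraMap E L).fieldRange ⊔ (algebraMap M L).fieldRange = ⊤) :
    Submodule.span E (Set.range fun i => algebraMap M L (integralBasis M i)) = ⊤ := by
  set N := Submodule.span E (Set.range fun i => algebraMap M L (integralBasis M i)) with hN
  have h1 : ∀ m : M, algebraMap M L m ∈ N := by
    intro m
    rw [← (integralBasis M).sum_repr m, map_sum]
    refine sum_mem fun i _ => ?_
    rw [Algebra.smul_def, map_mul, ← IsScalarTower.algebraMap_apply ℚ M L,
      IsScalarTower.algebraMap_apply ℚ E L, ← Algebra.smul_def]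
    exact Submodule.smul_mem _ _ (Submodule.subset_span ⟨i, rfl⟩)
  have h2 : Submodule.span E (Set.range (algebraMap M L)) ≤ N :=
    Submodule.span_le.2 (by rintro _ ⟨m, rfl⟩; exact h1 m)
  -- The subring generated by `E` and `M` is a field, because `L` is algebraic over `E`, and it is
  -- the `E`-span of `M`.
  have h3 : Subalgebra.toSubmodule (Algebra.adjoin E (Set.range (algebraMap M L))) =
      Submodule.span E (Set.range (algebraMap M L)) := by
    rw [Algebra.adjoin_eq_span]
    congr 1
    exact congrArg SetLike.coe (Submonoid.closure_eq (MonoidHom.mrange (algebraMap M L)))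
  have h4 : IntermediateField.adjoin E (Set.range (algebraMap M L)) = ⊤ := by
    rw [eq_top_iff]
    intro l _
    have h5 : (algebraMap E L).fieldRange ⊔ (algebraMap M L).fieldRange ≤
        (IntermediateField.adjoin E (Set.range (algebraMap M L))).toSubfield := by
      rw [sup_le_iff]
      constructor
      · rintro _ ⟨e, rfl⟩
        exact IntermediateField.algebraMap_mem _ e
      · rintro _ ⟨m, rfl⟩
        exact IntermediateField.subset_adjoin _ _ ⟨m, rfl⟩
    exact h5 (by rw [hL]; trivial)
  rw [eq_top_iff]
  refine le_trans ?_ h2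
  rw [← h3, ← IntermediateField.adjoin_toSubalgebra, h4]
  exact le_rfl

theorem finrank_compositum (hσ : orderOf σ = 5)
    (hL : (algebraMap E L).fieldRange ⊔ (algebraMap M L).fieldRange = ⊤)
    (hM : Module.finrank ℚ M = 5) : Module.finrank E L = 5 := by
  have hcard : Fintype.card (Module.Free.ChooseBasisIndex ℤ (𝓞 M)) = 5 := by
    rw [← hM, ← RingOfIntegers.rank, Module.finrank_eq_card_chooseBasisIndex]
  apply le_antisymm
  · rw [← hcard]
    exact finrank_le_of_span_eq_top (span_integralBasis_eq_top hL)
  · refine le_trans ?_ (AlgEquiv.card_le (F := E) (K := L))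
    rw [← hσ]
    exact orderOf_le_card_univ

/-- The integral basis of `M` as a basis of `L = E M` over `E`. -/
noncomputable def compositumBasis (hσ : orderOf σ = 5)
    (hL : (algebraMap E L).fieldRange ⊔ (algebraMap M L).fieldRange = ⊤)
    (hM : Module.finrank ℚ M = 5) :
    Module.Basis (Module.Free.ChooseBasisIndex ℤ (𝓞 M)) E L :=
  basisOfTopLeSpanOfCardEqFinrank (fun i => algebraMap M L (integralBasis M i))
    (span_integralBasis_eq_top hL).ge (by
      rw [finrank_compositum hσ hL hM, ← hM, ← RingOfIntegers.rank,
        Module.finrank_eq_card_chooseBasisIndex])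

theorem compositumBasis_apply (hσ : orderOf σ = 5)
    (hL : (algebraMap E L).fieldRange ⊔ (algebraMap M L).fieldRange = ⊤)
    (hM : Module.finrank ℚ M = 5) (i) :
    compositumBasis hσ hL hM i = algebraMap M L (RingOfIntegers.basis M i) := by
  rw [compositumBasis, coe_basisOfTopLeSpanOfCardEqFinrank, integralBasis_apply]

theorem trace_algebraMap_compositum [IsGalois ℚ M] (hσ : orderOf σ = 5)
    (hL : (algebraMap E L).fieldRange ⊔ (algebraMap M L).fieldRange = ⊤)
    (hM : Module.finrank ℚ M = 5) (m : M) :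
    Algebra.trace E L (algebraMap M L m) = algebraMap ℚ E (Algebra.trace ℚ M m) := by
  obtain ⟨τ, hτ5, hτ⟩ := exists_restrict (M := M) hσ hL
  apply (algebraMap E L).injective
  rw [algebraMap_trace_eq_sum_pow hσ (finrank_compositum hσ hL hM),
    ← IsScalarTower.algebraMap_apply ℚ E L, IsScalarTower.algebraMap_apply ℚ M L,
    algebraMap_trace_eq_sum_pow hτ5 hM, map_sum]
  exact Finset.sum_congr rfl fun j _ => (algebraMap_pow_apply hτ _ _).symm

theorem prod_pow_algebraMap [IsGalois ℚ M] (hσ : orderOf σ = 5)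
    (hL : (algebraMap E L).fieldRange ⊔ (algebraMap M L).fieldRange = ⊤)
    (hM : Module.finrank ℚ M = 5) (m : M) :
    ∏ j ∈ Finset.range 5, (σ ^ j) (algebraMap M L m) = algebraMap ℚ L (Algebra.norm ℚ m) := by
  obtain ⟨τ, hτ5, hτ⟩ := exists_restrict (M := M) hσ hL
  rw [IsScalarTower.algebraMap_apply ℚ M L, algebraMap_norm_eq_prod_pow hτ5 hM, map_prod,
    Finset.prod_range]
  exact Finset.prod_congr rfl fun j _ => (algebraMap_pow_apply hτ _ _).symm

end Compositum

/-! ### Duality and the inert places of the compositum -/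

section CompositumLocal

set_option linter.unusedSectionVars false

variable {E M L : Type*} [Field E] [NumberField E] [Field M] [NumberField M]
  [Field L] [NumberField L] [Algebra E L] [Algebra M L] {σ : L ≃ₐ[E] L}
  {v : HeightOneSpectrum (𝓞 E)}

theorem algebraMap_integer_mem_locInt (m : 𝓞 M) : algebraMap M L m ∈ locInt v L :=
  mem_locInt_of_isIntegral (m.isIntegral_coe.map (algebraMap M L).toIntAlgHom)

/-- Elements of the trace dual of the integers of `L` have coordinates in the integral basis of `M`
with denominators dividing the discriminant of `M`. -/
theorem discr_mul_repr_mem [IsGalois ℚ M] (hσ : orderOf σ = 5)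
    (hL : (algebraMap E L).fieldRange ⊔ (algebraMap M L).fieldRange = ⊤)
    (hM : Module.finrank ℚ M = 5) {l : L}
    (h : ∀ m ∈ locInt v L, Algebra.trace E L (l * m) ∈ locInt v E) (j) :
    (discr M : E) * (compositumBasis hσ hL hM).repr l j ∈ locInt v E := by
  classical
  set e := compositumBasis hσ hL hM with he
  have heB : ∀ i, e i ∈ locInt v L := fun i => by
    rw [he, compositumBasis_apply]
    exact algebraMap_integer_mem_locInt _
  let T' : Matrix _ _ (locInt v E) := fun i j =>
    ⟨Algebra.trace E L (e i * e j), trace_mem_locInt (mul_mem (heB i) (heB j))⟩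
  let w' : _ → locInt v E := fun i => ⟨Algebra.trace E L (l * e i), h _ (heB i)⟩
  set φ := (locInt v E).subtype with hφ
  have hT : φ.mapMatrix T' = Algebra.traceMatrix E e := by
    ext i j
    rfl
  have hdet : (Algebra.traceMatrix E e).det = (discr M : E) := by
    have h1 : Algebra.traceMatrix E e =
        (algebraMap ℚ E).mapMatrix (Algebra.traceMatrix ℚ (integralBasis M)) := by
      ext i j
      rw [Algebra.traceMatrix_apply, Algebra.traceForm_apply, he, compositumBasis_apply,
        compositumBasis_apply, ← map_mul, trace_algebraMap_compositum hσ hL hM]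
      simp [Algebra.traceMatrix_apply, Algebra.traceForm_apply, integralBasis_apply]
    rw [h1, ← RingHom.map_det, ← Algebra.discr_def, ← coe_discr]
    simp
  -- The coordinates solve a linear system with integral right-hand side and determinant `discr M`.
  have hw : Matrix.mulVec (Algebra.traceMatrix E e) (e.repr l) = fun i => (w' i : E) := by
    ext i
    change ∑ j, Algebra.trace E L (e i * e j) * e.repr l j = Algebra.trace E L (l * e i)
    conv_rhs => rw [← e.sum_repr l, Finset.sum_mul, map_sum]
    refine Finset.sum_congr rfl fun j _ => ?_
    rw [smul_mul_assoc, map_smul, smul_eq_mul, mul_comm (e j), mul_comm]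
  have h2 : (discr M : E) * e.repr l j =
      φ ((T'.adjugate.mulVec w') j) := by
    have h3 : Matrix.mulVec (Algebra.traceMatrix E e).adjugate
        (Matrix.mulVec (Algebra.traceMatrix E e) (e.repr l)) = (discr M : E) • ⇑(e.repr l) := by
      rw [Matrix.mulVec_mulVec, Matrix.adjugate_mul, hdet, Matrix.smul_mulVec, Matrix.one_mulVec]
    have h4 := congrFun h3 j
    rw [Pi.smul_apply, smul_eq_mul] at h4
    rw [← h4, hw, ← hT, ← RingHom.map_adjugate, RingHom.map_mulVec]
    rfl
  rw [h2]
  exact SetLike.coe_mem _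

theorem repr_mem_of_discr_notMem [IsGalois ℚ M] (hσ : orderOf σ = 5)
    (hL : (algebraMap E L).fieldRange ⊔ (algebraMap M L).fieldRange = ⊤)
    (hM : Module.finrank ℚ M = 5) (hv : (discr M : 𝓞 E) ∉ v.asIdeal) {l : L}
    (h : ∀ m ∈ locInt v L, Algebra.trace E L (l * m) ∈ locInt v E) (j) :
    (compositumBasis hσ hL hM).repr l j ∈ locInt v E := by
  have h1 := mul_mem (inv_coe_mem_locInt hv) (discr_mul_repr_mem hσ hL hM h j)
  have h2 : ((discr M : 𝓞 E) : E) = (discr M : E) := by simp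
  have h3 : (discr M : E) ≠ 0 := by
    rw [← h2]; exact ne_zero_of_notMem hv
  rwa [h2, ← mul_assoc, inv_mul_cancel₀ h3, one_mul] at h1

theorem mem_locInt_of_trace_mem [IsGalois ℚ M] (hσ : orderOf σ = 5)
    (hL : (algebraMap E L).fieldRange ⊔ (algebraMap M L).fieldRange = ⊤)
    (hM : Module.finrank ℚ M = 5) (hv : (discr M : 𝓞 E) ∉ v.asIdeal) {l : L}
    (h : ∀ m ∈ locInt v L, Algebra.trace E L (l * m) ∈ locInt v E) : l ∈ locInt v L := by
  rw [← (compositumBasis hσ hL hM).sum_repr l]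
  refine sum_mem fun j _ => ?_
  rw [Algebra.smul_def, compositumBasis_apply]
  exact mul_mem (algebraMap_mem_locInt (repr_mem_of_discr_notMem hσ hL hM hv h j))
    (algebraMap_integer_mem_locInt _)

theorem repr_algebraMap_integer (hσ : orderOf σ = 5)
    (hL : (algebraMap E L).fieldRange ⊔ (algebraMap M L).fieldRange = ⊤)
    (hM : Module.finrank ℚ M = 5) (m : 𝓞 M) (j) :
    (compositumBasis hσ hL hM).repr (algebraMap M L m) j =
      ((RingOfIntegers.basis M).repr m j : E) := by
  have h1 : algebraMap M L m =
      ∑ i, ((RingOfIntegers.basis M).repr m i : E) • compositumBasis hσ hL hM i := by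
    conv_lhs => rw [← (RingOfIntegers.basis M).sum_repr m]
    rw [RingOfIntegers.val_sum, map_sum]
    refine Finset.sum_congr rfl fun i _ => ?_
    rw [compositumBasis_apply, zsmul_eq_mul, Algebra.smul_def, RingOfIntegers.val_mul, map_mul]
    simp
  rw [h1, Module.Basis.repr_sum_self]

/-- Modulo a prime element with residue field `𝔽_p`, the integers of `L` are congruent to integers
of `M`. -/
theorem exists_sub_integer_mem [IsGalois ℚ M] (hσ : orderOf σ = 5)
    (hL : (algebraMap E L).fieldRange ⊔ (algebraMap M L).fieldRange = ⊤)
    (hM : Module.finrank ℚ M = 5) (hv : (discr M : 𝓞 E) ∉ v.asIdeal) {π : 𝓞 E}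
    (hπ : v.asIdeal = Ideal.span {π}) (hres : ∀ n : 𝓞 E, ∃ k : ℤ, n - k ∈ v.asIdeal) {l : L}
    (hl : l ∈ locInt v L) :
    ∃ m : 𝓞 M, ∃ w ∈ locInt v L, l = algebraMap M L m + algebraMap E L π * w := by
  set e := compositumBasis hσ hL hM with he
  have h1 : ∀ j, ∃ k : ℤ, ∃ f ∈ locInt v E, e.repr l j = k + π * f := by
    intro j
    obtain ⟨n, f, hf, h2⟩ := exists_coe_sub_mem hπ (repr_mem_of_discr_notMem hσ hL hM hv
      (fun m hm => trace_mem_locInt (mul_mem hl hm)) j)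
    obtain ⟨k, hk⟩ := hres n
    rw [hπ, Ideal.mem_span_singleton] at hk
    obtain ⟨q, hq⟩ := hk
    refine ⟨k, q + f, add_mem (coe_mem_locInt q) hf, ?_⟩
    have h3 : (n : E) = k + π * q := by
      rw [sub_eq_iff_eq_add'] at hq
      rw [hq, RingOfIntegers.val_add, RingOfIntegers.val_mul, RingOfIntegers.val_intCast]
    rw [h2, h3]
    ring
  choose k f hf hk using h1
  refine ⟨∑ j, k j • RingOfIntegers.basis M j, ∑ j, algebraMap E L (f j) * e j,
    sum_mem fun j _ => mul_mem (algebraMap_mem_locInt (hf j)) ?_, ?_⟩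
  · rw [he, compositumBasis_apply]
    exact algebraMap_integer_mem_locInt _
  · conv_lhs => rw [← e.sum_repr l]
    rw [RingOfIntegers.val_sum, map_sum, Finset.mul_sum, ← Finset.sum_add_distrib]
    refine Finset.sum_congr rfl fun j _ => ?_
    rw [hk, Algebra.smul_def, he, compositumBasis_apply, zsmul_eq_mul, RingOfIntegers.val_mul,
      map_mul, map_add, map_mul]
    simp only [map_intCast]
    ring

theorem two_dvd_of_eq_mul [IsGalois ℚ M] (hσ : orderOf σ = 5)
    (hL : (algebraMap E L).fieldRange ⊔ (algebraMap M L).fieldRange = ⊤)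
    (hM : Module.finrank ℚ M = 5) (hv : (discr M : 𝓞 E) ∉ v.asIdeal) {π : 𝓞 E}
    (hπ : v.asIdeal = Ideal.span {π}) (h2 : (2 : 𝓞 E) ∈ v.asIdeal) {m : 𝓞 M} {w : L}
    (hw : w ∈ locInt v L) (h : algebraMap M L m = algebraMap E L π * w) : 2 ∣ m := by
  have h1 : ∀ j, (2 : ℤ) ∣ (RingOfIntegers.basis M).repr m j := by
    intro j
    have h3 := repr_algebraMap_integer hσ hL hM m j
    rw [h, ← Algebra.smul_def, map_smul, Finsupp.smul_apply, smul_eq_mul] at h3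
    have h4 : (((RingOfIntegers.basis M).repr m j : ℤ) : 𝓞 E) ∈ v.asIdeal :=
      mem_asIdeal_of_div_mem_locInt hπ (repr_mem_of_discr_notMem hσ hL hM hv
        (fun m hm => trace_mem_locInt (mul_mem hw hm)) j) (by rw [h3]; simp)
    -- An odd integer is not in `v`, because `2` is.
    by_contra hodd
    obtain ⟨q, hq⟩ := Int.not_even_iff_odd.1 fun h5 => hodd h5.two_dvd
    rw [hq] at h4
    refine HeightOneSpectrum.one_notMem v ?_
    push_cast at h4
    exact (Ideal.add_mem_iff_right _ (Ideal.mul_mem_right _ _ h2)).1 h4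
  choose q hq using h1
  refine ⟨∑ j, q j • RingOfIntegers.basis M j, ?_⟩
  conv_lhs => rw [← (RingOfIntegers.basis M).sum_repr m]
  rw [Finset.mul_sum]
  refine Finset.sum_congr rfl fun j _ => ?_
  rw [hq, zsmul_eq_mul, zsmul_eq_mul]
  push_cast
  ring

/-- A prime element of `E` above `2` stays prime in `L` when `2` is inert in `M`. -/
theorem prime_of_two_inert [IsGalois ℚ M] (hσ : orderOf σ = 5)
    (hL : (algebraMap E L).fieldRange ⊔ (algebraMap M L).fieldRange = ⊤)
    (hM : Module.finrank ℚ M = 5) (hM2 : (Ideal.span {(2 : 𝓞 M)}).IsPrime)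
    (hv : (discr M : 𝓞 E) ∉ v.asIdeal) {π : 𝓞 E}
    (hπ : v.asIdeal = Ideal.span {π}) (hres : ∀ n : 𝓞 E, ∃ k : ℤ, n - k ∈ v.asIdeal)
    (h2 : (2 : 𝓞 E) ∈ v.asIdeal) {l m : L} (hl : l ∈ locInt v L) (hm : m ∈ locInt v L)
    (h : l * m ∈ fracPow (locInt v L) (algebraMap E L π) 1) :
    l ∈ fracPow (locInt v L) (algebraMap E L π) 1 ∨
      m ∈ fracPow (locInt v L) (algebraMap E L π) 1 := by
  have hπ0 : algebraMap E L π ≠ 0 := by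
    rw [map_ne_zero, Ne, RingOfIntegers.coe_eq_zero_iff]
    rintro rfl
    exact v.ne_bot (by rw [hπ]; simp)
  simp only [mem_fracPow_iff_exists hπ0, zpow_one] at h ⊢
  obtain ⟨l', w, hw, rfl⟩ := exists_sub_integer_mem hσ hL hM hv hπ hres hl
  obtain ⟨m', z, hz, rfl⟩ := exists_sub_integer_mem hσ hL hM hv hπ hres hm
  obtain ⟨q, hq, h⟩ := h
  have hl' := algebraMap_integer_mem_locInt (L := L) (v := v) l'
  -- Modulo `π`, all elements are congruent to integers of `M`, and `2` is prime in `𝓞 M`.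
  have h3 : 2 ∣ l' * m' := by
    refine two_dvd_of_eq_mul hσ hL hM hv hπ h2 (sub_mem (sub_mem hq (mul_mem hl' hz))
      (mul_mem hw hm)) ?_
    rw [RingOfIntegers.val_mul, map_mul]
    linear_combination h
  have h4 : ∀ n : 𝓞 M, 2 ∣ n → ∃ r ∈ locInt v L, algebraMap M L n = algebraMap E L π * r := by
    rintro _ ⟨n, rfl⟩
    rw [hπ, Ideal.mem_span_singleton] at h2
    obtain ⟨r, hr⟩ := h2
    refine ⟨algebraMap E L r * algebraMap M L n, mul_mem (algebraMap_coe_mem_locInt r)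
      (algebraMap_integer_mem_locInt n), ?_⟩
    have h5 := congrArg (fun t : 𝓞 E => algebraMap E L t) hr
    simp only [map_mul, map_ofNat] at h5
    rw [RingOfIntegers.val_mul, map_mul, ← mul_assoc, ← h5, RingOfIntegers.val_two, map_ofNat]
  rcases hM2.mem_or_mem (Ideal.mem_span_singleton.2 h3) with h5 | h5
  · obtain ⟨r, hr, h6⟩ := h4 _ (Ideal.mem_span_singleton.1 h5)
    exact Or.inl ⟨r + w, add_mem hr hw, by rw [h6]; ring⟩
  · obtain ⟨r, hr, h6⟩ := h4 _ (Ideal.mem_span_singleton.1 h5)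
    exact Or.inr ⟨r + z, add_mem hr hz, by rw [h6]; ring⟩

end CompositumLocal

/-! ### The quadratic field `ℚ(√-7)` -/

theorem exists_int_sub_mem_of_absNorm {E : Type*} [Field E] [NumberField E] {I : Ideal (𝓞 E)}
    {p : ℕ} (hp : p.Prime) (hI : Ideal.absNorm I = p) (n : 𝓞 E) : ∃ k : ℤ, n - k ∈ I := by
  have hcard : Nat.card (𝓞 E ⧸ I) = p := by
    rw [← hI, Ideal.absNorm_apply]; rfl
  have hfin : Finite (𝓞 E ⧸ I) := Nat.finite_of_card_ne_zero (by rw [hcard]; exact hp.ne_zero)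
  have : Fintype (𝓞 E ⧸ I) := Fintype.ofFinite _
  rw [Nat.card_eq_fintype_card] at hcard
  let f := ZMod.ringEquivOfPrime (𝓞 E ⧸ I) hp hcard
  obtain ⟨z, hz⟩ := f.surjective (Ideal.Quotient.mk I n)
  obtain ⟨k, rfl⟩ := ZMod.intCast_surjective z
  refine ⟨k, ?_⟩
  rw [← Ideal.Quotient.eq_zero_iff_mem, map_sub, ← hz, map_intCast, map_intCast, sub_self]

theorem notMem_of_coprime {R : Type*} [CommRing R] {I : Ideal R} (hI : I.IsPrime) {p q : ℕ}
    (h : Nat.Coprime p q) (hp : (p : R) ∈ I) : (q : R) ∉ I := by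
  intro hq
  have h1 := (Nat.isCoprime_iff_coprime.2 h)
  obtain ⟨a, b, hab⟩ := h1
  refine (Ideal.ne_top_iff_one I).1 hI.ne_top ?_
  have h2 : (a : R) * p + b * q = 1 := by exact_mod_cast congrArg (fun t : ℤ => (t : R)) hab
  rw [← h2]
  exact add_mem (Ideal.mul_mem_left _ _ hp) (Ideal.mul_mem_left _ _ hq)

namespace CyclicData

set_option linter.unusedSectionVars false

variable {E M L : Type*} [Field E] [NumberField E] [Field M] [NumberField M]
  [Field L] [NumberField L] [Algebra E L] [Algebra M L] (x : CyclicData E M L)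

theorem coe_conjInt (n : 𝓞 E) : ((x.conjInt n : 𝓞 E) : E) = x.conj n := rfl

theorem conj_sqrtNegSeven (hE : Module.finrank ℚ E = 2) (hsqrt : x.sqrtNegSeven ^ 2 = -7)
    (hconj : x.conj ≠ 1) : x.conj x.sqrtNegSeven = -x.sqrtNegSeven := by
  have h1 : x.conj x.sqrtNegSeven ^ 2 = x.sqrtNegSeven ^ 2 := by
    rw [← map_pow, hsqrt, map_neg, map_ofNat]
  refine (sq_eq_sq_iff_eq_or_eq_neg.1 h1).resolve_left fun h2 => hconj ?_
  -- A rational number has no negative square, so `√-7` generates `E`.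
  have h3 : IntermediateField.adjoin ℚ {x.sqrtNegSeven} = ⊤ := by
    have h4 : Module.finrank ℚ (IntermediateField.adjoin ℚ {x.sqrtNegSeven}) ∣ 2 := by
      rw [← hE]
      exact ⟨_, (Module.finrank_mul_finrank ℚ (IntermediateField.adjoin ℚ {x.sqrtNegSeven}) E).symm⟩
    rcases (Nat.dvd_prime Nat.prime_two).1 h4 with h5 | h5
    · exfalso
      rw [IntermediateField.finrank_adjoin_simple_eq_one_iff, IntermediateField.mem_bot] at h5
      obtain ⟨q, hq⟩ := h5
      rw [← hq, ← map_pow] at hsqrt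
      have h6 : algebraMap ℚ E (q ^ 2) = algebraMap ℚ E (-7) := by rw [hsqrt]; simp
      have h7 := (algebraMap ℚ E).injective h6
      nlinarith [sq_nonneg q]
    · rw [← IntermediateField.finrank_eq_one_iff_eq_top]
      have := Module.finrank_mul_finrank ℚ (IntermediateField.adjoin ℚ {x.sqrtNegSeven}) E
      rw [h5, hE] at this
      omega
  ext z
  have hz : z ∈ IntermediateField.adjoin ℚ {x.sqrtNegSeven} := by rw [h3]; trivial
  induction hz using IntermediateField.adjoin_induction with
  | mem z hz => rw [Set.mem_singleton_iff.1 hz]; exact h2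
  | algebraMap q => exact x.conj.commutes q
  | add y z _ _ hy hz => rw [map_add, hy, hz]; rfl
  | inv z _ hz => rw [map_inv₀, hz]; rfl
  | mul y z _ _ hy hz => rw [map_mul, hy, hz]; rfl

/-- The integers `ρ₂` and `ρ̄₂`. -/
theorem exists_ρ₂_int (hE : Module.finrank ℚ E = 2) (hsqrt : x.sqrtNegSeven ^ 2 = -7)
    (hconj : x.conj ≠ 1) : ∃ r r' : 𝓞 E, (r : E) = x.ρ₂ ∧ (r' : E) = x.ρ₂bar ∧ r * r' = 2 ∧
      r + r' = 1 ∧ x.conjInt r = r' := by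
  have hmul : x.ρ₂ * x.ρ₂bar = 2 := by
    rw [ρ₂, ρ₂bar]
    linear_combination (-1 / 4) * hsqrt
  have hadd : x.ρ₂ + x.ρ₂bar = 1 := by
    rw [ρ₂, ρ₂bar]
    ring
  have h1 : ∀ z : E, z ^ 2 - z + 2 = 0 → IsIntegral ℤ z := fun z hz => by
    refine ⟨Polynomial.X ^ 2 - Polynomial.X + 2, by monicity!, ?_⟩
    simpa using hz
  obtain ⟨r, hr⟩ : ∃ r : 𝓞 E, (r : E) = x.ρ₂ :=
    ⟨⟨x.ρ₂, h1 _ (by linear_combination -hmul + x.ρ₂ * hadd)⟩, rfl⟩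
  obtain ⟨r', hr'⟩ : ∃ r' : 𝓞 E, (r' : E) = x.ρ₂bar :=
    ⟨⟨x.ρ₂bar, h1 _ (by linear_combination -hmul + x.ρ₂bar * hadd)⟩, rfl⟩
  refine ⟨r, r', hr, hr', ?_, ?_, ?_⟩
  · apply RingOfIntegers.ext
    rw [RingOfIntegers.val_mul, RingOfIntegers.val_two, hr, hr', hmul]
  · apply RingOfIntegers.ext
    rw [RingOfIntegers.val_add, hr, hr', hadd]
    exact (map_one (algebraMap (𝓞 E) E)).symm
  · apply RingOfIntegers.ext
    rw [coe_conjInt, hr, hr', ρ₂, ρ₂bar, map_div₀, map_add, x.conj_sqrtNegSeven hE hsqrt hconj,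
      map_one, map_ofNat]
    ring

theorem absNorm_span_of_mul_conjInt (hE : Module.finrank ℚ E = 2) {π : 𝓞 E} {p : ℕ}
    (h : π * x.conjInt π = p) : Ideal.absNorm (Ideal.span {π}) = p := by
  have h1 : Algebra.norm ℤ (x.conjInt π) = Algebra.norm ℤ π :=
    (Algebra.norm_eq_of_algEquiv x.conjInt.toIntAlgEquiv π)
  have h2 := congrArg (Algebra.norm ℤ) h
  rw [map_mul, h1, show (p : 𝓞 E) = algebraMap ℤ (𝓞 E) p by simp, Algebra.norm_algebraMap,
    RingOfIntegers.rank, hE] at h2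
  have h3 := congrArg Int.natAbs h2
  rw [Int.natAbs_mul, Int.natAbs_pow, Int.natAbs_natCast, ← sq] at h3
  rw [Ideal.absNorm_span_singleton]
  exact Nat.pow_left_injective (n := 2) (by norm_num) h3

theorem isPrime_span_of_mul_conjInt (hE : Module.finrank ℚ E = 2) {π : 𝓞 E} {p : ℕ}
    (hp : p.Prime) (h : π * x.conjInt π = p) : (Ideal.span {π}).IsPrime :=
  Ideal.isPrime_of_irreducible_absNorm (by
    rw [x.absNorm_span_of_mul_conjInt hE h]
    exact hp)

theorem conjInt_conjInt {π : 𝓞 E} {p : ℕ} (hp : p ≠ 0)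
    (h : π * x.conjInt π = p) : x.conjInt (x.conjInt π) = π := by
  have h1 := congrArg x.conjInt h
  rw [map_mul, map_natCast, ← h, mul_comm π] at h1
  refine mul_left_cancel₀ ?_ h1
  intro h0
  rw [h0, mul_zero] at h
  exact hp (by exact_mod_cast h.symm)

theorem asIdeal_eq_of_mem (hE : Module.finrank ℚ E = 2) {π : 𝓞 E} {p : ℕ}
    (hp : p.Prime) (h : π * x.conjInt π = p) {v : HeightOneSpectrum (𝓞 E)} (hv : π ∈ v.asIdeal) :
    v.asIdeal = Ideal.span {π} := by
  have h0 : π ≠ 0 := by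
    rintro rfl
    rw [zero_mul] at h
    exact hp.ne_zero (by exact_mod_cast h.symm)
  have h1 := (x.isPrime_span_of_mul_conjInt hE hp h).isMaximal (by simpa using h0)
  exact (h1.eq_of_le v.isPrime.ne_top (by simpa using hv)).symm

/-- The primes above a rational prime that splits as `p = π π̄`. -/
theorem asIdeal_eq_or_of_natCast_mem (hE : Module.finrank ℚ E = 2) {π : 𝓞 E} {p : ℕ}
    (hp : p.Prime) (h : π * x.conjInt π = p) {v : HeightOneSpectrum (𝓞 E)}
    (hv : (p : 𝓞 E) ∈ v.asIdeal) :
    v.asIdeal = Ideal.span {π} ∨ v.asIdeal = Ideal.span {x.conjInt π} := by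
  rw [← h] at hv
  rcases v.isPrime.mem_or_mem hv with h1 | h1
  · exact Or.inl (x.asIdeal_eq_of_mem hE hp h h1)
  · refine Or.inr (x.asIdeal_eq_of_mem hE hp ?_ h1)
    rw [x.conjInt_conjInt hp.ne_zero h, mul_comm, h]

/-- A prime `π` of degree one with residue characteristic prime to `14` is not associated to its
conjugate: otherwise the conjugation would act trivially on the residue field `𝔽_p`, and
`√-7 ≡ -√-7`. -/
theorem conjInt_notMem (hE : Module.finrank ℚ E = 2) (hsqrt : x.sqrtNegSeven ^ 2 = -7)
    (hconj : x.conj ≠ 1) {π : 𝓞 E} {p : ℕ}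
    (hp : p.Prime) (hp28 : Nat.Coprime p 28) (h : π * x.conjInt π = p)
    {v : HeightOneSpectrum (𝓞 E)} (hv : v.asIdeal = Ideal.span {π}) :
    x.conjInt π ∉ v.asIdeal := by
  intro hmem
  have hstable : ∀ n ∈ v.asIdeal, x.conjInt n ∈ v.asIdeal := by
    intro n hn
    rw [hv, Ideal.mem_span_singleton] at hn
    obtain ⟨q, rfl⟩ := hn
    rw [map_mul]
    exact Ideal.mul_mem_right _ _ hmem
  have hint : IsIntegral ℤ x.sqrtNegSeven :=
    ⟨Polynomial.X ^ 2 + 7, by monicity!, by simp [hsqrt]⟩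
  obtain ⟨s, hs⟩ : ∃ s : 𝓞 E, (s : E) = x.sqrtNegSeven := ⟨⟨x.sqrtNegSeven, hint⟩, rfl⟩
  have hsc : x.conjInt s = -s := by
    apply RingOfIntegers.ext
    rw [coe_conjInt, hs, x.conj_sqrtNegSeven hE hsqrt hconj, ← hs]
    exact (map_neg (algebraMap (𝓞 E) E) s).symm
  have hss : s ^ 2 = -7 := by
    apply RingOfIntegers.ext
    rw [RingOfIntegers.val_pow, hs, hsqrt]
    exact ((map_neg (algebraMap (𝓞 E) E) 7).trans (by rw [map_ofNat])).symm
  obtain ⟨k, hk⟩ := exists_int_sub_mem_of_absNorm (I := v.asIdeal) hp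
    (by rw [hv]; exact x.absNorm_span_of_mul_conjInt hE h) s
  have h1 := hstable _ hk
  rw [map_sub, hsc, map_intCast] at h1
  have h2 := sub_mem hk h1
  have h3 : ((28 : ℕ) : 𝓞 E) ∈ v.asIdeal := by
    -- As `s ≡ k` implies `-s ≡ k`, the ideal contains `2 s`, and `(2 s)² = -28`.
    have h4 : ((28 : ℕ) : 𝓞 E) = (s - k - (-s - k)) * (-(2 * s)) := by
      push_cast
      linear_combination (4 : 𝓞 E) * hss
    rw [h4]
    exact Ideal.mul_mem_right _ _ h2
  refine notMem_of_coprime v.isPrime hp28 ?_ h3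
  rw [← h]
  exact Ideal.mul_mem_left _ _ hmem

end CyclicData

/-! ### Total ramification in a cyclic quintic field -/

section TotalRamification

set_option linter.unusedSectionVars false

variable {M : Type*} [Field M] [NumberField M]

theorem absNorm_span_of_norm {p : ℕ} {δ : 𝓞 M} (hδ : Algebra.norm ℚ (δ : M) = p) :
    Ideal.absNorm (Ideal.span {δ}) = p := by
  have h1 : Algebra.norm ℤ δ = p := by
    have := Algebra.coe_norm_int δ
    rw [hδ] at this
    exact_mod_cast this
  rw [Ideal.absNorm_span_singleton, h1, Int.natAbs_natCast]

/-- If `p` divides the discriminant of a number field, then some integer that is not divisible by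
`p` is orthogonal to all integers modulo `p` for the trace form. -/
theorem exists_forall_dvd_trace {p : ℕ} (hp : p.Prime) (h : (p : ℤ) ∣ discr M) :
    ∃ m : 𝓞 M, ¬ (p : 𝓞 M) ∣ m ∧ ∀ n : 𝓞 M, (p : ℤ) ∣ Algebra.trace ℤ (𝓞 M) (m * n) := by
  classical
  have : Fact p.Prime := ⟨hp⟩
  set e := RingOfIntegers.basis M with he
  have hdet : ((Algebra.traceMatrix ℤ e).map (Int.castRingHom (ZMod p))).det = 0 := by
    have h1 := (Int.castRingHom (ZMod p)).map_det (Algebra.traceMatrix ℤ e)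
    rw [RingHom.mapMatrix_apply] at h1
    rw [← h1, ← Algebra.discr_def]
    exact (ZMod.intCast_zmod_eq_zero_iff_dvd _ p).2 h
  -- A vector in the kernel of the trace form modulo `p`.
  obtain ⟨w, hw0, hw⟩ := Matrix.exists_mulVec_eq_zero_iff.2 hdet
  choose k hk using fun i => ZMod.intCast_surjective (w i)
  set m : 𝓞 M := ∑ i, k i • e i with hm
  have hrepr : ∀ i, e.repr m i = k i := fun i => by rw [hm, e.repr_sum_self]
  have hbasis : ∀ i, (p : ℤ) ∣ Algebra.trace ℤ (𝓞 M) (m * e i) := by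
    intro i
    rw [← ZMod.intCast_zmod_eq_zero_iff_dvd, hm, Finset.sum_mul, map_sum, Int.cast_sum]
    have h1 := congrFun hw i
    rw [Pi.zero_apply] at h1
    rw [← h1, Matrix.mulVec, dotProduct]
    refine Finset.sum_congr rfl fun j _ => ?_
    rw [smul_mul_assoc, map_smul, smul_eq_mul, Int.cast_mul, hk, mul_comm, mul_comm (e j)]
    rfl
  refine ⟨m, ?_, fun n => ?_⟩
  · rintro ⟨n, hn⟩
    refine hw0 (funext fun i => ?_)
    rw [Pi.zero_apply, ← hk, ← hrepr, hn, ← nsmul_eq_mul, map_nsmul, Finsupp.smul_apply,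
      nsmul_eq_mul]
    simp
  · rw [← e.sum_repr n, Finset.mul_sum, map_sum]
    refine Finset.dvd_sum fun i _ => ?_
    rw [mul_smul_comm, map_smul, smul_eq_mul]
    exact Dvd.dvd.mul_left (hbasis i) _

variable {τ : M ≃ₐ[ℚ] M}

theorem coe_mapRingEquiv_iterate (n : ℕ) (m : 𝓞 M) :
    (((RingOfIntegers.mapRingEquiv τ.toRingEquiv)^[n] m : 𝓞 M) : M) = (τ ^ n) m := by
  induction n with
  | zero => rfl
  | succ n ih =>
    rw [Function.iterate_succ_apply', pow_succ', AlgEquiv.mul_apply, ← ih]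
    rfl

theorem iterate_dvd_iterate {g : 𝓞 M ≃+* 𝓞 M} {m n : 𝓞 M} (h : m ∣ n) (k : ℕ) :
    g^[k] m ∣ g^[k] n := by
  induction k with
  | zero => exact h
  | succ k ih =>
    rw [Function.iterate_succ_apply', Function.iterate_succ_apply']
    exact map_dvd g ih

/-- In a cyclic quintic field, an element `δ` whose norm is a ramified prime `p` is associated to
its conjugates. Otherwise the five conjugates of `δ` are pairwise coprime, `p` is their product, and
the trace form is nondegenerate modulo `p`, as one sees by multiplying an element by all the
conjugates but one. -/
theorem associated_map_of_dvd_discr [IsGalois ℚ M] (hM : Module.finrank ℚ M = 5)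
    (hτ : orderOf τ = 5) {p : ℕ} (hp : p.Prime) (hdisc : (p : ℤ) ∣ discr M) {δ : 𝓞 M}
    (hδ : Algebra.norm ℚ (δ : M) = p) :
    Associated (RingOfIntegers.mapRingEquiv τ.toRingEquiv δ) δ := by
  classical
  set g := RingOfIntegers.mapRingEquiv τ.toRingEquiv with hg
  have hτ5 : τ ^ 5 = 1 := by rw [← hτ, pow_orderOf_eq_one]
  have hper : ∀ (n : ℕ) (m : 𝓞 M), g^[n + 5] m = g^[n] m := by
    intro n m
    apply RingOfIntegers.ext
    rw [coe_mapRingEquiv_iterate, coe_mapRingEquiv_iterate, pow_add, hτ5, mul_one]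
  by_cases hdvd : δ ∣ g δ
  · have h1 : ∀ k, g δ ∣ g^[k + 1] δ := by
      intro k
      induction k with
      | zero => exact dvd_rfl
      | succ k ih =>
        refine ih.trans ?_
        have := iterate_dvd_iterate (g := g) hdvd (k + 1)
        rwa [← Function.iterate_succ_apply] at this
    have h2 := h1 4
    rw [show 4 + 1 = 0 + 5 from rfl, hper] at h2
    exact associated_of_dvd_dvd h2 hdvd
  exfalso
  -- Otherwise `δ` divides its image under each power of `gʲ`, and `gʲ` generates the group.
  have hnd : ∀ j, 0 < j → j < 5 → ¬ δ ∣ g^[j] δ := by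
    intro j h0 h5 h1
    have h2 : ∀ k, δ ∣ g^[j * k] δ := by
      intro k
      induction k with
      | zero => exact dvd_rfl
      | succ k ih =>
        have := iterate_dvd_iterate (g := g) h1 (j * k)
        rw [← Function.iterate_add_apply] at this
        exact ih.trans this
    apply hdvd
    interval_cases j
    · exact h2 1
    · have h3 := h2 3
      rwa [show 2 * 3 = 1 + 5 from rfl, hper] at h3
    · have h3 := h2 2
      rwa [show 3 * 2 = 1 + 5 from rfl, hper] at h3
    · have h3 := h2 4
      rwa [show 4 * 4 = 1 + 5 + 5 + 5 from rfl, hper, hper, hper] at h3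
  have hprime : (Ideal.span {δ}).IsPrime := Ideal.isPrime_of_irreducible_absNorm (by
    rw [absNorm_span_of_norm hδ]; exact hp)
  have hδ0 : δ ≠ 0 := by
    rintro rfl
    have h1 : (p : ℚ) = 0 := by rw [← hδ]; simp
    exact hp.ne_zero (by exact_mod_cast h1)
  have hmax := hprime.isMaximal (by simpa using hδ0)
  have hgprime : ∀ j, Prime (g^[j] δ) := by
    intro j
    induction j with
    | zero => exact (Ideal.span_singleton_prime hδ0).1 hprime
    | succ j ih =>
      rw [Function.iterate_succ_apply']
      exact (MulEquiv.prime_iff g.toMulEquiv).2 ih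
  have hcop : ∀ i j, i < j → j < 5 → IsCoprime (g^[i] δ) (g^[j] δ) := by
    intro i j hij hj
    have h1 : IsCoprime δ (g^[j - i] δ) := by
      obtain ⟨y, z, hz, h1⟩ := hmax.exists_inv (x := g^[j - i] δ) (by
        rw [Ideal.mem_span_singleton]
        exact hnd _ (by omega) (by omega))
      obtain ⟨w, rfl⟩ := Ideal.mem_span_singleton.1 hz
      exact ⟨w, y, by linear_combination h1⟩
    have h2 : ∀ k, IsCoprime (g^[k] δ) (g^[k] (g^[j - i] δ)) := by
      intro k
      induction k with
      | zero => exact h1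
      | succ k ih =>
        rw [Function.iterate_succ_apply', Function.iterate_succ_apply' _ _ (g^[j - i] δ)]
        exact ih.map (g : 𝓞 M →+* 𝓞 M)
    have h3 := h2 i
    rwa [← Function.iterate_add_apply, show i + (j - i) = j by omega] at h3
  have hcop' : ∀ i j, i ≠ j → i < 5 → j < 5 → IsCoprime (g^[i] δ) (g^[j] δ) := by
    intro i j hij hi hj
    rcases lt_or_gt_of_ne hij with h1 | h1
    · exact hcop i j h1 hj
    · exact (hcop j i h1 hi).symm
  have hprod : ∏ j ∈ Finset.range 5, g^[j] δ = (p : 𝓞 M) := by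
    apply RingOfIntegers.ext
    rw [RingOfIntegers.val_prod, RingOfIntegers.val_natCast, Finset.prod_range,
      Finset.prod_congr rfl fun j _ => coe_mapRingEquiv_iterate _ _,
      ← algebraMap_norm_eq_prod_pow hτ hM, hδ, map_natCast]
  obtain ⟨m, hm, hmtr⟩ := exists_forall_dvd_trace hp hdisc
  -- As the conjugates of `δ` are coprime with product `p`, one of them does not divide `m`.
  obtain ⟨j, hj5, hj⟩ : ∃ j < 5, ¬ g^[j] δ ∣ m := by
    by_contra! hall
    apply hm
    rw [← hprod]
    refine Finset.prod_dvd_of_coprime (fun i hi j hj hij => ?_) fun j hj =>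
      hall j (Finset.mem_range.1 hj)
    exact hcop' i j hij (Finset.mem_range.1 hi) (Finset.mem_range.1 hj)
  -- The trace of `m n` is divisible by `δ`, and so are all conjugates of `m n` except the one by
  -- `g^k₀ = g⁻ʲ`; hence this one is divisible too, and `gʲ δ` divides `m n`.
  set n := ∏ i ∈ (Finset.range 5).erase j, g^[i] δ with hn
  have htr : δ ∣ ∑ k ∈ Finset.range 5, g^[k] (m * n) := by
    have h1 : ((Algebra.trace ℤ (𝓞 M) (m * n) : ℤ) : 𝓞 M) =
        ∑ k ∈ Finset.range 5, g^[k] (m * n) := by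
      apply RingOfIntegers.ext
      rw [RingOfIntegers.val_sum, RingOfIntegers.val_intCast, Finset.sum_range,
        Finset.sum_congr rfl fun j _ => coe_mapRingEquiv_iterate _ _,
        ← algebraMap_trace_eq_sum_pow hτ hM, ← Algebra.coe_trace_int, map_intCast]
    rw [← h1]
    have h2 : δ ∣ (p : 𝓞 M) := by
      rw [← hprod]
      exact Finset.dvd_prod_of_mem (fun j => g^[j] δ) (Finset.mem_range.2 (by norm_num : 0 < 5))
    refine h2.trans ?_
    obtain ⟨c, hc⟩ := hmtr n
    exact ⟨c, by rw [hc]; push_cast; ring⟩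
  set k₀ := (5 - j) % 5 with hk₀
  have hothers : ∀ k ∈ (Finset.range 5).erase k₀, δ ∣ g^[k] (m * n) := by
    intro k hk
    rw [Finset.mem_erase, Finset.mem_range] at hk
    have hi : (5 - k) % 5 ∈ (Finset.range 5).erase j := by
      rw [Finset.mem_erase, Finset.mem_range]
      omega
    have h1 : g^[(5 - k) % 5] δ ∣ m * n :=
      (Finset.dvd_prod_of_mem (fun i => g^[i] δ) hi).trans (Dvd.intro_left _ rfl)
    have h2 := iterate_dvd_iterate (g := g) h1 k
    rw [← Function.iterate_add_apply] at h2
    have h3 : g^[k + (5 - k) % 5] δ = δ := by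
      rcases Nat.eq_zero_or_pos k with rfl | hk0
      · rfl
      · rw [show k + (5 - k) % 5 = 0 + 5 by omega, hper]; rfl
    rwa [h3] at h2
  have hk₀mem : k₀ ∈ Finset.range 5 := Finset.mem_range.2 (by omega)
  rw [← Finset.add_sum_erase _ _ hk₀mem] at htr
  have h1 := (dvd_add_left (Finset.dvd_sum hothers)).1 htr
  have h2 := iterate_dvd_iterate (g := g) h1 j
  rw [← Function.iterate_add_apply] at h2
  have h3 : g^[j + k₀] (m * n) = m * n := by
    rcases Nat.eq_zero_or_pos j with h0 | h0
    · rw [show j + k₀ = 0 by omega]; rfl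
    · rw [show j + k₀ = 0 + 5 by omega, hper]; rfl
  rw [h3] at h2
  rcases (hgprime j).dvd_or_dvd h2 with h4 | h4
  · exact hj h4
  · obtain ⟨i, hi, h5⟩ := ((hgprime j).dvd_finsetProd_iff _).1 h4
    rw [Finset.mem_erase, Finset.mem_range] at hi
    exact (hgprime j).not_isUnit ((hcop' i j hi.1 hi.2 hj5).symm.isUnit_of_dvd h5)

theorem associated_pow_five_of_dvd_discr [IsGalois ℚ M] (hM : Module.finrank ℚ M = 5)
    (hτ : orderOf τ = 5) {p : ℕ} (hp : p.Prime) (hdisc : (p : ℤ) ∣ discr M) {δ : 𝓞 M}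
    (hδ : Algebra.norm ℚ (δ : M) = p) : Associated (δ ^ 5) (p : 𝓞 M) := by
  set g := RingOfIntegers.mapRingEquiv τ.toRingEquiv with hg
  have h1 : ∀ j, Associated δ (g^[j] δ) := by
    intro j
    induction j with
    | zero => exact Associated.refl _
    | succ j ih =>
      rw [Function.iterate_succ_apply']
      exact (associated_map_of_dvd_discr hM hτ hp hdisc hδ).symm.trans (ih.map g)
  have hprod : ∏ j ∈ Finset.range 5, g^[j] δ = (p : 𝓞 M) := by
    apply RingOfIntegers.ext
    rw [RingOfIntegers.val_prod, RingOfIntegers.val_natCast, Finset.prod_range,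
      Finset.prod_congr rfl fun j _ => coe_mapRingEquiv_iterate _ _,
      ← algebraMap_norm_eq_prod_pow hτ hM, hδ, map_natCast]
  have h2 : Associated (∏ _j ∈ Finset.range 5, δ) (∏ j ∈ Finset.range 5, g^[j] δ) :=
    Associated.prod _ _ _ fun j _ => h1 j
  rwa [hprod, Finset.prod_const, Finset.card_range] at h2

end TotalRamification

/-! ### The ramified places of the compositum -/

/-- The situation at a place `v = (π)` of `E` above a rational prime `p = π π'` that is totally
ramified in the quintic field `M`, with `δ⁵ W = p` and `σ(δ) = δ η` for units `W` and `η`. -/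
structure QuinticRamified {E M L : Type*} [Field E] [NumberField E] [Field M] [NumberField M]
    [Field L] [Algebra E L] [Algebra M L] (σ : L ≃ₐ[E] L) (v : HeightOneSpectrum (𝓞 E))
    (π π' : 𝓞 E) (δ : 𝓞 M) (W η : (𝓞 M)ˣ) (p : ℕ) : Prop where
  asIdeal_eq : v.asIdeal = Ideal.span {π}
  notMem : π' ∉ v.asIdeal
  mul_eq : π * π' = p
  pow_eq : δ ^ 5 * (W : 𝓞 M) = p
  map_δ : σ (algebraMap M L δ) = algebraMap M L δ * algebraMap M L (η : 𝓞 M)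
  discr_eq : discr M = (p : ℤ) ^ 4
  residue : ∀ m : 𝓞 M, ∃ k : ℤ, δ ∣ m - k
  five_notMem : (5 : 𝓞 E) ∉ v.asIdeal

namespace QuinticRamified

set_option linter.unusedSectionVars false

variable {E M L : Type*} [Field E] [NumberField E] [Field M] [NumberField M]
  [Field L] [NumberField L] [Algebra E L] [Algebra M L] {σ : L ≃ₐ[E] L}
  {v : HeightOneSpectrum (𝓞 E)} {π π' : 𝓞 E} {δ : 𝓞 M} {W η : (𝓞 M)ˣ} {p : ℕ}

local notation "δL" => algebraMap M L (δ : M)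

theorem unit_mem (u : (𝓞 M)ˣ) : algebraMap M L (u : 𝓞 M) ∈ locInt v L :=
  algebraMap_integer_mem_locInt _

theorem unit_ne_zero (u : (𝓞 M)ˣ) : algebraMap M L (u : 𝓞 M) ≠ 0 := by
  rw [map_ne_zero, Ne, RingOfIntegers.coe_eq_zero_iff]
  exact u.ne_zero

theorem unit_inv (u : (𝓞 M)ˣ) :
    (algebraMap M L (u : 𝓞 M))⁻¹ = algebraMap M L ((u⁻¹ : (𝓞 M)ˣ) : 𝓞 M) := by
  rw [inv_eq_iff_eq_inv, eq_comm]
  apply inv_eq_of_mul_eq_one_left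
  rw [← map_mul, ← RingOfIntegers.val_mul, ← Units.val_mul, mul_inv_cancel, Units.val_one]
  exact (congrArg (algebraMap M L) (map_one (algebraMap (𝓞 M) M))).trans (map_one _)

theorem unit_inv_mem (u : (𝓞 M)ˣ) : (algebraMap M L (u : 𝓞 M))⁻¹ ∈ locInt v L := by
  rw [unit_inv]
  exact unit_mem _

theorem pow_eq' (h : QuinticRamified σ v π π' δ W η p) :
    (δL : L) ^ 5 * algebraMap M L (W : 𝓞 M) = algebraMap E L π * algebraMap E L π' := by
  have h1 := congrArg (fun t : 𝓞 M => algebraMap M L (t : M)) h.pow_eq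
  have h2 := congrArg (fun t : 𝓞 E => algebraMap E L (t : E)) h.mul_eq
  simp only [map_mul, map_pow, map_natCast] at h1 h2
  rw [h1, h2]

theorem algebraMap_ne_zero (h : QuinticRamified σ v π π' δ W η p) : algebraMap E L π ≠ 0 := by
  rw [map_ne_zero, Ne, RingOfIntegers.coe_eq_zero_iff]
  rintro rfl
  exact v.ne_bot (by rw [h.asIdeal_eq]; simp)

theorem algebraMap_ne_zero' (h : QuinticRamified σ v π π' δ W η p) : algebraMap E L π' ≠ 0 := by
  rw [map_ne_zero]
  exact ne_zero_of_notMem h.notMem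

theorem δ_ne_zero (h : QuinticRamified σ v π π' δ W η p) : (δL : L) ≠ 0 := by
  intro h0
  have := h.pow_eq'
  rw [h0, zero_pow (by norm_num), zero_mul] at this
  exact mul_ne_zero h.algebraMap_ne_zero h.algebraMap_ne_zero' this.symm

theorem δ_mem (_ : QuinticRamified σ v π π' δ W η p) : (δL : L) ∈ locInt v L :=
  algebraMap_integer_mem_locInt δ

theorem inv_π'_mem (h : QuinticRamified σ v π π' δ W η p) :
    (algebraMap E L π')⁻¹ ∈ locInt v L := by
  rw [← map_inv₀]
  exact algebraMap_mem_locInt (inv_coe_mem_locInt h.notMem)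

theorem algebraMap_eq (h : QuinticRamified σ v π π' δ W η p) : algebraMap E L π =
    (δL : L) ^ 5 * (algebraMap M L (W : 𝓞 M) * (algebraMap E L π')⁻¹) := by
  have := h.algebraMap_ne_zero'
  field_simp
  exact h.pow_eq'.symm

/-- An integer of `E` divisible by `δ` lies in `v`: its fifth power is divisible by `π`. -/
theorem mem_asIdeal_of_eq_mul (h : QuinticRamified σ v π π' δ W η p) {n : 𝓞 E} {b : L}
    (hb : b ∈ locInt v L) (hn : algebraMap E L n = δL * b) : n ∈ v.asIdeal := by
  have h1 : algebraMap E L ((n : E) ^ 5 / π) =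
      algebraMap E L π' * (algebraMap M L (W : 𝓞 M))⁻¹ * b ^ 5 := by
    have h2 := h.algebraMap_ne_zero
    have h3 := unit_ne_zero (L := L) W
    rw [map_div₀, map_pow, hn]
    field_simp
    linear_combination b ^ 5 * h.pow_eq'
  have h2 : (n : E) ^ 5 / π ∈ locInt v E := by
    rw [← algebraMap_mem_locInt_iff (L := L), h1]
    exact mul_mem (mul_mem (algebraMap_coe_mem_locInt _) (unit_inv_mem W)) (pow_mem hb 5)
  have h0 : (π : E) ≠ 0 := (_root_.map_ne_zero (algebraMap E L)).1 h.algebraMap_ne_zero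
  refine v.isPrime.mem_of_pow_mem 5 (mem_asIdeal_of_div_mem_locInt h.asIdeal_eq h2 ?_)
  rw [RingOfIntegers.val_pow]
  field_simp

theorem exists_eq_mul_of_mem (h : QuinticRamified σ v π π' δ W η p) {f : E}
    (hf : f ∈ locInt v E) {b : L} (hb : b ∈ locInt v L) (hfb : algebraMap E L f = δL * b) :
    ∃ f' ∈ locInt v E, f = π * f' := by
  obtain ⟨n, f₁, hf₁, rfl⟩ := exists_coe_sub_mem h.asIdeal_eq hf
  have h1 : algebraMap E L n = δL * (b - (δL : L) ^ 4 * (algebraMap M L (W : 𝓞 M) *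
      (algebraMap E L π')⁻¹) * algebraMap E L f₁) := by
    rw [map_add, map_mul, h.algebraMap_eq] at hfb
    linear_combination hfb
  have h2 := h.mem_asIdeal_of_eq_mul (sub_mem hb (mul_mem (mul_mem (pow_mem h.δ_mem 4)
    (mul_mem (unit_mem W) h.inv_π'_mem)) (algebraMap_mem_locInt hf₁))) h1
  rw [h.asIdeal_eq, Ideal.mem_span_singleton] at h2
  obtain ⟨q, rfl⟩ := h2
  exact ⟨q + f₁, add_mem (coe_mem_locInt q) hf₁, by rw [RingOfIntegers.val_mul]; ring⟩

section IntegralBasis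

variable (hσ : orderOf σ = 5)
    (hL : (algebraMap E L).fieldRange ⊔ (algebraMap M L).fieldRange = ⊤)
    (hM : Module.finrank ℚ M = 5)

theorem repr_integer_mul_mem (m : 𝓞 M) {l : L}
    (hl : ∀ j, (compositumBasis hσ hL hM).repr l j ∈ locInt v E) (j) :
    (compositumBasis hσ hL hM).repr (algebraMap M L m * l) j ∈ locInt v E := by
  set e := compositumBasis hσ hL hM with he
  rw [← e.sum_repr l, Finset.mul_sum, map_sum, Finsupp.finsetSum_apply]
  refine sum_mem fun i _ => ?_
  rw [mul_smul_comm, map_smul, Finsupp.smul_apply, smul_eq_mul, he, compositumBasis_apply,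
    ← map_mul, ← RingOfIntegers.val_mul, repr_algebraMap_integer]
  refine mul_mem (hl i) ?_
  rw [← RingOfIntegers.val_intCast]
  exact coe_mem_locInt _

theorem repr_algebraMap_mul_mem {f : E} (hf : f ∈ locInt v E) {l : L}
    (hl : ∀ j, (compositumBasis hσ hL hM).repr l j ∈ locInt v E) (j) :
    (compositumBasis hσ hL hM).repr (algebraMap E L f * l) j ∈ locInt v E := by
  rw [← Algebra.smul_def, map_smul, Finsupp.smul_apply, smul_eq_mul]
  exact mul_mem hf (hl j)

theorem repr_integer_mem (m : 𝓞 M) (j) :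
    (compositumBasis hσ hL hM).repr (algebraMap M L m) j ∈ locInt v E := by
  rw [repr_algebraMap_integer, ← RingOfIntegers.val_intCast]
  exact coe_mem_locInt _

/-- Modulo `δ`, the lattice spanned by the integral basis of `M` reduces to the integers of `E`. -/
theorem exists_eq_add_mul (h : QuinticRamified σ v π π' δ W η p) {l : L}
    (hl : ∀ j, (compositumBasis hσ hL hM).repr l j ∈ locInt v E) :
    ∃ f ∈ locInt v E, ∃ l', (∀ j, (compositumBasis hσ hL hM).repr l' j ∈ locInt v E) ∧
      l = algebraMap E L f + δL * l' := by
  set e := compositumBasis hσ hL hM with he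
  choose k hk using fun i => h.residue (RingOfIntegers.basis M i)
  choose c hc using hk
  refine ⟨∑ i, e.repr l i * k i, sum_mem fun i _ => mul_mem (hl i) (by
      rw [← RingOfIntegers.val_intCast]; exact coe_mem_locInt _),
    ∑ i, algebraMap E L (e.repr l i) * algebraMap M L (c i), fun j => ?_, ?_⟩
  · rw [map_sum, Finsupp.finsetSum_apply]
    exact sum_mem fun i _ => repr_algebraMap_mul_mem hσ hL hM (hl i)
      (repr_integer_mem hσ hL hM (c i)) j
  · conv_lhs => rw [← e.sum_repr l]
    rw [map_sum, Finset.mul_sum, ← Finset.sum_add_distrib]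
    refine Finset.sum_congr rfl fun i _ => ?_
    have h1 : (RingOfIntegers.basis M i : M) = k i + (δ : M) * c i := by
      have := hc i
      rw [sub_eq_iff_eq_add'] at this
      rw [this, RingOfIntegers.val_add, RingOfIntegers.val_mul, RingOfIntegers.val_intCast]
    rw [Algebra.smul_def, he, compositumBasis_apply, h1, map_add, map_mul, map_mul, map_intCast,
      map_intCast]
    ring

/-- The lattice spanned by the integral basis of `M` is closed under division by `δ`, as far as
integrality allows. -/
theorem repr_mem_of_δ_mul (h : QuinticRamified σ v π π' δ W η p) {l : L} (hl : l ∈ locInt v L)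
    (hδl : ∀ j, (compositumBasis hσ hL hM).repr (δL * l) j ∈ locInt v E) (j) :
    (compositumBasis hσ hL hM).repr l j ∈ locInt v E := by
  obtain ⟨f, hf, l', hl', h1⟩ := h.exists_eq_add_mul hσ hL hM hδl
  have hl'B : l' ∈ locInt v L := by
    rw [← (compositumBasis hσ hL hM).sum_repr l']
    refine sum_mem fun i _ => ?_
    rw [Algebra.smul_def, compositumBasis_apply]
    exact mul_mem (algebraMap_mem_locInt (hl' i)) (algebraMap_integer_mem_locInt _)
  obtain ⟨f', hf', rfl⟩ := h.exists_eq_mul_of_mem hf (sub_mem hl hl'B)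
    (by linear_combination -h1 : algebraMap E L f = δL * (l - l'))
  have h2 : l = algebraMap M L ((δ ^ 4 * (W : 𝓞 M) : 𝓞 M) : M) *
      (algebraMap E L ((π' : E)⁻¹ * f') * 1) + l' := by
    apply mul_left_cancel₀ h.δ_ne_zero
    rw [h1, map_mul, h.algebraMap_eq, RingOfIntegers.val_mul, RingOfIntegers.val_pow, map_mul,
      map_mul, map_pow, map_inv₀]
    ring
  have h3 : ∀ j, (compositumBasis hσ hL hM).repr (1 : L) j ∈ locInt v E := by
    intro j
    have := repr_integer_mem (v := v) hσ hL hM (1 : 𝓞 M) j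
    rwa [show ((1 : 𝓞 M) : M) = 1 from map_one _, map_one] at this
  rw [h2, map_add, Finsupp.add_apply]
  exact add_mem (repr_integer_mul_mem hσ hL hM _ (repr_algebraMap_mul_mem hσ hL hM
    (mul_mem (inv_coe_mem_locInt h.notMem) hf') h3) j) (hl' j)

/-- The integers of `L` are spanned locally at `v` by the integral basis of `M`. -/
theorem repr_mem [IsGalois ℚ M] (h : QuinticRamified σ v π π' δ W η p) {l : L}
    (hl : l ∈ locInt v L) (j) : (compositumBasis hσ hL hM).repr l j ∈ locInt v E := by
  have key : ∀ N : ℕ, (∀ j, (compositumBasis hσ hL hM).repr ((δL : L) ^ N * l) j ∈ locInt v E) →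
      ∀ j, (compositumBasis hσ hL hM).repr l j ∈ locInt v E := by
    intro N
    induction N with
    | zero => intro h1; simpa using h1
    | succ N ih =>
      intro h1
      refine ih (h.repr_mem_of_δ_mul hσ hL hM (mul_mem (pow_mem h.δ_mem N) hl) ?_)
      rwa [← mul_assoc, ← pow_succ']
  -- The discriminant `p⁴` is a unit multiple of `δ²⁰` and a common denominator of the coordinates.
  refine key 20 (fun j => ?_) j
  have h1 : (δL : L) ^ 20 * l = algebraMap M L (((W⁻¹ ^ 4 : (𝓞 M)ˣ) : 𝓞 M) : M) *
      (algebraMap E L (discr M : E) * l) := by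
    have h2 : (δL : L) ^ 5 * algebraMap M L (W : 𝓞 M) = p := by
      have := congrArg (fun t : 𝓞 M => algebraMap M L (t : M)) h.pow_eq
      simpa only [map_mul, map_pow, map_natCast] using this
    have h3 := unit_ne_zero (L := L) W
    rw [h.discr_eq, Units.val_pow_eq_pow_val, RingOfIntegers.val_pow, map_pow, ← unit_inv]
    push_cast
    rw [← h2]
    field_simp
  rw [h1]
  refine repr_integer_mul_mem hσ hL hM _ (fun j => ?_) j
  rw [← Algebra.smul_def, map_smul, Finsupp.smul_apply, smul_eq_mul]
  exact discr_mul_repr_mem hσ hL hM (fun m hm => trace_mem_locInt (mul_mem hl hm)) j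

end IntegralBasis

/-- The residue field does not grow in `L`. -/
theorem exists_residue [IsGalois ℚ M] (hσ : orderOf σ = 5)
    (hL : (algebraMap E L).fieldRange ⊔ (algebraMap M L).fieldRange = ⊤)
    (hM : Module.finrank ℚ M = 5) (h : QuinticRamified σ v π π' δ W η p) {l : L}
    (hl : l ∈ locInt v L) :
    ∃ n : 𝓞 E, ∃ m ∈ locInt v L, l = algebraMap E L n + δL * m := by
  obtain ⟨f, hf, l', hl', h1⟩ := h.exists_eq_add_mul hσ hL hM (h.repr_mem hσ hL hM hl)
  have hl'B : l' ∈ locInt v L := by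
    rw [← (compositumBasis hσ hL hM).sum_repr l']
    refine sum_mem fun i _ => ?_
    rw [Algebra.smul_def, compositumBasis_apply]
    exact mul_mem (algebraMap_mem_locInt (hl' i)) (algebraMap_integer_mem_locInt _)
  obtain ⟨n, f', hf', rfl⟩ := exists_coe_sub_mem h.asIdeal_eq hf
  refine ⟨n, (δL : L) ^ 4 * (algebraMap M L (W : 𝓞 M) * (algebraMap E L π')⁻¹) * algebraMap E L f'
    + l', add_mem (mul_mem (mul_mem (pow_mem h.δ_mem 4)
    (mul_mem (unit_mem W) h.inv_π'_mem)) (algebraMap_mem_locInt hf')) hl'B, ?_⟩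
  rw [h1, map_add, map_mul, h.algebraMap_eq]
  ring

theorem map_mem (h : QuinticRamified σ v π π' δ W η p) {k : ℤ} {l : L}
    (hl : l ∈ fracPow (locInt v L) (δL : L) k) : σ l ∈ fracPow (locInt v L) (δL : L) k :=
  map_mem_fracPow (fun _ => map_mem_locInt σ) h.map_δ (unit_mem η) (unit_inv_mem η) hl

theorem pow_map_mem (h : QuinticRamified σ v π π' δ W η p) (i : ℕ) {k : ℤ} {l : L}
    (hl : l ∈ fracPow (locInt v L) (δL : L) k) : (σ ^ i) l ∈ fracPow (locInt v L) (δL : L) k := by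
  induction i with
  | zero => simpa using hl
  | succ i ih => rw [pow_succ']; exact h.map_mem ih

theorem mem_fracPow_one_iff (h : QuinticRamified σ v π π' δ W η p) {l : L} :
    l ∈ fracPow (locInt v L) (δL : L) 1 ↔ ∃ m ∈ locInt v L, l = δL * m := by
  rw [mem_fracPow_iff_exists h.δ_ne_zero]; simp

/-- Traces reduce to five times the residue. -/
theorem trace_sub_mem (hσ : orderOf σ = 5) (hLdeg : Module.finrank E L = 5)
    (h : QuinticRamified σ v π π' δ W η p) {k : ℤ} {l : L} {n : E}
    (hl : l - algebraMap E L n ∈ fracPow (locInt v L) (δL : L) k) :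
    algebraMap E L (Algebra.trace E L l - 5 * n) ∈ fracPow (locInt v L) (δL : L) k := by
  have h1 : algebraMap E L (Algebra.trace E L l - 5 * n) =
      ∑ j : Fin 5, (σ ^ (j : ℕ)) (l - algebraMap E L n) := by
    rw [map_sub, algebraMap_trace_eq_sum_pow hσ hLdeg, map_mul, map_ofNat]
    simp only [map_sub, AlgEquiv.commutes]
    rw [Finset.sum_sub_distrib, Finset.sum_const, Finset.card_fin, nsmul_eq_mul]
    norm_num
  rw [h1]
  exact sum_mem fun j _ => h.pow_map_mem _ hl

theorem five_mul_notMem (h : QuinticRamified σ v π π' δ W η p) {n : 𝓞 E} (hn : n ∉ v.asIdeal) :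
    (5 * n) ∉ v.asIdeal := fun h1 =>
  (v.isPrime.mem_or_mem h1).elim h.five_notMem hn

/-- The trace dual of the integers of `L` is contained in `δ⁻⁴ 𝓞_L`: the ramification is tame. -/
theorem mem_fracPow_of_trace_mem [IsGalois ℚ M] (hσ : orderOf σ = 5)
    (hL : (algebraMap E L).fieldRange ⊔ (algebraMap M L).fieldRange = ⊤)
    (hM : Module.finrank ℚ M = 5) (h : QuinticRamified σ v π π' δ W η p) {l : L}
    (hl : ∀ m ∈ locInt v L, Algebra.trace E L (l * m) ∈ locInt v E) :
    l ∈ fracPow (locInt v L) (δL : L) (-4) := by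
  have hπ0 := h.algebraMap_ne_zero
  have hδ0 := h.δ_ne_zero
  have key : ∀ n : ℕ, (δL : L) ^ (n + 4) * l ∈ locInt v L → (δL : L) ^ 4 * l ∈ locInt v L := by
    intro n
    induction n with
    | zero => intro h1; simpa using h1
    | succ n ih =>
      intro h1
      obtain ⟨n₀, m, hm, h2⟩ := h.exists_residue hσ hL hM h1
      by_cases hn₀ : n₀ ∈ v.asIdeal
      · apply ih
        rw [h.asIdeal_eq, Ideal.mem_span_singleton] at hn₀
        obtain ⟨q, rfl⟩ := hn₀
        have h3 : (δL : L) ^ (n + 4) * l = (δL : L) ^ 4 * (algebraMap M L (W : 𝓞 M) *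
            (algebraMap E L π')⁻¹) * algebraMap E L q + m := by
          apply mul_left_cancel₀ hδ0
          rw [RingOfIntegers.val_mul, map_mul, h.algebraMap_eq] at h2
          linear_combination h2
        rw [h3]
        exact add_mem (mul_mem (mul_mem (pow_mem h.δ_mem 4)
          (mul_mem (unit_mem W) h.inv_π'_mem)) (algebraMap_coe_mem_locInt q)) hm
      · exfalso
        set w := (δL : L) ^ (n + 1 + 4) * l with hw
        -- The trace of `w / π` is integral, while that of `w` is not divisible by `π`.
        have h3 : w * algebraMap E L (π : E)⁻¹ = l * ((δL : L) ^ n *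
            (algebraMap E L π' * (algebraMap M L (W : 𝓞 M))⁻¹)) := by
          have h4 := unit_ne_zero (L := L) W
          have h5 := h.algebraMap_ne_zero'
          rw [hw, map_inv₀, h.algebraMap_eq, pow_add, pow_add]
          field_simp
        have h4 : Algebra.trace E L w * (π : E)⁻¹ ∈ locInt v E := by
          have h5 := hl _ (mul_mem (pow_mem h.δ_mem n)
            (mul_mem (algebraMap_coe_mem_locInt π') (unit_inv_mem W)))
          rwa [← h3, mul_comm, ← Algebra.smul_def, map_smul, smul_eq_mul, mul_comm] at h5
        have h5 := h.trace_sub_mem hσ (finrank_compositum hσ hL hM) (l := w) (n := (n₀ : E))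
          (k := 1) (h.mem_fracPow_one_iff.2 ⟨m, hm, by rw [h2]; ring⟩)
        obtain ⟨b, hb, h6⟩ := h.mem_fracPow_one_iff.1 h5
        have hπE : (π : E) ≠ 0 := (_root_.map_ne_zero (algebraMap E L)).1 hπ0
        refine h.five_mul_notMem hn₀ (h.mem_asIdeal_of_eq_mul (b := (δL : L) ^ 4 *
          (algebraMap M L (W : 𝓞 M) * (algebraMap E L π')⁻¹) *
            algebraMap E L (Algebra.trace E L w * (π : E)⁻¹) - b) (sub_mem (mul_mem (mul_mem
              (pow_mem h.δ_mem 4) (mul_mem (unit_mem W) h.inv_π'_mem))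
                (algebraMap_mem_locInt h4)) hb) ?_)
        have h7 : Algebra.trace E L w = π * (Algebra.trace E L w * (π : E)⁻¹) := by field_simp
        have h8 : ((5 * n₀ : 𝓞 E) : E) = 5 * n₀ := by
          rw [RingOfIntegers.val_mul]
          congr 1
        rw [map_sub] at h6
        have h9 := congrArg (algebraMap E L) h7
        rw [map_mul _ (π : E), h.algebraMap_eq] at h9
        rw [h8]
        linear_combination h9 - h6
  obtain ⟨r, hr, h1⟩ := exists_mul_mem_locInt v l
  obtain ⟨k, s, hs, rfl⟩ := exists_pow_mul_unit h.asIdeal_eq hr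
  rw [mem_fracPow, neg_neg, show (4 : ℤ) = (4 : ℕ) from rfl, zpow_natCast]
  refine key (5 * k) ?_
  have h2 : (δL : L) ^ (5 * k + 4) * l = (δL : L) ^ 4 *
      (algebraMap E L π' * (algebraMap M L (W : 𝓞 M))⁻¹) ^ k * algebraMap E L (s : E)⁻¹ *
      (algebraMap E L ((π ^ k * s : 𝓞 E) : E) * l) := by
    have h4 := unit_ne_zero (L := L) W
    have h5 := h.algebraMap_ne_zero'
    have h6 : algebraMap E L (s : E) ≠ 0 := by
      rw [_root_.map_ne_zero]; exact ne_zero_of_notMem hs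
    have h7 : (δL : L) ^ 5 = (algebraMap E L π' * (algebraMap M L (W : 𝓞 M))⁻¹) *
        algebraMap E L π := by
      rw [h.algebraMap_eq]
      field_simp
    rw [RingOfIntegers.val_mul, RingOfIntegers.val_pow, map_mul, map_pow, map_inv₀, pow_add,
      pow_mul, h7, mul_pow _ (algebraMap E L (π : E))]
    generalize algebraMap E L π' * (algebraMap M L (W : 𝓞 M))⁻¹ = t
    field_simp
  rw [h2]
  exact mul_mem (mul_mem (mul_mem (pow_mem h.δ_mem 4) (pow_mem (mul_mem
    (algebraMap_coe_mem_locInt π') (unit_inv_mem W)) k))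
      (algebraMap_mem_locInt (inv_coe_mem_locInt hs))) h1

/-- The congruence `σʲ(δ) ≡ ζʲ δ` modulo `δ²`. -/
theorem pow_apply_sub_mem (h : QuinticRamified σ v π π' δ W η p) {ζ : 𝓞 E} {m : L}
    (hm : m ∈ locInt v L) (hη : algebraMap M L (η : 𝓞 M) = algebraMap E L ζ + δL * m) (j : ℕ) :
    (σ ^ j) (δL : L) - δL * algebraMap E L ζ ^ j ∈ fracPow (locInt v L) (δL : L) 2 := by
  have hδ1 : (δL : L) ∈ fracPow (locInt v L) (δL : L) 1 :=
    h.mem_fracPow_one_iff.2 ⟨1, one_mem _, (mul_one _).symm⟩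
  induction j with
  | zero => simp
  | succ j ih =>
    have h1 : (σ ^ (j + 1)) (δL : L) - δL * algebraMap E L ζ ^ (j + 1) =
        σ ((σ ^ j) (δL : L) - δL * algebraMap E L ζ ^ j) +
          δL * (δL * m) * algebraMap E L ζ ^ j := by
      rw [map_sub, map_mul, map_pow, AlgEquiv.commutes, h.map_δ, hη, pow_succ', pow_succ',
        AlgEquiv.mul_apply]
      ring
    rw [h1]
    refine add_mem (h.map_mem ih) ?_
    have h2 := fracPow_mul_mem h.δ_ne_zero (fracPow_mul_mem h.δ_ne_zero hδ1
      (h.mem_fracPow_one_iff.2 ⟨m, hm, rfl⟩)) (mem_fracPow_zero.2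
        (pow_mem (algebraMap_coe_mem_locInt (L := L) (v := v) ζ) j))
    rwa [add_zero] at h2

theorem mem_asIdeal_of_δ_mul_mem (h : QuinticRamified σ v π π' δ W η p) {n : 𝓞 E}
    (hn : δL * algebraMap E L n ∈ fracPow (locInt v L) (δL : L) 2) : n ∈ v.asIdeal := by
  obtain ⟨b, hb, h1⟩ := (mem_fracPow_iff_exists h.δ_ne_zero).1 hn
  refine h.mem_asIdeal_of_eq_mul hb (mul_left_cancel₀ h.δ_ne_zero ?_)
  rw [h1, show (2 : ℤ) = (2 : ℕ) from rfl, zpow_natCast]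
  ring

theorem algebraMap_mem_fracPow_five (h : QuinticRamified σ v π π' δ W η p) {f : E}
    (hf : f ∈ locInt v E) : algebraMap E L (π * f) ∈ fracPow (locInt v L) (δL : L) 5 := by
  rw [mem_fracPow_iff_exists h.δ_ne_zero, map_mul, h.algebraMap_eq]
  refine ⟨algebraMap M L (W : 𝓞 M) * (algebraMap E L π')⁻¹ * algebraMap E L f,
    mul_mem (mul_mem (unit_mem W) h.inv_π'_mem) (algebraMap_mem_locInt hf), ?_⟩
  rw [mul_assoc, show (5 : ℤ) = (5 : ℕ) from rfl, zpow_natCast]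

/-- A place at which the compositum is totally ramified satisfies the local conditions for a cyclic
algebra with unit parameter `α ≡ b⁵`. -/
theorem exists_ramifiedAt [IsGalois ℚ M] (hσ : orderOf σ = 5)
    (hL : (algebraMap E L).fieldRange ⊔ (algebraMap M L).fieldRange = ⊤)
    (hM : Module.finrank ℚ M = 5) (h : QuinticRamified σ v π π' δ W η p)
    {D : Type*} [Ring D] [Algebra E D] (F : CyclicFrame σ D) (hα0 : F.α ≠ 0)
    (hα : F.α ∈ locInt v E) (hα' : F.α⁻¹ ∈ locInt v E) {b : 𝓞 E}
    (hb : ∃ f ∈ locInt v E, F.α - (b : E) ^ 5 = π * f) :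
    ∃ ζ c : 𝓞 E, F.RamifiedAt v π (δL : L) ζ c b := by
  have hLdeg := finrank_compositum hσ hL hM
  have hσ5 : σ ^ 5 = 1 := by rw [← hσ, pow_orderOf_eq_one]
  obtain ⟨ζ, m, hm, hζ⟩ := h.exists_residue hσ hL hM (unit_mem η)
  set ε := algebraMap E L π' * (algebraMap M L (W : 𝓞 M))⁻¹ with hε
  have hεmem : ε ∈ locInt v L := mul_mem (algebraMap_coe_mem_locInt π') (unit_inv_mem W)
  obtain ⟨c, m', hm', hc⟩ := h.exists_residue hσ hL hM hεmem
  have hδ1 : (δL : L) ∈ fracPow (locInt v L) (δL : L) 1 :=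
    h.mem_fracPow_one_iff.2 ⟨1, one_mem _, (mul_one _).symm⟩
  refine ⟨ζ, c, h.asIdeal_eq, h.δ_mem, ⟨ε, hεmem, mul_ne_zero h.algebraMap_ne_zero'
    (inv_ne_zero (unit_ne_zero W)), ?_, ?_, m', hm', hc⟩,
    ⟨_, unit_mem η, unit_ne_zero η, unit_inv_mem η, h.map_δ, m, hm, hζ⟩,
    fun l hl => h.exists_residue hσ hL hM hl,
    fun l hl => h.mem_fracPow_of_trace_mem hσ hL hM hl, ?_, hσ5, ?_, ?_, hα0, hα, hα', hb⟩
  · rw [hε, mul_inv, inv_inv]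
    exact mul_mem h.inv_π'_mem (unit_mem W)
  · have := unit_ne_zero (L := L) W
    rw [hε]
    field_simp
    exact h.pow_eq'
  · intro l hl
    have h1 := algebraMap_trace_eq_sum_pow hσ hLdeg l
    have h2 : ∀ j : ℕ, (σ ^ j) l = l := by
      intro j
      induction j with
      | zero => rfl
      | succ j ih => rw [pow_succ, AlgEquiv.mul_apply, hl, ih]
    simp only [h2, Finset.sum_const, Finset.card_fin, nsmul_eq_mul] at h1
    refine ⟨Algebra.trace E L l / 5, ?_⟩
    rw [map_div₀, h1, map_ofNat]
    norm_num
  -- `σ⁵ = 1` gives `ζ⁵ ≡ 1`.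
  · have h1 := h.pow_apply_sub_mem hm hζ 5
    rw [hσ5, AlgEquiv.one_apply] at h1
    apply h.mem_asIdeal_of_δ_mul_mem
    have h2 := neg_mem h1
    rw [RingOfIntegers.val_sub, RingOfIntegers.val_pow, map_sub, map_pow]
    rw [show ((1 : 𝓞 E) : E) = 1 from map_one _, map_one]
    convert h2 using 1
    ring
  · intro h1
    -- If `ζ ≡ 1`, the trace of `δ` is `5 δ` modulo `δ²`; but the order of an element of `E` is a
    -- multiple of `5`.
    have hpow : ∀ j : ℕ, (σ ^ j) (δL : L) - δL ∈ fracPow (locInt v L) (δL : L) 2 := by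
      intro j
      have h2 : ζ ^ j - 1 ∈ v.asIdeal := by
        rw [← Ideal.Quotient.eq_zero_iff_mem] at h1 ⊢
        rw [map_sub, map_one, sub_eq_zero] at h1 ⊢
        rw [map_pow, h1, one_pow]
      rw [h.asIdeal_eq, Ideal.mem_span_singleton] at h2
      obtain ⟨q, hq⟩ := h2
      have h3 : δL * algebraMap E L ζ ^ j - δL ∈ fracPow (locInt v L) (δL : L) 2 := by
        have h4 := fracPow_mul_mem h.δ_ne_zero hδ1
          (h.algebraMap_mem_fracPow_five (coe_mem_locInt (v := v) q))
        have h5 : δL * algebraMap E L (π * q) = δL * algebraMap E L ζ ^ j - (δL : L) := by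
          rw [← RingOfIntegers.val_mul, ← hq, RingOfIntegers.val_sub, RingOfIntegers.val_pow,
            map_sub, map_pow, show ((1 : 𝓞 E) : E) = 1 from map_one _, map_one]
          ring
        rw [h5] at h4
        exact fracPow_le h.δ_ne_zero h.δ_mem (by norm_num) h4
      have h4 := add_mem (h.pow_apply_sub_mem hm hζ j) h3
      rwa [sub_add_sub_cancel] at h4
    have h2 : algebraMap E L (Algebra.trace E L (δL : L)) - 5 * (δL : L) ∈
        fracPow (locInt v L) (δL : L) 2 := by
      have h3 : algebraMap E L (Algebra.trace E L (δL : L)) - 5 * (δL : L) =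
          ∑ j : Fin 5, ((σ ^ (j : ℕ)) (δL : L) - δL) := by
        rw [algebraMap_trace_eq_sum_pow hσ hLdeg, Finset.sum_sub_distrib, Finset.sum_const,
          Finset.card_fin, nsmul_eq_mul]
        norm_num
      rw [h3]
      exact sum_mem fun j _ => hpow j
    have h3 : algebraMap E L (Algebra.trace E L (δL : L)) ∈ fracPow (locInt v L) (δL : L) 1 := by
      have h4 := fracPow_mul_mem h.δ_ne_zero hδ1 (mem_fracPow_zero.2
        (ofNat_mem (locInt v L) 5))
      rw [add_zero] at h4
      have h5 := add_mem (fracPow_le h.δ_ne_zero h.δ_mem (by norm_num) h2 :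
        _ ∈ fracPow (locInt v L) (δL : L) 1) h4
      convert h5 using 1
      ring
    obtain ⟨b', hb', h4⟩ := h.mem_fracPow_one_iff.1 h3
    obtain ⟨f, hf, h5⟩ := h.exists_eq_mul_of_mem (trace_mem_locInt h.δ_mem) hb' h4
    have h6 := sub_mem (fracPow_le h.δ_ne_zero h.δ_mem (by norm_num)
      (h.algebraMap_mem_fracPow_five hf) : _ ∈ fracPow (locInt v L) (δL : L) 2) h2
    rw [h5] at h6
    refine h.five_notMem (h.mem_asIdeal_of_δ_mul_mem ?_)
    convert h6 using 1
    rw [show ((5 : 𝓞 E) : E) = 5 from map_ofNat (algebraMap (𝓞 E) E) 5, map_ofNat]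
    ring

end QuinticRamified

/-! ### Comparison of the lattices at a place -/

section ScaledInt

set_option linter.unusedSectionVars false

variable {E : Type*} (L : Type*) [Field E] [NumberField E] [Field L] [NumberField L] [Algebra E L]

/-- The multiples `c 𝓞_{L,v}` of the localization of `𝓞 L` at `v`, for `c ∈ Eˣ`. -/
def scaledInt (v : HeightOneSpectrum (𝓞 E)) (c : E) : AddSubgroup L :=
  fracPow (locInt v L) (algebraMap E L c) 1

variable {L} {v : HeightOneSpectrum (𝓞 E)} {c c' : E}

theorem mem_scaledInt (hc : c ≠ 0) {l : L} :
    l ∈ scaledInt L v c ↔ ∃ m ∈ locInt v L, l = algebraMap E L c * m := by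
  rw [scaledInt, mem_fracPow_iff_exists (by simpa using hc)]
  simp only [zpow_one]

theorem scaledInt_le (hc : c ≠ 0) (hc' : c' ≠ 0) (h : c / c' ∈ locInt v E) :
    scaledInt L v c ≤ scaledInt L v c' := by
  intro l hl
  obtain ⟨m, hm, rfl⟩ := (mem_scaledInt hc).1 hl
  refine (mem_scaledInt hc').2 ⟨_, mul_mem (algebraMap_mem_locInt h) hm, ?_⟩
  rw [← mul_assoc, ← map_mul, mul_div_cancel₀ _ hc']

theorem scaledInt_mul_unit {s : E} (hc : c ≠ 0) (hs0 : s ≠ 0) (hs : s ∈ locInt v E)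
    (hs' : s⁻¹ ∈ locInt v E) : scaledInt L v (c * s) = scaledInt L v c := by
  refine le_antisymm (scaledInt_le (mul_ne_zero hc hs0) hc ?_)
    (scaledInt_le hc (mul_ne_zero hc hs0) ?_)
  · rwa [mul_div_cancel_left₀ _ hc]
  · rwa [div_mul_cancel_left₀ hc]

theorem scaledInt_one : scaledInt L v (1 : E) = (locInt v L).toAddSubgroup := by
  ext l
  rw [mem_scaledInt one_ne_zero]
  simp

theorem scaledInt_unit {s : E} (hs0 : s ≠ 0) (hs : s ∈ locInt v E)
    (hs' : s⁻¹ ∈ locInt v E) : scaledInt L v s = (locInt v L).toAddSubgroup := by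
  rw [← scaledInt_one, ← scaledInt_mul_unit one_ne_zero hs0 hs hs', one_mul]

theorem algebraMap_mul_mem_scaledInt {l : L} (hl : l ∈ scaledInt L v c) {s : E}
    (hs : s ∈ locInt v E) : algebraMap E L s * l ∈ scaledInt L v c := by
  rw [scaledInt, mem_fracPow] at *
  rw [mul_left_comm]
  exact mul_mem (algebraMap_mem_locInt hs) hl

/-- Multiples of a power of `ϖ` in terms of the coefficient `c`. -/
theorem scaledInt_le_fracPow {ϖ : L} (h0 : ϖ ≠ 0) (hc : c ≠ 0) {k : ℤ}
    (h : algebraMap E L c ∈ fracPow (locInt v L) ϖ k) :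
    scaledInt L v c ≤ fracPow (locInt v L) ϖ k := by
  intro l hl
  obtain ⟨m, hm, rfl⟩ := (mem_scaledInt hc).1 hl
  simpa using fracPow_mul_mem h0 h (mem_fracPow_zero.2 hm)

end ScaledInt

theorem zpow_mem_locInt {E L : Type*} [Field E] [NumberField E] [Field L] [Algebra E L]
    {v : HeightOneSpectrum (𝓞 E)} {l : L} (hl : l ∈ locInt v L) (hl' : l⁻¹ ∈ locInt v L) (n : ℤ) :
    l ^ n ∈ locInt v L := by
  rcases Int.eq_nat_or_neg n with ⟨m, rfl | rfl⟩
  · rw [zpow_natCast]; exact pow_mem hl m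
  · rw [zpow_neg, zpow_natCast, ← inv_pow]; exact pow_mem hl' m

namespace CyclicFrame

set_option linter.unusedSectionVars false

variable {E L : Type*} [Field E] [NumberField E] [Field L] [NumberField L] [Algebra E L]
  {σ : L ≃ₐ[E] L} {D : Type*} [Ring D] [Algebra E D] {F : CyclicFrame σ D}
  {v : HeightOneSpectrum (𝓞 E)}

theorem sum_U_pow_eq (l : Fin 5 → L) : ∑ i : Fin 5, F.U ^ (i : ℕ) * F.ι (l i) =
    ∑ i : Fin 5, F.ι ((σ ^ (i : ℕ)) (l i)) * F.U ^ (i : ℕ) :=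
  Finset.sum_congr rfl fun i _ => F.pow_mul i (l i)

/-- The lattices in powers of the cyclic generator, in coordinates. -/
theorem mem_powerSum_U_iff {c : Fin 5 → E} (hc : ∀ i, c i ≠ 0) {z : D} :
    z ∈ F.powerSum F.U (fun i => scaledInt L v (c i)) ↔
      ∀ i, F.coord z i ∈ scaledInt L v (c i) := by
  have hmap : ∀ (τ : L ≃ₐ[E] L) (i : Fin 5) (l : L), l ∈ scaledInt L v (c i) →
      τ l ∈ scaledInt L v (c i) := by
    intro τ i l hl
    obtain ⟨m, hm, rfl⟩ := (mem_scaledInt (hc i)).1 hl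
    exact (mem_scaledInt (hc i)).2 ⟨_, map_mem_locInt τ hm, by rw [map_mul, AlgEquiv.commutes]⟩
  constructor
  · rintro ⟨l, hl, rfl⟩ i
    rw [sum_U_pow_eq, F.coord_sum]
    exact hmap _ _ _ (hl i)
  · intro h
    refine ⟨fun i => (σ ^ (i : ℕ)).symm (F.coord z i), fun i => hmap _ _ _ (h i), ?_⟩
    rw [sum_U_pow_eq]
    conv_lhs => rw [← F.sum_coord z]
    exact Finset.sum_congr rfl fun i _ => by rw [AlgEquiv.apply_symm_apply]

variable (F) in
/-- The sums `∑_{j ≤ k} Xʲ bᵏ⁻ʲ lⱼ` with `lⱼ` in the localization of `𝓞 L` at `v`, as iterated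
Horner schemes. -/
def hornerSet (v : HeightOneSpectrum (𝓞 E)) (b : E) (X : D) : ℕ → Set D
  | 0 => {z | ∃ l ∈ locInt v L, z = F.ι l}
  | k + 1 => {z | ∃ w ∈ hornerSet v b X k, ∃ l ∈ locInt v L,
      z = X * w + F.ι (algebraMap E L b ^ (k + 1) * l)}

section Horner

variable {b : E} {X Y : D}

theorem add_mem_hornerSet {k : ℕ} {z w : D} (hz : z ∈ F.hornerSet v b X k)
    (hw : w ∈ F.hornerSet v b X k) : z + w ∈ F.hornerSet v b X k := by
  induction k generalizing z w with
  | zero =>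
    obtain ⟨l, hl, rfl⟩ := hz
    obtain ⟨m, hm, rfl⟩ := hw
    exact ⟨l + m, add_mem hl hm, by rw [map_add]⟩
  | succ k ih =>
    obtain ⟨z', hz', l, hl, rfl⟩ := hz
    obtain ⟨w', hw', m, hm, rfl⟩ := hw
    exact ⟨z' + w', ih hz' hw', l + m, add_mem hl hm, by
      rw [mul_add X, mul_add _ l, map_add]; abel⟩

theorem mul_mem_hornerSet_succ {k : ℕ} {z : D} (hz : z ∈ F.hornerSet v b X k) :
    X * z ∈ F.hornerSet v b X (k + 1) :=
  ⟨z, hz, 0, zero_mem _, by simp⟩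

theorem algebraMap_mul_mem_hornerSet_succ {k : ℕ} {z : D} (hz : z ∈ F.hornerSet v b X k) :
    F.ι (algebraMap E L b) * z ∈ F.hornerSet v b X (k + 1) := by
  induction k generalizing z with
  | zero =>
    obtain ⟨l, hl, rfl⟩ := hz
    exact ⟨0, ⟨0, zero_mem _, by simp⟩, l, hl, by simp⟩
  | succ k ih =>
    obtain ⟨w, hw, l, hl, rfl⟩ := hz
    refine ⟨_, ih hw, l, hl, ?_⟩
    rw [mul_add, ← map_mul, pow_succ' _ (k + 1), mul_assoc (algebraMap E L b), F.ι.commutes,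
      Algebra.left_comm]

/-- If `l X ∈ X 𝓞 + b 𝓞` for all `l ∈ 𝓞`, the Horner sets are stable under multiplication by `𝓞`
from the left. -/
theorem ι_mul_mem_hornerSet
    (hX : ∀ l ∈ locInt v L, ∃ m ∈ locInt v L, ∃ n ∈ locInt v L,
      F.ι l * X = X * F.ι m + F.ι (algebraMap E L b) * F.ι n)
    {k : ℕ} {l : L} (hl : l ∈ locInt v L) {z : D} (hz : z ∈ F.hornerSet v b X k) :
    F.ι l * z ∈ F.hornerSet v b X k := by
  induction k generalizing l z with
  | zero =>
    obtain ⟨m, hm, rfl⟩ := hz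
    exact ⟨_, mul_mem hl hm, by rw [map_mul]⟩
  | succ k ih =>
    obtain ⟨w, hw, r, hr, rfl⟩ := hz
    obtain ⟨m, hm, n, hn, h⟩ := hX l hl
    have h1 : F.ι l * (X * w + F.ι (algebraMap E L b ^ (k + 1) * r)) =
        X * (F.ι m * w) + F.ι (algebraMap E L b) * (F.ι n * w) +
          F.ι (algebraMap E L b ^ (k + 1) * (l * r)) := by
      rw [mul_add, ← mul_assoc, h, mul_left_comm, map_mul F.ι l]
      noncomm_ring
    rw [h1]
    refine add_mem_hornerSet (add_mem_hornerSet (mul_mem_hornerSet_succ (ih hm hw))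
      (algebraMap_mul_mem_hornerSet_succ (ih hn hw))) ?_
    refine ⟨0, ?_, _, mul_mem hl hr, by simp⟩
    clear * -
    induction k with
    | zero => exact ⟨0, zero_mem _, by simp⟩
    | succ k ih => exact ⟨0, ih, 0, zero_mem _, by simp⟩

theorem pow_mul_mem_hornerSet
    (hX : ∀ l ∈ locInt v L, ∃ m ∈ locInt v L, ∃ n ∈ locInt v L,
      F.ι l * X = X * F.ι m + F.ι (algebraMap E L b) * F.ι n)
    {m₁ m₀ : L} (h₁ : m₁ ∈ locInt v L) (h₀ : m₀ ∈ locInt v L)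
    (hY : Y = X * F.ι m₁ + F.ι (algebraMap E L b) * F.ι m₀)
    (k : ℕ) {l : L} (hl : l ∈ locInt v L) : Y ^ k * F.ι l ∈ F.hornerSet v b X k := by
  induction k with
  | zero => exact ⟨l, hl, by simp⟩
  | succ k ih =>
    have h2 : Y ^ (k + 1) * F.ι l = X * (F.ι m₁ * (Y ^ k * F.ι l)) +
        F.ι (algebraMap E L b) * (F.ι m₀ * (Y ^ k * F.ι l)) := by
      rw [pow_succ', mul_assoc]
      nth_rw 1 [hY]
      noncomm_ring
    rw [h2]
    exact add_mem_hornerSet (mul_mem_hornerSet_succ (ι_mul_mem_hornerSet hX h₁ ih))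
      (algebraMap_mul_mem_hornerSet_succ (ι_mul_mem_hornerSet hX h₀ ih))

theorem exists_sum_of_mem_hornerSet {k : ℕ} {z : D} (hz : z ∈ F.hornerSet v b X k) :
    ∃ l : ℕ → L, (∀ j, l j ∈ locInt v L) ∧
      z = ∑ j ∈ Finset.range (k + 1), X ^ j * F.ι (algebraMap E L b ^ (k - j) * l j) := by
  induction k generalizing z with
  | zero =>
    obtain ⟨l, hl, rfl⟩ := hz
    exact ⟨fun _ => l, fun _ => hl, by simp⟩
  | succ k ih =>
    obtain ⟨w, hw, m, hm, rfl⟩ := hz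
    obtain ⟨l, hl, rfl⟩ := ih hw
    refine ⟨fun j => if j = 0 then m else l (j - 1), fun j => ?_, ?_⟩
    · dsimp only
      split_ifs
      · exact hm
      · exact hl _
    · rw [Finset.sum_range_succ' _ (k + 1), Finset.mul_sum]
      congr 1
      · refine Finset.sum_congr rfl fun j _ => ?_
        rw [← mul_assoc, ← pow_succ']
        simp
      · simp

variable {c : Fin 5 → E}

/-- The growth condition on the coefficients `cᵢ` makes the lattice `∑ Yⁱ cᵢ 𝓞` lie in
`∑ Xⁱ cᵢ 𝓞` when `Y ∈ X 𝓞 + b 𝓞`. -/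
theorem powerSum_scaledInt_le (hc0 : ∀ i, c i ≠ 0)
    (hc : ∀ j k : Fin 5, j ≤ k → c k * b ^ ((k : ℕ) - j) / c j ∈ locInt v E)
    (hX : ∀ l ∈ locInt v L, ∃ m ∈ locInt v L, ∃ n ∈ locInt v L,
      F.ι l * X = X * F.ι m + F.ι (algebraMap E L b) * F.ι n)
    {m₁ m₀ : L} (h₁ : m₁ ∈ locInt v L) (h₀ : m₀ ∈ locInt v L)
    (hY : Y = X * F.ι m₁ + F.ι (algebraMap E L b) * F.ι m₀) :
    F.powerSum Y (fun i => scaledInt L v (c i)) ≤ F.powerSum X (fun i => scaledInt L v (c i)) := by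
  refine powerSum_le fun k l hl => ?_
  obtain ⟨m, hm, rfl⟩ := (mem_scaledInt (hc0 k)).1 hl
  obtain ⟨w, hw, h⟩ := exists_sum_of_mem_hornerSet (pow_mul_mem_hornerSet hX h₁ h₀ hY k hm)
  have h1 : Y ^ (k : ℕ) * F.ι (algebraMap E L (c k) * m) =
      ∑ j ∈ Finset.range (k + 1),
        X ^ j * F.ι (algebraMap E L (c k) * (algebraMap E L b ^ ((k : ℕ) - j) * w j)) := by
    have h2 : Y ^ (k : ℕ) * F.ι (algebraMap E L (c k) * m) =
        Y ^ (k : ℕ) * F.ι m * F.ι (algebraMap E L (c k)) := by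
      rw [mul_comm, map_mul, mul_assoc]
    rw [h2, h, Finset.sum_mul]
    refine Finset.sum_congr rfl fun j _ => ?_
    rw [mul_comm (algebraMap E L (c k)), map_mul F.ι _ (algebraMap E L (c k)), mul_assoc]
  rw [h1]
  refine sum_mem fun j hj => ?_
  rw [Finset.mem_range] at hj
  have hk := k.isLt
  obtain ⟨i, rfl⟩ : ∃ i : Fin 5, (i : ℕ) = j := ⟨⟨j, by omega⟩, rfl⟩
  refine pow_mul_mem_powerSum X i ((mem_scaledInt (hc0 i)).2
    ⟨_, mul_mem (algebraMap_mem_locInt (hc i k (Fin.le_def.2 (by omega)))) (hw i), ?_⟩)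
  rw [← mul_assoc, ← mul_assoc, ← map_pow, ← map_mul, ← map_mul, mul_div_cancel₀ _ (hc0 i)]

/-- A change of the generator `U` into `U m₁ + b m₀`, with `m₁` a unit, does not change the lattice
`∑ Uⁱ cᵢ 𝓞`. -/
theorem powerSum_scaledInt_eq (hc0 : ∀ i, c i ≠ 0)
    (hc : ∀ j k : Fin 5, j ≤ k → c k * b ^ ((k : ℕ) - j) / c j ∈ locInt v E)
    {m₁ m₀ : L} (h₁0 : m₁ ≠ 0) (h₁ : m₁ ∈ locInt v L) (h₁' : m₁⁻¹ ∈ locInt v L)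
    (h₀ : m₀ ∈ locInt v L)
    (hY : Y = F.U * F.ι m₁ + F.ι (algebraMap E L b) * F.ι m₀) :
    F.powerSum Y (fun i => scaledInt L v (c i)) =
      F.powerSum F.U (fun i => scaledInt L v (c i)) := by
  have hU : ∀ l, F.ι l * F.U = F.U * F.ι (σ.symm l) := by
    intro l
    rw [F.U_mul, AlgEquiv.apply_symm_apply]
  refine le_antisymm (powerSum_scaledInt_le hc0 hc (fun l hl => ⟨_, map_mem_locInt σ.symm hl,
    0, zero_mem _, by rw [hU]; simp⟩) h₁ h₀ hY) ?_
  -- For the reverse inclusion, `U = Y m₁⁻¹ - b m₀ m₁⁻¹`, and the commutation rule of `Y` follows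
  -- from that of `U`.
  refine powerSum_scaledInt_le hc0 hc (fun l hl => ⟨_, map_mem_locInt σ.symm hl,
    m₀ * (l - σ.symm l), mul_mem h₀ (sub_mem hl (map_mem_locInt σ.symm hl)), ?_⟩) h₁'
    (neg_mem (mul_mem h₀ h₁') : -(m₀ * m₁⁻¹) ∈ locInt v L) ?_
  · have h3 : F.ι m₁ * F.ι (σ.symm l) = F.ι (σ.symm l) * F.ι m₁ := by
      rw [← map_mul, mul_comm, map_mul]
    have h4 : F.ι m₀ * F.ι l = F.ι l * F.ι m₀ := by rw [← map_mul, mul_comm, map_mul]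
    have h5 : F.ι (algebraMap E L b) * F.ι l = F.ι l * F.ι (algebraMap E L b) := by
      rw [← map_mul, mul_comm, map_mul]
    rw [hY, mul_add, ← mul_assoc, hU, mul_assoc F.U, ← h3, add_mul, mul_assoc F.U, ← mul_assoc (F.ι l),
      ← h5, mul_assoc, ← h4, mul_assoc, mul_sub, map_sub, mul_sub, map_mul, map_mul]
    noncomm_ring
  · rw [hY, add_mul, mul_assoc, mul_assoc, ← map_mul, ← map_mul, mul_inv_cancel₀ h₁0]
    simp

end Horner

end CyclicFrame

theorem NumberField.RingOfIntegers.isScalarTower_of_algebra {E D : Type*} [Field E] [Ring D]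
    [Algebra E D] : IsScalarTower (𝓞 E) E D := inferInstance

namespace CyclicData

set_option linter.unusedSectionVars false

variable {E M L : Type*} [Field E] [NumberField E] [Field M] [NumberField M]
  [Field L] [NumberField L] [Algebra E L] [Algebra M L] (x : CyclicData E M L)

instance : IsScalarTower (𝓞 E) E x.D :=
  RingOfIntegers.isScalarTower_of_algebra

theorem algebraMap_smul_mem_powerSum {v : HeightOneSpectrum (𝓞 E)} {y : x.D} {c : Fin 5 → E}
    {z : x.D} (hz : z ∈ x.frame.powerSum y (fun i => scaledInt L v (c i))) {s : E}
    (hs : s ∈ locInt v E) : s • z ∈ x.frame.powerSum y (fun i => scaledInt L v (c i)) := by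
  obtain ⟨l, hl, rfl⟩ := hz
  refine ⟨fun i => algebraMap E L s * l i, fun i => algebraMap_mul_mem_scaledInt (hl i) hs, ?_⟩
  rw [Finset.smul_sum]
  refine Finset.sum_congr rfl fun i _ => ?_
  rw [map_mul, x.frame.ι.commutes, Algebra.left_comm, Algebra.smul_def]

/-- The localization of the lattice `∑ yⁱ cᵢ 𝓞_L`. -/
theorem mem_locAt_powerLattice {v : HeightOneSpectrum (𝓞 E)} {y : x.D} {c : Fin 5 → E}
    (hc : ∀ i, c i ≠ 0) {z : x.D} : z ∈ locAt v (x.powerLattice y c) ↔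
      z ∈ x.frame.powerSum y (fun i => scaledInt L v (c i)) := by
  constructor
  · rintro ⟨s, hs, hz⟩
    have h1 : ∀ w ∈ x.powerLattice y c,
        w ∈ x.frame.powerSum y (fun i => scaledInt L v (c i)) := by
      intro w hw
      induction hw using Submodule.span_induction with
      | mem w hw =>
        obtain ⟨i, l, rfl⟩ := hw
        exact CyclicFrame.pow_mul_mem_powerSum (F := x.frame) y i ((mem_scaledInt (hc i)).2
          ⟨_, mem_locInt_of_isIntegral l.isIntegral_coe, rfl⟩)
      | zero => exact zero_mem _
      | add w w' _ _ hw hw' => exact add_mem hw hw'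
      | smul r w _ hw =>
        rw [← algebraMap_smul E r w]
        exact x.algebraMap_smul_mem_powerSum hw (coe_mem_locInt r)
    have h2 := x.algebraMap_smul_mem_powerSum (h1 _ hz) (inv_coe_mem_locInt hs)
    rwa [← algebraMap_smul E s z, smul_smul, inv_mul_cancel₀ (ne_zero_of_notMem hs),
      one_smul] at h2
  · rintro ⟨l, hl, rfl⟩
    refine sum_mem fun i _ => ?_
    obtain ⟨m, ⟨s, hs, hm⟩, h⟩ := (mem_scaledInt (hc i)).1 (hl i)
    have h1 : (s : E) • (y ^ (i : ℕ) * x.ofL (l i)) =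
        y ^ (i : ℕ) * x.ofL (algebraMap E L (c i) * (algebraMap E L s * m)) := by
      rw [h, mul_left_comm, map_mul x.ofL (algebraMap E L s), x.ofL.commutes, Algebra.left_comm,
        Algebra.smul_def]
    refine ⟨s, hs, ?_⟩
    change (s : E) • (y ^ (i : ℕ) * x.ofL (l i)) ∈ _
    rw [h1]
    exact Submodule.subset_span ⟨i, ⟨_, hm⟩, rfl⟩

theorem powerLattice_fg (y : x.D) (c : Fin 5 → E) : (x.powerLattice y c).FG := by
  classical
  let B := RingOfIntegers.basis L
  let f : Fin 5 × Module.Free.ChooseBasisIndex ℤ (𝓞 L) → x.D := fun p =>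
    y ^ (p.1 : ℕ) * x.ofL (algebraMap E L (c p.1) * (B p.2 : L))
  refine ⟨Finset.univ.image f, le_antisymm ?_ ?_⟩
  · refine Submodule.span_mono ?_
    intro z hz
    obtain ⟨p, rfl⟩ : ∃ p, f p = z := by simpa using hz
    exact ⟨p.1, B p.2, rfl⟩
  · refine Submodule.span_le.2 ?_
    rintro _ ⟨i, l, rfl⟩
    have h1 : y ^ (i : ℕ) * x.ofL (algebraMap E L (c i) * (l : L)) =
        ∑ j, B.repr l j • f (i, j) := by
      conv_lhs => rw [← B.sum_repr l, RingOfIntegers.val_sum, Finset.mul_sum, map_sum,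
        Finset.mul_sum]
      refine Finset.sum_congr rfl fun j _ => ?_
      rw [zsmul_eq_mul, RingOfIntegers.val_mul, RingOfIntegers.val_intCast, zsmul_eq_mul,
        mul_left_comm, map_mul, map_intCast, ← mul_assoc, ← mul_assoc, Int.cast_comm]
    rw [h1]
    refine sum_mem fun j _ => ?_
    rw [← Int.cast_smul_eq_zsmul (𝓞 E)]
    exact Submodule.smul_mem _ _ (Submodule.subset_span (by simp))

theorem span_powerLattice_u {c : Fin 5 → E} (hc : ∀ i, c i ≠ 0) :
    Submodule.span E (x.powerLattice x.u c : Set x.D) = ⊤ := by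
  rw [eq_top_iff]
  rintro z -
  obtain ⟨l, rfl⟩ := x.exists_eq_sum z
  refine sum_mem fun i _ => ?_
  have h1 : IsAlgebraic ℤ (l i) :=
    (IsFractionRing.isAlgebraic_iff ℤ ℚ L).2 (Algebra.IsAlgebraic.isAlgebraic (l i))
  obtain ⟨r, hr, h⟩ := h1.exists_integral_multiple
  obtain ⟨m, hm⟩ : ∃ m : 𝓞 L, (m : L) = r • l i := ⟨⟨_, h⟩, rfl⟩
  have h3 : l i = algebraMap E L ((r : E)⁻¹ * (c i)⁻¹) * (algebraMap E L (c i) * m) := by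
    have h4 : (r : L) ≠ 0 := by exact_mod_cast hr
    have h5 : algebraMap E L (c i) ≠ 0 := by simpa using hc i
    rw [hm, zsmul_eq_mul, map_mul, map_inv₀, map_inv₀, map_intCast]
    field_simp
  have h2 : x.u ^ (i : ℕ) * x.ofL (l i) = ((r : E)⁻¹ * (c i)⁻¹) •
      (x.u ^ (i : ℕ) * x.ofL (algebraMap E L (c i) * m)) := by
    conv_lhs => rw [h3, map_mul, x.ofL.commutes, Algebra.left_comm, ← Algebra.smul_def]
  rw [h2]
  exact Submodule.smul_mem _ _ (Submodule.subset_span (Submodule.subset_span ⟨i, m, rfl⟩))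

instance : FiniteDimensional E x.D := by
  have : FiniteDimensional E L := Module.Finite.of_restrictScalars_finite ℚ E L
  infer_instance

end CyclicData

/-! ### Local units and the coefficients of the lattices -/

section LocUnit

variable {E L : Type*} [Field E] [NumberField E] [Field L] [Algebra E L]

/-- The units of the localization of `𝓞 L` at the place `v` of `E`. -/
structure IsLocUnit (v : HeightOneSpectrum (𝓞 E)) (s : L) : Prop where
  ne_zero : s ≠ 0
  mem : s ∈ locInt v L
  inv_mem : s⁻¹ ∈ locInt v L

namespace IsLocUnit

variable {v : HeightOneSpectrum (𝓞 E)}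

theorem one : IsLocUnit v (1 : L) := ⟨one_ne_zero, one_mem _, by simp⟩

theorem inv {s : L} (hs : IsLocUnit v s) : IsLocUnit v s⁻¹ :=
  ⟨inv_ne_zero hs.ne_zero, hs.inv_mem, by rw [inv_inv]; exact hs.mem⟩

theorem mul {s t : L} (hs : IsLocUnit v s) (ht : IsLocUnit v t) : IsLocUnit v (s * t) :=
  ⟨mul_ne_zero hs.ne_zero ht.ne_zero, mul_mem hs.mem ht.mem, by
    rw [mul_inv]; exact mul_mem hs.inv_mem ht.inv_mem⟩

theorem div {s t : L} (hs : IsLocUnit v s) (ht : IsLocUnit v t) : IsLocUnit v (s / t) := by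
  rw [div_eq_mul_inv]
  exact hs.mul ht.inv

theorem zpow {s : L} (hs : IsLocUnit v s) (n : ℤ) : IsLocUnit v (s ^ n) :=
  ⟨zpow_ne_zero n hs.ne_zero, zpow_mem_locInt hs.mem hs.inv_mem n, by
    rw [← inv_zpow]; exact zpow_mem_locInt hs.inv_mem (by rw [inv_inv]; exact hs.mem) n⟩

theorem pow {s : L} (hs : IsLocUnit v s) (n : ℕ) : IsLocUnit v (s ^ n) := by
  rw [← zpow_natCast]
  exact hs.zpow n

theorem neg {s : L} (hs : IsLocUnit v s) : IsLocUnit v (-s) :=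
  ⟨neg_ne_zero.2 hs.ne_zero, neg_mem hs.mem, by rw [inv_neg]; exact neg_mem hs.inv_mem⟩

theorem of_notMem {s : 𝓞 E} (hs : s ∉ v.asIdeal) : IsLocUnit v (s : E) :=
  ⟨ne_zero_of_notMem hs, coe_mem_locInt s, inv_coe_mem_locInt hs⟩

theorem algebraMap {s : E} (hs : IsLocUnit v s) : IsLocUnit v (algebraMap E L s) :=
  ⟨by simpa using hs.ne_zero, algebraMap_mem_locInt hs.mem, by
    rw [← map_inv₀]; exact algebraMap_mem_locInt hs.inv_mem⟩

/-- A divisor of a unit is a unit. -/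
theorem of_mul {s t : L} (hs : s ∈ locInt v L) (ht : t ∈ locInt v L) (h : IsLocUnit v (s * t)) :
    IsLocUnit v s := by
  have hs0 := left_ne_zero_of_mul h.ne_zero
  have ht0 := right_ne_zero_of_mul h.ne_zero
  refine ⟨hs0, hs, ?_⟩
  have := mul_mem ht h.inv_mem
  rwa [show t * (s * t)⁻¹ = s⁻¹ by field_simp] at this

end IsLocUnit

end LocUnit

theorem Rat.ceil_natCast_div_five (n : ℕ) : ⌈(n : ℚ) / 5⌉ = ((n : ℤ) + 4) / 5 := by
  have := Rat.ceil_natCast_div_natCast n 5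
  rw [Nat.cast_ofNat] at this
  rw [this]
  push_cast
  omega

theorem Rat.ceil_neg_natCast_div_five (n : ℕ) : ⌈-((n : ℚ) / 5)⌉ = -((n : ℤ) / 5) := by
  have := Rat.floor_natCast_div_natCast n 5
  rw [Nat.cast_ofNat] at this
  rw [Int.ceil_neg, this]
  push_cast
  rfl

namespace CyclicData

set_option linter.unusedSectionVars false

variable {E M L : Type*} [Field E] [NumberField E] [Field M] [NumberField M]
  [Field L] [NumberField L] [Algebra E L] [Algebra M L] (x : CyclicData E M L)

/-- The conditions on the parameters under which the lattices are orders: those on the fields, on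
the elements `ρ`, `δ`, `b` and on the exponents. -/
structure Admissible (p₀ : ℕ) : Prop where
  prime : p₀.Prime
  ne_two : p₀ ≠ 2
  split : p₀ % 7 = 1 ∨ p₀ % 7 = 2 ∨ p₀ % 7 = 4
  finrank_E : Module.finrank ℚ E = 2
  sqrt : x.sqrtNegSeven ^ 2 = -7
  galois : IsGalois ℚ M
  finrank_M : Module.finrank ℚ M = 5
  discr_eq : discr M = (p₀ : ℤ) ^ 4
  inert : (Ideal.span {(2 : 𝓞 M)}).IsPrime
  sup_eq : (algebraMap E L).fieldRange ⊔ (algebraMap M L).fieldRange = ⊤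
  conj_ne : x.conj ≠ 1
  ρ_mul : x.ρ * x.ρbar = (p₀ : 𝓞 E)
  norm_δ : Algebra.norm ℚ (x.δ : M) = (p₀ : ℚ)
  e_pos : 0 < x.e
  e_lt : x.e < 5
  two_dvd : (2 : 𝓞 E) ∣ x.b
  congr_ρbar : CongrMod x.ρbar ((x.b : E) ^ 5) ((p₀ : E) ^ (x.d * x.e) * x.a)
  congr_ρ : CongrMod x.ρ ((x.b : E) ^ 5) (((p₀ : E) ^ (x.d * x.e))⁻¹ * x.a)

theorem c₂_eq (i : Fin 5) : x.c₂ i =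
    x.ρ₂bar ^ ((((x.e * i : ℕ) : ℤ) + 4) / 5) * x.ρ₂ ^ (-(((x.e * i : ℕ) : ℤ) / 5)) := by
  rw [c₂, Rat.ceil_natCast_div_five, Rat.ceil_neg_natCast_div_five]

namespace Admissible

variable {x} {p₀ : ℕ} {v : HeightOneSpectrum (𝓞 E)}

theorem ρ₂_mul (h : x.Admissible p₀) : x.ρ₂ * x.ρ₂bar = 2 := by
  rw [ρ₂, ρ₂bar]
  linear_combination (-1 / 4) * h.sqrt

theorem ρ₂_ne_zero (h : x.Admissible p₀) : x.ρ₂ ≠ 0 := by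
  intro h0
  have := h.ρ₂_mul
  rw [h0, zero_mul] at this
  exact two_ne_zero this.symm

theorem ρ₂bar_ne_zero (h : x.Admissible p₀) : x.ρ₂bar ≠ 0 := by
  intro h0
  have := h.ρ₂_mul
  rw [h0, mul_zero] at this
  exact two_ne_zero this.symm

theorem coe_ρ_mul (h : x.Admissible p₀) : (x.ρ : E) * x.ρbar = p₀ := by
  rw [← RingOfIntegers.val_mul, h.ρ_mul, RingOfIntegers.val_natCast]

theorem natCast_ne_zero (h : x.Admissible p₀) : (p₀ : E) ≠ 0 := by exact_mod_cast h.prime.ne_zero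

theorem ρ_ne_zero (h : x.Admissible p₀) : (x.ρ : E) ≠ 0 := by
  intro h0
  have := h.coe_ρ_mul
  rw [h0, zero_mul] at this
  exact h.natCast_ne_zero this.symm

theorem ρbar_ne_zero (h : x.Admissible p₀) : (x.ρbar : E) ≠ 0 := by
  intro h0
  have := h.coe_ρ_mul
  rw [h0, mul_zero] at this
  exact h.natCast_ne_zero this.symm

theorem c₂_ne_zero (h : x.Admissible p₀) (i : Fin 5) : x.c₂ i ≠ 0 :=
  mul_ne_zero (zpow_ne_zero _ h.ρ₂bar_ne_zero) (zpow_ne_zero _ h.ρ₂_ne_zero)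

theorem coprime (h : x.Admissible p₀) : Nat.Coprime p₀ 28 := by
  rw [Nat.Prime.coprime_iff_not_dvd h.prime]
  intro h1
  rw [show 28 = 2 * 2 * 7 by norm_num, h.prime.dvd_mul, h.prime.dvd_mul,
    Nat.prime_dvd_prime_iff_eq h.prime Nat.prime_two, or_self,
    Nat.prime_dvd_prime_iff_eq h.prime (by norm_num)] at h1
  rcases h1 with h1 | h1
  · exact h.ne_two h1
  · have := h.split
    subst h1
    omega

theorem coprime_five (h : x.Admissible p₀) : Nat.Coprime p₀ 5 := by
  rw [Nat.coprime_primes h.prime (by norm_num)]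
  rintro rfl
  have := h.split
  omega

/-- The growth of the coefficients `c₂ i`: as `b` is divisible by `2 = ρ₂ ρ̄₂`, the quotients
`c₂ k bᵏ⁻ʲ / c₂ j` are integral for `j ≤ k`. -/
theorem c₂_mul_pow_div_mem (h : x.Admissible p₀) (v : HeightOneSpectrum (𝓞 E)) (j k : Fin 5)
    (hjk : j ≤ k) : x.c₂ k * (x.b : E) ^ ((k : ℕ) - j) / x.c₂ j ∈ locInt v E := by
  obtain ⟨r, r', hr, hr', -⟩ := x.exists_ρ₂_int h.finrank_E h.sqrt h.conj_ne
  obtain ⟨b', hb⟩ := h.two_dvd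
  obtain ⟨n, hn⟩ := Nat.exists_eq_add_of_le (Fin.le_def.1 hjk)
  have h1 := h.ρ₂_ne_zero
  have h2 := h.ρ₂bar_ne_zero
  have he := h.e_lt
  -- The exponent `⌈e i / 5⌉` of `ρ̄₂` increases with `i`, and the exponent `-⌊e i / 5⌋` of `ρ₂`
  -- decreases by at most one at each step, since `e < 5`.
  obtain ⟨A, hA⟩ : ∃ A : ℕ, (((x.e * k : ℕ) : ℤ) + 4) / 5 = (((x.e * j : ℕ) : ℤ) + 4) / 5 + A := by
    have : x.e * (j : ℕ) ≤ x.e * k := Nat.mul_le_mul_left _ (Fin.le_def.1 hjk)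
    refine ⟨((((x.e * k : ℕ) : ℤ) + 4) / 5 - (((x.e * j : ℕ) : ℤ) + 4) / 5).toNat, ?_⟩
    omega
  obtain ⟨B, hB⟩ : ∃ B : ℕ, -(((x.e * k : ℕ) : ℤ) / 5) + n = -(((x.e * j : ℕ) : ℤ) / 5) + B := by
    have h3 : x.e * (k : ℕ) ≤ x.e * j + 4 * n := by
      rw [hn, mul_add]
      gcongr
      omega
    refine ⟨(-(((x.e * k : ℕ) : ℤ) / 5) + n + (((x.e * j : ℕ) : ℤ) / 5)).toNat, ?_⟩
    omega
  have h3 : x.c₂ k * (x.b : E) ^ ((k : ℕ) - j) / x.c₂ j =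
      x.ρ₂bar ^ A * x.ρ₂ ^ B * x.ρ₂bar ^ n * (b' : E) ^ n := by
    rw [div_eq_iff (h.c₂_ne_zero j), hn, Nat.add_sub_cancel_left, hb, RingOfIntegers.val_mul,
      RingOfIntegers.val_two, ← h.ρ₂_mul, c₂_eq, c₂_eq, hA, zpow_add₀ h2, mul_pow, mul_pow]
    have h4 : x.ρ₂ ^ (-(((x.e * k : ℕ) : ℤ) / 5)) * x.ρ₂ ^ n =
        x.ρ₂ ^ (-(((x.e * j : ℕ) : ℤ) / 5)) * x.ρ₂ ^ B := by
      rw [← zpow_natCast, ← zpow_natCast, ← zpow_add₀ h1, ← zpow_add₀ h1, hB]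
    rw [zpow_natCast]
    linear_combination x.ρ₂bar ^ ((((x.e * j : ℕ) : ℤ) + 4) / 5) * x.ρ₂bar ^ A * x.ρ₂bar ^ n *
      (b' : E) ^ n * h4
  rw [h3, ← hr, ← hr']
  exact mul_mem (mul_mem (mul_mem (pow_mem (coe_mem_locInt _) _) (pow_mem (coe_mem_locInt _) _))
    (pow_mem (coe_mem_locInt _) _)) (pow_mem (coe_mem_locInt _) _)

theorem isLocUnit_ρ₂ (h : x.Admissible p₀) (hv : (2 : 𝓞 E) ∉ v.asIdeal) :
    IsLocUnit v x.ρ₂ ∧ IsLocUnit v x.ρ₂bar := by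
  obtain ⟨r, r', hr, hr', hmul, -⟩ := x.exists_ρ₂_int h.finrank_E h.sqrt h.conj_ne
  rw [← hr, ← hr']
  constructor
  · exact .of_notMem fun h1 => hv (hmul ▸ Ideal.mul_mem_right _ _ h1)
  · exact .of_notMem fun h1 => hv (hmul ▸ Ideal.mul_mem_left _ _ h1)

theorem isLocUnit_ρ (h : x.Admissible p₀) (hv : (p₀ : 𝓞 E) ∉ v.asIdeal) :
    IsLocUnit v (x.ρ : E) ∧ IsLocUnit v (x.ρbar : E) := by
  rw [← h.ρ_mul] at hv
  exact ⟨.of_notMem fun h1 => hv (Ideal.mul_mem_right _ _ h1),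
    .of_notMem fun h1 => hv (Ideal.mul_mem_left _ _ h1)⟩

theorem isLocUnit_c₂ (h : x.Admissible p₀) (hv : (2 : 𝓞 E) ∉ v.asIdeal) (i : Fin 5) :
    IsLocUnit v (x.c₂ i) :=
  ((h.isLocUnit_ρ₂ hv).2.zpow _).mul ((h.isLocUnit_ρ₂ hv).1.zpow _)

theorem orderOf_restrict_data (h : x.Admissible p₀) : ∃ (τ : M ≃ₐ[ℚ] M), orderOf τ = 5 ∧
    ∀ m, algebraMap M L (τ m) = x.σ (algebraMap M L m) := by
  have := h.galois
  exact exists_restrict x.orderOf_σ h.sup_eq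

theorem dvd_discr (h : x.Admissible p₀) : (p₀ : ℤ) ∣ discr M := by
  rw [h.discr_eq]
  exact dvd_pow_self _ (by norm_num)

/-- `p₀` is totally ramified in `M`. -/
theorem exists_δ_pow_mul (h : x.Admissible p₀) :
    ∃ W : (𝓞 M)ˣ, x.δ ^ 5 * (W : 𝓞 M) = (p₀ : 𝓞 M) := by
  have := h.galois
  obtain ⟨τ, hτ, -⟩ := h.orderOf_restrict_data
  exact associated_pow_five_of_dvd_discr h.finrank_M hτ h.prime h.dvd_discr h.norm_δ

theorem exists_map_δ (h : x.Admissible p₀) :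
    ∃ η : (𝓞 M)ˣ, x.σ x.δL = x.δL * algebraMap M L (η : 𝓞 M) := by
  have := h.galois
  obtain ⟨τ, hτ, h1⟩ := h.orderOf_restrict_data
  obtain ⟨η, h2⟩ := (associated_map_of_dvd_discr h.finrank_M hτ h.prime h.dvd_discr h.norm_δ).symm
  refine ⟨η, ?_⟩
  rw [δL, ← h1, ← map_mul, ← RingOfIntegers.val_mul, h2]
  rfl

theorem δL_ne_zero (h : x.Admissible p₀) : x.δL ≠ 0 := by
  intro h0
  rw [δL, map_eq_zero] at h0
  have := h.norm_δ
  rw [h0, Algebra.norm_zero] at this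
  exact h.prime.ne_zero (by exact_mod_cast this.symm)

theorem isLocUnit_δL (h : x.Admissible p₀) (hv : (p₀ : 𝓞 E) ∉ v.asIdeal) :
    IsLocUnit v x.δL := by
  obtain ⟨W, hW⟩ := h.exists_δ_pow_mul
  -- `δ` divides `p₀`.
  have h1 : x.δL * (x.δL ^ 4 * algebraMap M L (W : 𝓞 M)) = algebraMap E L (p₀ : 𝓞 E) := by
    have h2 := congrArg (fun t : 𝓞 M => algebraMap M L (t : M)) hW
    simp only [map_mul, map_pow, map_natCast] at h2
    rw [RingOfIntegers.val_natCast, map_natCast, ← h2, δL]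
    ring
  refine IsLocUnit.of_mul (t := x.δL ^ 4 * algebraMap M L (W : 𝓞 M))
    (algebraMap_integer_mem_locInt _) (mul_mem (pow_mem
    (algebraMap_integer_mem_locInt _) 4) (algebraMap_integer_mem_locInt _)) ?_
  rw [h1]
  exact (IsLocUnit.of_notMem hv).algebraMap

theorem finrank_L (h : x.Admissible p₀) : Module.finrank E L = 5 := by
  have := h.galois
  exact finrank_compositum x.orderOf_σ h.sup_eq h.finrank_M

end Admissible

end CyclicData

/-! ### The places not dividing `p₀` -/

namespace CyclicData

set_option linter.unusedSectionVars false

variable {E M L : Type*} [Field E] [NumberField E] [Field M] [NumberField M]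
  [Field L] [NumberField L] [Algebra E L] [Algebra M L] {x : CyclicData E M L}

namespace Admissible

variable {p₀ : ℕ} {v : HeightOneSpectrum (𝓞 E)}

/-- A lattice in the powers of a generator `u m₁ + b m₀`, with `m₁` a unit at `v`, agrees at `v`
with `⨁ uⁱ c₂ᵢ 𝓞_L`. -/
theorem locAt_powerLattice_eq (h : x.Admissible p₀) {Y : x.D} {s : Fin 5 → E}
    (hs : ∀ i, IsLocUnit v (s i)) {m₁ m₀ : L} (h₁ : IsLocUnit v m₁) (h₀ : m₀ ∈ locInt v L)
    (hY : Y = x.u * x.ofL m₁ + x.ofL (algebraMap E L x.b) * x.ofL m₀) :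
    locAt v (x.powerLattice Y fun i => x.c₂ i * s i) = locAt v (x.powerLattice x.u x.c₂) := by
  ext z
  rw [x.mem_locAt_powerLattice fun i => mul_ne_zero (h.c₂_ne_zero i) (hs i).ne_zero,
    x.mem_locAt_powerLattice h.c₂_ne_zero]
  have h1 := CyclicFrame.powerSum_scaledInt_eq (F := x.frame) (v := v) h.c₂_ne_zero
    (h.c₂_mul_pow_div_mem v) h₁.ne_zero h₁.mem h₁.inv_mem h₀ hY
  have h2 : (fun i => scaledInt L v (x.c₂ i * s i)) = fun i => scaledInt L v (x.c₂ i) :=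
    funext fun i => scaledInt_mul_unit (h.c₂_ne_zero i) (hs i).ne_zero (hs i).mem (hs i).inv_mem
  rw [h2, h1]
  rfl

/-- At the places above `2`, the algebra is a division algebra with valuation ring `⨁ uⁱ c₂ᵢ 𝓞`. -/
theorem exists_inertAt (h : x.Admissible p₀) (hv : (2 : 𝓞 E) ∈ v.asIdeal) :
    ∃ (π : 𝓞 E) (ε : ℤ), x.frame.InertAt v π ε ∧
      ∀ z, z ∈ locAt v (x.powerLattice x.u x.c₂) ↔ x.frame.Level v π ε 0 z := by
  have := h.galois
  obtain ⟨r, r', hr, hr', hmul, hadd, hconj⟩ := x.exists_ρ₂_int h.finrank_E h.sqrt h.conj_ne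
  have hmul2 : r * x.conjInt r = (2 : ℕ) := by rw [hconj, hmul]; rfl
  have hmul2' : r' * x.conjInt r' = (2 : ℕ) := by
    rw [← hconj, x.conjInt_conjInt two_ne_zero hmul2, mul_comm, hmul2]
  have hp : (p₀ : 𝓞 E) ∉ v.asIdeal :=
    notMem_of_coprime v.isPrime ((Nat.coprime_primes Nat.prime_two h.prime).2 h.ne_two.symm)
      (by exact_mod_cast hv)
  have hdisc : (discr M : 𝓞 E) ∉ v.asIdeal := by
    rw [h.discr_eq]
    push_cast
    exact fun h1 => hp (v.isPrime.mem_of_pow_mem _ h1)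
  have hnot5 : ¬ (5 : ℤ) ∣ x.e := by
    have := h.e_pos
    have := h.e_lt
    omega
  have hρ := h.isLocUnit_ρ hp
  have hb0 := h.ρbar_ne_zero
  have h20 := h.ρ₂bar_ne_zero
  have h10 := h.ρ₂_ne_zero
  have hprime : ∀ π : 𝓞 E, π * x.conjInt π = (2 : ℕ) → v.asIdeal = Ideal.span {π} →
      ∀ l ∈ locInt v L, ∀ m ∈ locInt v L, l * m ∈ fracPow (locInt v L) (algebraMap E L π) 1 →
        l ∈ fracPow (locInt v L) (algebraMap E L π) 1 ∨
          m ∈ fracPow (locInt v L) (algebraMap E L π) 1 := by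
    intro π h1 hπ l hl m hm hlm
    refine prime_of_two_inert x.orderOf_σ h.sup_eq h.finrank_M h.inert hdisc hπ ?_ hv hl hm hlm
    rw [hπ]
    exact exists_int_sub_mem_of_absNorm Nat.prime_two (x.absNorm_span_of_mul_conjInt h.finrank_E h1)
  have hscaled : ∀ (π : 𝓞 E) (k : ℤ), scaledInt L v ((π : E) ^ k) =
      fracPow (locInt v L) (algebraMap E L π) k := by
    intro π k
    ext l
    rw [scaledInt, mem_fracPow, mem_fracPow, map_zpow₀, ← zpow_mul, mul_neg_one]
  have hnot : ∀ t t' : 𝓞 E, t + t' = 1 → t ∈ v.asIdeal → t' ∉ v.asIdeal := by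
    intro t t' h1 h2 h3
    exact HeightOneSpectrum.one_notMem v (h1 ▸ add_mem h2 h3)
  rcases x.asIdeal_eq_or_of_natCast_mem h.finrank_E Nat.prime_two hmul2
    (by exact_mod_cast hv) with hv1 | hv1
  · have hmem : r ∈ v.asIdeal := by rw [hv1]; exact Ideal.mem_span_singleton_self _
    have hunit : IsLocUnit v x.ρ₂bar := by
      rw [← hr']; exact .of_notMem (hnot r r' hadd hmem)
    refine ⟨r, x.e, ⟨hv1, hprime r hmul2 hv1, hnot5, ?_⟩, ?_⟩
    · have h1 := ((hρ.1.pow x.d).div (hunit.mul (hρ.2.pow x.d))).pow x.e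
      refine ⟨_, h1.ne_zero, h1.mem, h1.inv_mem, ?_⟩
      rw [frame_α, a, hr, zpow_natCast, ← mul_pow, mul_div_assoc]
    · intro z
      rw [x.mem_locAt_powerLattice h.c₂_ne_zero]
      refine (CyclicFrame.mem_powerSum_U_iff (F := x.frame) h.c₂_ne_zero).trans
        (forall_congr' fun i => ?_)
      have h2 := hunit.zpow ((((x.e * i : ℕ) : ℤ) + 4) / 5)
      rw [c₂_eq, mul_comm, scaledInt_mul_unit (zpow_ne_zero _ h10) h2.ne_zero h2.mem h2.inv_mem,
        ← hr, hscaled]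
      push_cast
      rw [sub_zero]
  · rw [hconj] at hv1
    have hmem : r' ∈ v.asIdeal := by rw [hv1]; exact Ideal.mem_span_singleton_self _
    have hunit : IsLocUnit v x.ρ₂ := by
      rw [← hr]; exact .of_notMem (hnot r' r (by rw [add_comm, hadd]) hmem)
    refine ⟨r', -x.e, ⟨hv1, hprime r' hmul2' hv1, by rwa [dvd_neg], ?_⟩, ?_⟩
    · have h1 := ((hunit.mul (hρ.1.pow x.d)).div (hρ.2.pow x.d)).pow x.e
      refine ⟨_, h1.ne_zero, h1.mem, h1.inv_mem, ?_⟩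
      rw [frame_α, a, hr', zpow_neg, zpow_natCast, ← inv_pow, ← mul_pow]
      congr 1
      field_simp
    · intro z
      rw [x.mem_locAt_powerLattice h.c₂_ne_zero]
      refine (CyclicFrame.mem_powerSum_U_iff (F := x.frame) h.c₂_ne_zero).trans
        (forall_congr' fun i => ?_)
      have h2 := hunit.zpow (-(((x.e * i : ℕ) : ℤ) / 5))
      rw [c₂_eq, scaledInt_mul_unit (zpow_ne_zero _ h20) h2.ne_zero h2.mem h2.inv_mem,
        ← hr', hscaled, show (((x.e * i : ℕ) : ℤ) + 4) / 5 = -((-(x.e : ℤ) * (i : ℕ) - 0) / 5) by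
          rw [neg_mul]; push_cast; omega]

theorem isLocallyMaximal_powerLattice_u (h : x.Admissible p₀) (hv : (p₀ : 𝓞 E) ∉ v.asIdeal) :
    IsLocallyMaximal v (x.powerLattice x.u x.c₂) := by
  by_cases h2 : (2 : 𝓞 E) ∈ v.asIdeal
  · obtain ⟨π, ε, h1, h3⟩ := h.exists_inertAt h2
    exact h1.isLocallyMaximal h3
  · have := h.galois
    have hρ := h.isLocUnit_ρ hv
    have hρ₂ := h.isLocUnit_ρ₂ h2
    have ha : IsLocUnit v x.a :=
      ((hρ₂.1.mul (hρ.1.pow x.d)).div (hρ₂.2.mul (hρ.2.pow x.d))).pow x.e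
    have hdisc : (discr M : 𝓞 E) ∉ v.asIdeal := by
      rw [h.discr_eq]
      push_cast
      exact fun h1 => hv (v.isPrime.mem_of_pow_mem _ h1)
    refine x.frame.isLocallyMaximal_of_unramified (fun l hl => mem_locInt_of_trace_mem
      x.orderOf_σ h.sup_eq h.finrank_M hdisc hl) ha.ne_zero ha.mem ha.inv_mem (fun z => ?_) ?_
    · rw [x.mem_locAt_powerLattice h.c₂_ne_zero]
      refine (CyclicFrame.mem_powerSum_U_iff (F := x.frame) h.c₂_ne_zero).trans
        (forall_congr' fun i => ?_)
      have h3 := h.isLocUnit_c₂ h2 i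
      rw [scaledInt_unit h3.ne_zero h3.mem h3.inv_mem]
      rfl
    · rintro Γ hone hmul ⟨r, hr, hb⟩ z hz
      exact x.trace_coord_mem_locInt h.finrank_L (x.powerLattice_fg _ _) hone hmul hr hb hz

/-- The local division algebra at a place above `2` shows that `D` is a division algebra. -/
theorem isUnit_of_ne_zero (h : x.Admissible p₀) {z : x.D} (hz : z ≠ 0) : IsUnit z := by
  obtain ⟨r, r', hr, hr', hmul, hadd, hconj⟩ := x.exists_ρ₂_int h.finrank_E h.sqrt h.conj_ne
  have hmul2 : r * x.conjInt r = (2 : ℕ) := by rw [hconj, hmul]; rfl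
  have hr0 : r ≠ 0 := by
    rintro rfl
    rw [zero_mul] at hmul
    exact two_ne_zero hmul.symm
  let v : HeightOneSpectrum (𝓞 E) :=
    ⟨Ideal.span {r}, x.isPrime_span_of_mul_conjInt h.finrank_E Nat.prime_two hmul2,
      by rwa [Ne, Ideal.span_singleton_eq_bot]⟩
  have hv : (2 : 𝓞 E) ∈ v.asIdeal := by
    rw [← hmul]
    exact Ideal.mul_mem_right _ _ (Ideal.mem_span_singleton_self r)
  obtain ⟨π, ε, h1, -⟩ := h.exists_inertAt hv
  exact h1.isUnit hz

theorem isLocUnit_δL_pow_div (h : x.Admissible p₀) (hv : (p₀ : 𝓞 E) ∉ v.asIdeal) {π : 𝓞 E}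
    (hπ : IsLocUnit v (π : E)) : IsLocUnit v (x.δL ^ 4 / algebraMap E L π) :=
  ((h.isLocUnit_δL hv).pow 4).div hπ.algebraMap

theorem locAt_Λ (h : x.Admissible p₀) (hv : (p₀ : 𝓞 E) ∉ v.asIdeal) :
    locAt v x.Λ = locAt v (x.powerLattice x.u x.c₂) :=
  h.locAt_powerLattice_eq (fun _ => ((h.isLocUnit_ρ hv).2.zpow _).mul ((h.isLocUnit_ρ hv).1.zpow _))
    (m₁ := 1) (m₀ := 0) .one (zero_mem _) (by simp)

theorem locAt_ΛPlus (h : x.Admissible p₀) (hv : (p₀ : 𝓞 E) ∉ v.asIdeal) :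
    locAt v x.ΛPlus = locAt v (x.powerLattice x.u x.c₂) :=
  h.locAt_powerLattice_eq (fun _ => (h.isLocUnit_ρ hv).1.zpow _)
    (m₀ := 0) ((h.isLocUnit_δL hv).pow (x.d * x.e)) (zero_mem _) (by simp [uPlus])

theorem locAt_ΛMinus (h : x.Admissible p₀) (hv : (p₀ : 𝓞 E) ∉ v.asIdeal) :
    locAt v x.ΛMinus = locAt v (x.powerLattice x.u x.c₂) :=
  h.locAt_powerLattice_eq (fun _ => (h.isLocUnit_ρ hv).2.zpow _)
    (m₀ := 0) ((h.isLocUnit_δL hv).pow (x.d * x.e)).inv (zero_mem _) (by simp [uMinus])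

theorem sub_mul_ofL_eq (θ t : L) :
    (x.ofL (algebraMap E L x.b) - x.u * x.ofL θ) * x.ofL t =
      x.u * x.ofL (-(θ * t)) + x.ofL (algebraMap E L x.b) * x.ofL t := by
  have h1 : x.u * x.ofL (-(θ * t)) + x.u * x.ofL (θ * t) = 0 := by
    rw [← mul_add, ← map_add, neg_add_cancel, map_zero, mul_zero]
  rw [sub_mul, mul_assoc, ← map_mul x.ofL θ, eq_neg_of_add_eq_zero_left h1]
  abel

theorem locAt_ΛPlusMax (h : x.Admissible p₀) (hv : (p₀ : 𝓞 E) ∉ v.asIdeal) :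
    locAt v x.ΛPlusMax = locAt v (x.powerLattice x.u x.c₂) :=
  have ht := h.isLocUnit_δL_pow_div hv (h.isLocUnit_ρ hv).2
  h.locAt_powerLattice_eq (fun _ => (h.isLocUnit_ρ hv).1.zpow _)
    (((h.isLocUnit_δL hv).pow _).mul ht).neg ht.mem (sub_mul_ofL_eq _ _)

theorem locAt_ΛMinusMax (h : x.Admissible p₀) (hv : (p₀ : 𝓞 E) ∉ v.asIdeal) :
    locAt v x.ΛMinusMax = locAt v (x.powerLattice x.u x.c₂) :=
  have ht := h.isLocUnit_δL_pow_div hv (h.isLocUnit_ρ hv).1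
  h.locAt_powerLattice_eq (fun _ => (h.isLocUnit_ρ hv).2.zpow _)
    (((h.isLocUnit_δL hv).pow _).inv.mul ht).neg ht.mem (sub_mul_ofL_eq _ _)

end Admissible

end CyclicData

/-! ### The places dividing `p₀` -/

namespace CyclicFrame

set_option linter.unusedSectionVars false

variable {E L : Type*} [Field E] [NumberField E] [Field L] [NumberField L] [Algebra E L]
  {σ : L ≃ₐ[E] L} {D : Type*} [Ring D] [Algebra E D] {F : CyclicFrame σ D}
  {v : HeightOneSpectrum (𝓞 E)} {π : 𝓞 E} {δ : L} {ζ c b : 𝓞 E}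

/-- A lattice `∑ Xⁱ cᵢ 𝓞` whose generators have nonnegative depth lies in the maximal order. -/
theorem RamifiedAt.powerSum_le_order (h : F.RamifiedAt v π δ ζ c b) {X : D} {k : ℤ}
    (hX : X ∈ F.depth v δ k) {c' : Fin 5 → E} (hc0 : ∀ i, c' i ≠ 0)
    (hc : ∀ i : Fin 5, algebraMap E L (c' i) ∈ fracPow (locInt v L) δ (-(k * (i : ℕ)))) :
    F.powerSum X (fun i => scaledInt L v (c' i)) ≤ F.ramifiedOrder v π δ b := by
  have hpow : ∀ n : ℕ, X ^ n ∈ F.depth v δ (k * n) := by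
    intro n
    induction n with
    | zero => simpa using h.U_pow_mem_depth 0
    | succ n ih =>
      rw [pow_succ]
      have := h.depth_mul ih hX
      rwa [← mul_add_one, ← Nat.cast_succ] at this
  refine (powerSum_le fun i l hl => ?_).trans h.depth_zero_le_order
  have := h.depth_mul (hpow i)
    (h.ι_mem_depth (scaledInt_le_fracPow h.δ_ne_zero (hc0 i) (hc i) hl))
  rwa [add_neg_cancel] at this

end CyclicFrame

namespace CyclicData

set_option linter.unusedSectionVars false

variable {E M L : Type*} [Field E] [NumberField E] [Field M] [NumberField M]
  [Field L] [NumberField L] [Algebra E L] [Algebra M L] {x : CyclicData E M L}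

namespace Admissible

variable {p₀ : ℕ} {v : HeightOneSpectrum (𝓞 E)}

/-- `σ(δⁿ)` has norm `p₀ⁿ`. -/
theorem prod_map_δL_zpow (h : x.Admissible p₀) (n : ℤ) :
    algebraMap E L ((p₀ : E) ^ n) =
      ∏ j ∈ Finset.range 5, (x.σ ^ j) (x.σ (x.δL ^ n)) := by
  have := h.galois
  have h1 : ∏ j ∈ Finset.range 5, (x.σ ^ j) x.δL = (p₀ : L) := by
    rw [δL, prod_pow_algebraMap x.orderOf_σ h.sup_eq h.finrank_M, h.norm_δ, map_natCast]
  have h2 : ∀ j : ℕ, (x.σ ^ j) (x.σ (x.δL ^ n)) = x.σ ((x.σ ^ j) x.δL) ^ n := by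
    intro j
    rw [← map_zpow₀, ← map_zpow₀, ← AlgEquiv.mul_apply, ← AlgEquiv.mul_apply, ← pow_succ,
      ← pow_succ']
  rw [Finset.prod_congr rfl fun j _ => h2 j, Finset.prod_zpow, ← map_prod, h1, map_natCast,
    map_zpow₀, map_natCast]

/-- The presentation of `D` with the cyclic generator `u δⁿ`. -/
noncomputable def twistedFrame (h : x.Admissible p₀) (n : ℤ) : CyclicFrame x.σ x.D :=
  -- `u δⁿ = σ(δⁿ) u`
  x.frame.twist (θ := x.σ (x.δL ^ n)) ((map_ne_zero x.σ).2 (zpow_ne_zero n h.δL_ne_zero))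
    ((p₀ : E) ^ n) (h.prod_map_δL_zpow n)

theorem twistedFrame_ι (h : x.Admissible p₀) (n : ℤ) : (h.twistedFrame n).ι = x.ofL := rfl

theorem twistedFrame_U (h : x.Admissible p₀) (n : ℤ) :
    (h.twistedFrame n).U = x.u * x.ofL (x.δL ^ n) := (x.u_mul_ofL _).symm

theorem twistedFrame_α (h : x.Admissible p₀) (n : ℤ) :
    (h.twistedFrame n).α = (p₀ : E) ^ n * x.a := rfl

theorem twistedFrame_coord_zero (h : x.Admissible p₀) (n : ℤ) (z : x.D) :
    (h.twistedFrame n).coord z 0 = x.frame.coord z 0 := by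
  rw [twistedFrame, CyclicFrame.twist_coord]
  simp

theorem uPlus_eq (h : x.Admissible p₀) : x.uPlus = (h.twistedFrame (x.d * x.e : ℕ)).U := by
  rw [twistedFrame_U, zpow_natCast, uPlus]

theorem uMinus_eq (h : x.Admissible p₀) : x.uMinus = (h.twistedFrame (-(x.d * x.e : ℕ))).U := by
  rw [twistedFrame_U, zpow_neg, zpow_natCast, uMinus]

theorem yPlus_eq (h : x.Admissible p₀) :
    x.yPlus = (h.twistedFrame (x.d * x.e : ℕ)).ramifiedGen x.ρbar x.δL x.b := by
  rw [CyclicFrame.ramifiedGen, ← uPlus_eq]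
  rfl

theorem yMinus_eq (h : x.Admissible p₀) :
    x.yMinus = (h.twistedFrame (-(x.d * x.e : ℕ))).ramifiedGen x.ρ x.δL x.b := by
  rw [CyclicFrame.ramifiedGen, ← uMinus_eq]
  rfl

section Ramified

variable {π π' ζ c : 𝓞 E} {n : ℤ}

theorem exists_quinticRamified (h : x.Admissible p₀) (hv : v.asIdeal = Ideal.span {π})
    (hπ' : π' ∉ v.asIdeal) (hmul : π * π' = p₀) :
    ∃ W η : (𝓞 M)ˣ, QuinticRamified x.σ v π π' x.δ W η p₀ := by
  obtain ⟨W, hW⟩ := h.exists_δ_pow_mul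
  obtain ⟨η, hη⟩ := h.exists_map_δ
  refine ⟨W, η, hv, hπ', hmul, hW, hη, h.discr_eq, fun m => ?_, ?_⟩
  · obtain ⟨k, hk⟩ := exists_int_sub_mem_of_absNorm h.prime (absNorm_span_of_norm h.norm_δ) m
    exact ⟨k, Ideal.mem_span_singleton.1 hk⟩
  · have h1 : (p₀ : 𝓞 E) ∈ v.asIdeal := by
      rw [← hmul, hv]
      exact Ideal.mul_mem_right _ _ (Ideal.mem_span_singleton_self π)
    exact_mod_cast notMem_of_coprime v.isPrime h.coprime_five h1

theorem u_mul_mem_depth (h : x.Admissible p₀)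
    (hr : (h.twistedFrame n).RamifiedAt v π x.δL ζ c x.b) (m : ℤ) :
    x.u * x.ofL (x.δL ^ m) ∈ (h.twistedFrame n).depth v x.δL (m - n) := by
  have h1 : x.u * x.ofL (x.δL ^ m) =
      (h.twistedFrame n).U * (h.twistedFrame n).ι (x.δL ^ (m - n)) := by
    rw [twistedFrame_U, twistedFrame_ι, mul_assoc, ← map_mul, ← zpow_add₀ h.δL_ne_zero,
      add_sub_cancel]
  have h2 := hr.U_pow_mem_depth 1
  rw [pow_one] at h2
  have := hr.depth_mul h2 (hr.ι_zpow_mem_depth (m - n))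
  rwa [zero_add, ← h1] at this

/-- The generator `y₊` or `y₋` that belongs to the conjugate place: its depth is at least that of
`b - u δᵐ`, increased by the valuation `4` of `δ⁴`, since `π'` is a unit at `v`. -/
theorem sub_mul_mem_depth (h : x.Admissible p₀)
    (hr : (h.twistedFrame n).RamifiedAt v π x.δL ζ c x.b) (hπ' : IsLocUnit v (π' : E)) {m k : ℤ}
    (hk : k ≤ 0) (hm : k ≤ m - n) :
    (x.ofL (algebraMap E L x.b) - x.u * x.ofL (x.δL ^ m)) *
      x.ofL (x.δL ^ 4 / algebraMap E L π') ∈ (h.twistedFrame n).depth v x.δL (k + 4) := by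
  have h1 : x.ofL (algebraMap E L x.b) ∈ (h.twistedFrame n).depth v x.δL k :=
    hr.depth_le hk (hr.ι_mem_depth (mem_fracPow_zero.2 (algebraMap_coe_mem_locInt x.b)))
  have h2 := hr.depth_le hm (h.u_mul_mem_depth hr m)
  have h3 : x.δL ^ 4 / algebraMap E L π' ∈ fracPow (locInt v L) x.δL 4 := by
    rw [mem_fracPow_iff_exists h.δL_ne_zero]
    exact ⟨_, hπ'.algebraMap.inv_mem, by
      rw [div_eq_mul_inv, show (4 : ℤ) = (4 : ℕ) from rfl, zpow_natCast]⟩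
  exact hr.depth_mul (sub_mem h1 h2) (hr.ι_mem_depth h3)

theorem mem_locAt_powerLattice_gen (h : x.Admissible p₀) {s : Fin 5 → E}
    (hs : ∀ i, IsLocUnit v (s i)) (z : x.D) :
    z ∈ locAt v (x.powerLattice ((h.twistedFrame n).ramifiedGen π x.δL x.b) s) ↔
      z ∈ (h.twistedFrame n).ramifiedOrder v π x.δL x.b := by
  rw [x.mem_locAt_powerLattice fun i => (hs i).ne_zero, CyclicFrame.ramifiedOrder]
  have h2 : (fun i => scaledInt L v (s i)) = fun _ => (locInt v L).toAddSubgroup :=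
    funext fun i => scaledInt_unit (hs i).ne_zero (hs i).mem (hs i).inv_mem
  rw [h2]
  rfl

theorem isLocallyMaximal_powerLattice_gen (h : x.Admissible p₀)
    (hr : (h.twistedFrame n).RamifiedAt v π x.δL ζ c x.b) {s : Fin 5 → E}
    (hs : ∀ i, IsLocUnit v (s i)) :
    IsLocallyMaximal v (x.powerLattice ((h.twistedFrame n).ramifiedGen π x.δL x.b) s) := by
  refine hr.isLocallyMaximal (h.mem_locAt_powerLattice_gen hs) ?_
  rintro Γ hone hmul ⟨r, hr, hb⟩ z hz
  rw [twistedFrame_coord_zero]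
  exact x.trace_coord_mem_locInt h.finrank_L (x.powerLattice_fg _ _) hone hmul hr hb hz

theorem algebraMap_unit_mul_zpow_mem {W η : (𝓞 M)ˣ}
    (hQ : QuinticRamified x.σ v π π' x.δ W η p₀) {s : E} (hs : IsLocUnit v s) {k m : ℤ}
    (hm : m ≤ 5 * k) :
    algebraMap E L (s * (π : E) ^ k) ∈ fracPow (locInt v L) x.δL m := by
  have h0 : x.δL ≠ 0 := hQ.δ_ne_zero
  have h1 : IsLocUnit v (algebraMap M L (W : 𝓞 M) * (algebraMap E L π')⁻¹) :=
    IsLocUnit.mul ⟨QuinticRamified.unit_ne_zero W, QuinticRamified.unit_mem W,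
      QuinticRamified.unit_inv_mem W⟩ (IsLocUnit.of_notMem hQ.notMem).algebraMap.inv
  refine fracPow_le h0 hQ.δ_mem hm ?_
  rw [mem_fracPow_iff_exists h0]
  refine ⟨_, (hs.algebraMap.mul (h1.zpow k)).mem, ?_⟩
  rw [map_mul, map_zpow₀, hQ.algebraMap_eq, mul_zpow, zpow_mul]
  change _ * ((x.δL ^ 5) ^ k * _) = (x.δL ^ (5 : ℤ)) ^ k * _
  rw [show (5 : ℤ) = (5 : ℕ) from rfl, zpow_natCast]
  ring

/-- Comparison with the maximal order at a place `v = (π)` above `p₀`: the factor `πᵗⁱ` in the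
coefficient of `Xⁱ` makes up for the negative depth of `Xⁱ`. -/
theorem powerLattice_le_locAt_gen (h : x.Admissible p₀) {W η : (𝓞 M)ˣ}
    (hQ : QuinticRamified x.σ v π π' x.δ W η p₀)
    (hr : (h.twistedFrame n).RamifiedAt v π x.δL ζ c x.b) {s : Fin 5 → E}
    (hs : ∀ i, IsLocUnit v (s i)) {X : x.D} {k : ℤ}
    (hX : X ∈ (h.twistedFrame n).depth v x.δL k) {s' : Fin 5 → E}
    (hs' : ∀ i, IsLocUnit v (s' i)) {t : Fin 5 → ℤ} (ht : ∀ i : Fin 5, -(k * (i : ℕ)) ≤ 5 * t i) :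
    locAt v (x.powerLattice X fun i => s' i * (π : E) ^ t i) ≤
      locAt v (x.powerLattice ((h.twistedFrame n).ramifiedGen π x.δL x.b) s) := by
  have h0 : ∀ i, s' i * (π : E) ^ t i ≠ 0 := fun i =>
    mul_ne_zero (hs' i).ne_zero (zpow_ne_zero _ ((map_ne_zero _).1 hQ.algebraMap_ne_zero))
  intro z hz
  rw [h.mem_locAt_powerLattice_gen hs]
  rw [x.mem_locAt_powerLattice h0] at hz
  exact hr.powerSum_le_order hX h0 (fun i => algebraMap_unit_mul_zpow_mem hQ (hs' i) (ht i)) hz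

end Ramified

theorem two_notMem (h : x.Admissible p₀) {π π' : 𝓞 E} (hv : v.asIdeal = Ideal.span {π})
    (hmul : π * π' = p₀) : (2 : 𝓞 E) ∉ v.asIdeal := by
  have h1 : (p₀ : 𝓞 E) ∈ v.asIdeal := by
    rw [← hmul, hv]
    exact Ideal.mul_mem_right _ _ (Ideal.mem_span_singleton_self π)
  exact_mod_cast notMem_of_coprime v.isPrime
    ((Nat.coprime_primes h.prime Nat.prime_two).2 h.ne_two) h1

theorem exists_of_congrMod {π : 𝓞 E} (hv : v.asIdeal = Ideal.span {π}) {y α : E}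
    (hc : CongrMod π y α) : ∃ f ∈ locInt v E, α - y = π * f := by
  obtain ⟨n, s, hs, h⟩ := hc
  have hs' : s ∉ v.asIdeal := by rwa [hv, Ideal.mem_span_singleton]
  refine ⟨(s : E)⁻¹ * -(n : E), mul_mem (inv_coe_mem_locInt hs') (neg_mem (coe_mem_locInt n)), ?_⟩
  have := ne_zero_of_notMem hs'
  field_simp
  linear_combination -h

end Admissible

end CyclicData

namespace CyclicData

set_option linter.unusedSectionVars false

variable {E M L : Type*} [Field E] [NumberField E] [Field M] [NumberField M]
  [Field L] [NumberField L] [Algebra E L] [Algebra M L] {x : CyclicData E M L}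

namespace Admissible

variable {p₀ : ℕ} {v : HeightOneSpectrum (𝓞 E)}

theorem ρbar_mul (h : x.Admissible p₀) : x.ρbar * x.ρ = (p₀ : 𝓞 E) := by rw [mul_comm, h.ρ_mul]

theorem conjInt_ρbar (h : x.Admissible p₀) : x.conjInt x.ρbar = x.ρ :=
  x.conjInt_conjInt h.prime.ne_zero h.ρ_mul

theorem ρbar_notMem (h : x.Admissible p₀) (hv : v.asIdeal = Ideal.span {x.ρ}) :
    x.ρbar ∉ v.asIdeal :=
  x.conjInt_notMem h.finrank_E h.sqrt h.conj_ne h.prime h.coprime h.ρ_mul hv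

theorem ρ_notMem (h : x.Admissible p₀) (hv : v.asIdeal = Ideal.span {x.ρbar}) :
    x.ρ ∉ v.asIdeal := by
  have h1 : x.ρbar * x.conjInt x.ρbar = (p₀ : 𝓞 E) := by rw [h.conjInt_ρbar, h.ρbar_mul]
  have := x.conjInt_notMem h.finrank_E h.sqrt h.conj_ne h.prime h.coprime h1 hv
  rwa [h.conjInt_ρbar] at this

theorem exists_ramifiedAt_ρbar (h : x.Admissible p₀) (hv : v.asIdeal = Ideal.span {x.ρbar}) :
    ∃ ζ c, (h.twistedFrame (x.d * x.e : ℕ)).RamifiedAt v x.ρbar x.δL ζ c x.b := by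
  have := h.galois
  obtain ⟨W, η, hQ⟩ := h.exists_quinticRamified hv (h.ρ_notMem hv) h.ρbar_mul
  have hρ := IsLocUnit.of_notMem (h.ρ_notMem hv)
  have hρ₂ := h.isLocUnit_ρ₂ (h.two_notMem hv h.ρbar_mul)
  -- The factor `(ρ ρ̄)^{de}` removes the powers of `ρ̄` from the denominator of `a`.
  have hα : (h.twistedFrame (x.d * x.e : ℕ)).α =
      ((x.ρ : E) ^ x.d * (x.ρ : E) ^ x.d * (x.ρ₂ / x.ρ₂bar)) ^ x.e := by
    have := h.ρbar_ne_zero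
    have := h.ρ₂bar_ne_zero
    rw [twistedFrame_α, zpow_natCast, a, ← h.coe_ρ_mul, pow_mul, ← mul_pow]
    congr 1
    field_simp
    ring
  have hu : IsLocUnit v (h.twistedFrame (x.d * x.e : ℕ)).α := by
    rw [hα]
    exact (((hρ.pow _).mul (hρ.pow _)).mul (hρ₂.1.div hρ₂.2)).pow _
  refine hQ.exists_ramifiedAt x.orderOf_σ h.sup_eq h.finrank_M _ hu.ne_zero hu.mem hu.inv_mem
    (exists_of_congrMod hv ?_)
  rw [twistedFrame_α, zpow_natCast]
  exact h.congr_ρbar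

theorem exists_ramifiedAt_ρ (h : x.Admissible p₀) (hv : v.asIdeal = Ideal.span {x.ρ}) :
    ∃ ζ c, (h.twistedFrame (-(x.d * x.e : ℕ))).RamifiedAt v x.ρ x.δL ζ c x.b := by
  have := h.galois
  obtain ⟨W, η, hQ⟩ := h.exists_quinticRamified hv (h.ρbar_notMem hv) h.ρ_mul
  have hρ := IsLocUnit.of_notMem (h.ρbar_notMem hv)
  have hρ₂ := h.isLocUnit_ρ₂ (h.two_notMem hv h.ρ_mul)
  -- The factor `(ρ ρ̄)^{-de}` removes the powers of `ρ` from the numerator of `a`.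
  have hα : (h.twistedFrame (-(x.d * x.e : ℕ))).α =
      (x.ρ₂ / x.ρ₂bar / ((x.ρbar : E) ^ x.d * (x.ρbar : E) ^ x.d)) ^ x.e := by
    have := h.ρ_ne_zero
    have := h.ρbar_ne_zero
    have := h.ρ₂bar_ne_zero
    rw [twistedFrame_α, zpow_neg, zpow_natCast, a, ← h.coe_ρ_mul, pow_mul, ← inv_pow, ← mul_pow]
    congr 1
    field_simp
    ring
  have hu : IsLocUnit v (h.twistedFrame (-(x.d * x.e : ℕ))).α := by
    rw [hα]
    exact ((hρ₂.1.div hρ₂.2).div ((hρ.pow _).mul (hρ.pow _))).pow _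
  refine hQ.exists_ramifiedAt x.orderOf_σ h.sup_eq h.finrank_M _ hu.ne_zero hu.mem hu.inv_mem
    (exists_of_congrMod hv ?_)
  rw [twistedFrame_α, zpow_neg, zpow_natCast]
  exact h.congr_ρ

/-- The lattices at the place `ρ̄`. -/
theorem localization_ρbar (h : x.Admissible p₀) (hv : v.asIdeal = Ideal.span {x.ρbar}) :
    IsLocallyMaximal v x.ΛPlusMax ∧ locAt v x.Λ ≤ locAt v x.ΛPlusMax ∧
      locAt v x.ΛPlus ≤ locAt v x.ΛPlusMax ∧ locAt v x.ΛMinus ≤ locAt v x.ΛPlusMax ∧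
      locAt v x.ΛMinusMax ≤ locAt v x.ΛPlusMax := by
  obtain ⟨ζ, c, hr⟩ := h.exists_ramifiedAt_ρbar hv
  obtain ⟨W, η, hQ⟩ := h.exists_quinticRamified hv (h.ρ_notMem hv) h.ρbar_mul
  have hρ := IsLocUnit.of_notMem (h.ρ_notMem hv)
  have hc₂ := h.isLocUnit_c₂ (h.two_notMem hv h.ρbar_mul)
  have hgen : x.ΛPlusMax = x.powerLattice
      ((h.twistedFrame (x.d * x.e : ℕ)).ramifiedGen x.ρbar x.δL x.b)
      fun i => x.c₂ i * (x.ρ : E) ^ ⌈-(((4 * i : ℕ) : ℚ) / 5)⌉ := by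
    rw [← yPlus_eq]; rfl
  have hs : ∀ i : Fin 5, IsLocUnit v (x.c₂ i * (x.ρ : E) ^ ⌈-(((4 * i : ℕ) : ℚ) / 5)⌉) :=
    fun i => (hc₂ i).mul (hρ.zpow _)
  -- In terms of the frame with generator `u₊`, the depths of `u`, `u₊`, `u₋` and `y₋` are at least
  -- `-de`, `0`, `-2de` and `-2de + 4`.
  have hu := h.u_mul_mem_depth hr 0
  rw [zpow_zero, map_one, mul_one, zero_sub] at hu
  have huPlus := hr.U_pow_mem_depth 1
  rw [pow_one, ← uPlus_eq] at huPlus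
  have huMinus := h.u_mul_mem_depth hr (-(x.d * x.e : ℕ))
  rw [← twistedFrame_U h, ← uMinus_eq] at huMinus
  have hyMinus := h.sub_mul_mem_depth (k := -((2 * x.d * x.e : ℕ) : ℤ)) hr hρ
    (m := -(x.d * x.e : ℕ)) (by omega) (by push_cast; linarith)
  rw [← twistedFrame_U h, ← uMinus_eq] at hyMinus
  -- The powers of `ρ̄`, which has order `5` in `δ`, compensate for the poles.
  have hceil : ∀ (N : ℕ) (i : Fin 5), -(-(N : ℤ) * (i : ℕ)) ≤ 5 * ⌈((N * i : ℕ) : ℚ) / 5⌉ := by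
    intro N i
    rw [Rat.ceil_natCast_div_five, neg_mul, neg_neg, ← Nat.cast_mul]
    omega
  rw [hgen]
  refine ⟨h.isLocallyMaximal_powerLattice_gen hr hs, ?_, ?_, ?_, ?_⟩
  · have h1 : x.Λ = x.powerLattice x.u fun i =>
        x.c₂ i * (x.ρ : E) ^ ⌈-(((x.d * x.e * i : ℕ) : ℚ) / 5)⌉ *
          (x.ρbar : E) ^ ⌈((x.d * x.e * i : ℕ) : ℚ) / 5⌉ := by
      rw [Λ]
      congr 1
      funext i
      ring
    rw [h1]
    exact h.powerLattice_le_locAt_gen hQ hr hs hu (fun i => (hc₂ i).mul (hρ.zpow _)) (hceil _)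
  · have h1 : x.ΛPlus = x.powerLattice x.uPlus fun i =>
        x.c₂ i * (x.ρ : E) ^ ⌈-(((2 * x.d * x.e * i : ℕ) : ℚ) / 5)⌉ * (x.ρbar : E) ^ (0 : ℤ) := by
      simp only [zpow_zero, mul_one]
      rfl
    rw [h1]
    exact h.powerLattice_le_locAt_gen hQ hr hs huPlus (fun i => (hc₂ i).mul (hρ.zpow _))
      (by simp)
  · exact h.powerLattice_le_locAt_gen hQ hr hs (k := -((2 * x.d * x.e : ℕ) : ℤ))
      (hr.depth_le (by push_cast; linarith) huMinus) hc₂ (hceil _)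
  · exact h.powerLattice_le_locAt_gen hQ hr hs (k := -((2 * x.d * x.e : ℕ) : ℤ))
      (hr.depth_le (by omega) hyMinus) hc₂ (hceil _)

/-- The lattices at the place `ρ`. -/
theorem localization_ρ (h : x.Admissible p₀) (hv : v.asIdeal = Ideal.span {x.ρ}) :
    IsLocallyMaximal v x.ΛMinusMax ∧ locAt v x.Λ ≤ locAt v x.ΛMinusMax ∧
      locAt v x.ΛPlus ≤ locAt v x.ΛMinusMax ∧ locAt v x.ΛMinus ≤ locAt v x.ΛMinusMax ∧
      locAt v x.ΛPlusMax ≤ locAt v x.ΛMinusMax := by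
  obtain ⟨ζ, c, hr⟩ := h.exists_ramifiedAt_ρ hv
  obtain ⟨W, η, hQ⟩ := h.exists_quinticRamified hv (h.ρbar_notMem hv) h.ρ_mul
  have hρ := IsLocUnit.of_notMem (h.ρbar_notMem hv)
  have hc₂ := h.isLocUnit_c₂ (h.two_notMem hv h.ρ_mul)
  have hgen : x.ΛMinusMax = x.powerLattice
      ((h.twistedFrame (-(x.d * x.e : ℕ))).ramifiedGen x.ρ x.δL x.b)
      fun i => x.c₂ i * (x.ρbar : E) ^ ⌈((2 * x.d * x.e * i : ℕ) : ℚ) / 5⌉ := by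
    rw [← yMinus_eq]; rfl
  have hs : ∀ i : Fin 5,
      IsLocUnit v (x.c₂ i * (x.ρbar : E) ^ ⌈((2 * x.d * x.e * i : ℕ) : ℚ) / 5⌉) :=
    fun i => (hc₂ i).mul (hρ.zpow _)
  -- In terms of the frame with generator `u₋`, the depths of `u`, `u₋`, `u₊` and `y₊` are at least
  -- `de`, `0`, `2de` and `4`.
  have hu := h.u_mul_mem_depth hr 0
  rw [zpow_zero, map_one, mul_one, zero_sub, neg_neg] at hu
  have huMinus := hr.U_pow_mem_depth 1
  rw [pow_one, ← uMinus_eq] at huMinus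
  have huPlus := h.u_mul_mem_depth hr (x.d * x.e : ℕ)
  rw [← twistedFrame_U h, ← uPlus_eq] at huPlus
  have hyPlus := h.sub_mul_mem_depth (k := 0) hr hρ
    (m := (x.d * x.e : ℕ)) le_rfl (by omega)
  rw [← twistedFrame_U h, ← uPlus_eq, zero_add] at hyPlus
  -- The positive depths compensate for the negative powers of `ρ`, which has order `5` in `δ`.
  have hceil : ∀ (N : ℕ) (i : Fin 5), -((N : ℤ) * (i : ℕ)) ≤ 5 * ⌈-(((N * i : ℕ) : ℚ) / 5)⌉ := by
    intro N i
    rw [Rat.ceil_neg_natCast_div_five, ← Nat.cast_mul]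
    omega
  rw [hgen]
  refine ⟨h.isLocallyMaximal_powerLattice_gen hr hs, ?_, ?_, ?_, ?_⟩
  · have h1 : x.Λ = x.powerLattice x.u fun i =>
        x.c₂ i * (x.ρbar : E) ^ ⌈((x.d * x.e * i : ℕ) : ℚ) / 5⌉ *
          (x.ρ : E) ^ ⌈-(((x.d * x.e * i : ℕ) : ℚ) / 5)⌉ := by
      rw [Λ]
      congr 1
      funext i
      ring
    rw [h1]
    exact h.powerLattice_le_locAt_gen hQ hr hs hu (fun i => (hc₂ i).mul (hρ.zpow _)) (hceil _)
  · exact h.powerLattice_le_locAt_gen hQ hr hs (k := ((2 * x.d * x.e : ℕ) : ℤ))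
      (hr.depth_le (by push_cast; linarith) huPlus) hc₂ (hceil _)
  · have h1 : x.ΛMinus = x.powerLattice x.uMinus fun i =>
        x.c₂ i * (x.ρbar : E) ^ ⌈((2 * x.d * x.e * i : ℕ) : ℚ) / 5⌉ * (x.ρ : E) ^ (0 : ℤ) := by
      simp only [zpow_zero, mul_one]
      rfl
    rw [h1]
    exact h.powerLattice_le_locAt_gen hQ hr hs huMinus (fun i => (hc₂ i).mul (hρ.zpow _))
      (by simp)
  · exact h.powerLattice_le_locAt_gen hQ hr hs hyPlus hc₂ (hceil 4)

end Admissible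

end CyclicData

/-! ### The global statement -/

namespace CyclicData

set_option linter.unusedSectionVars false

variable {E M L : Type*} [Field E] [NumberField E] [Field M] [NumberField M]
  [Field L] [NumberField L] [Algebra E L] [Algebra M L] {x : CyclicData E M L}

theorem ΛMax_fg (x : CyclicData E M L) : x.ΛMax.FG :=
  (x.powerLattice_fg _ _).sup (x.powerLattice_fg _ _)

theorem locAt_ΛMax_of_le {v : HeightOneSpectrum (𝓞 E)} {N : Submodule (𝓞 E) x.D}
    (hN : N ≤ x.ΛMax) (h₁ : locAt v x.ΛPlusMax ≤ locAt v N) (h₂ : locAt v x.ΛMinusMax ≤ locAt v N) :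
    locAt v x.ΛMax = locAt v N := by
  refine le_antisymm (locAt_le_locAt_iff.2 (sup_le ?_ ?_))
    (locAt_le_locAt_iff.2 (hN.trans (le_locAt v _)))
  · exact (le_locAt v _).trans h₁
  · exact (le_locAt v _).trans h₂

namespace Admissible

variable {p₀ : ℕ} {v : HeightOneSpectrum (𝓞 E)}

theorem span_Λ (h : x.Admissible p₀) : Submodule.span E (x.Λ : Set x.D) = ⊤ :=
  x.span_powerLattice_u fun i => mul_ne_zero (h.c₂_ne_zero i)
    (mul_ne_zero (zpow_ne_zero _ h.ρbar_ne_zero) (zpow_ne_zero _ h.ρ_ne_zero))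

theorem asIdeal_eq_or (h : x.Admissible p₀) (hv : (p₀ : 𝓞 E) ∈ v.asIdeal) :
    v.asIdeal = Ideal.span {x.ρ} ∨ v.asIdeal = Ideal.span {x.ρbar} :=
  x.asIdeal_eq_or_of_natCast_mem h.finrank_E h.prime h.ρ_mul hv

theorem locAt_ΛMax_of_notMem (h : x.Admissible p₀) (hv : (p₀ : 𝓞 E) ∉ v.asIdeal) :
    locAt v x.ΛMax = locAt v x.Λ := by
  rw [locAt_ΛMax_of_le le_sup_left le_rfl
    (by rw [h.locAt_ΛPlusMax hv, h.locAt_ΛMinusMax hv]), h.locAt_ΛPlusMax hv, h.locAt_Λ hv]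

theorem locAt_ΛMax_of_ρbar (h : x.Admissible p₀) (hv : v.asIdeal = Ideal.span {x.ρbar}) :
    locAt v x.ΛMax = locAt v x.ΛPlusMax :=
  locAt_ΛMax_of_le le_sup_left le_rfl (h.localization_ρbar hv).2.2.2.2

theorem locAt_ΛMax_of_ρ (h : x.Admissible p₀) (hv : v.asIdeal = Ideal.span {x.ρ}) :
    locAt v x.ΛMax = locAt v x.ΛMinusMax :=
  locAt_ΛMax_of_le le_sup_right (h.localization_ρ hv).2.2.2.2 le_rfl

theorem isLocallyMaximal_Λ (h : x.Admissible p₀) (hv : (p₀ : 𝓞 E) ∉ v.asIdeal) :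
    IsLocallyMaximal v x.Λ :=
  (h.isLocallyMaximal_powerLattice_u hv).congr E (h.locAt_Λ hv)

theorem isLocallyMaximal_ΛMax (h : x.Admissible p₀) (v : HeightOneSpectrum (𝓞 E)) :
    IsLocallyMaximal v x.ΛMax := by
  by_cases hv : (p₀ : 𝓞 E) ∈ v.asIdeal
  · rcases h.asIdeal_eq_or hv with hv | hv
    · exact (h.localization_ρ hv).1.congr E (h.locAt_ΛMax_of_ρ hv)
    · exact (h.localization_ρbar hv).1.congr E (h.locAt_ΛMax_of_ρbar hv)
  · exact (h.isLocallyMaximal_Λ hv).congr E (h.locAt_ΛMax_of_notMem hv)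

theorem Λ_le_ΛMax (h : x.Admissible p₀) : x.Λ ≤ x.ΛMax := by
  refine le_of_forall_le_locAt (RingOfIntegers.not_isField E) fun v => ?_
  by_cases hv : (p₀ : 𝓞 E) ∈ v.asIdeal
  · rcases h.asIdeal_eq_or hv with hv | hv
    · rw [h.locAt_ΛMax_of_ρ hv]
      exact (le_locAt v _).trans (h.localization_ρ hv).2.1
    · rw [h.locAt_ΛMax_of_ρbar hv]
      exact (le_locAt v _).trans (h.localization_ρbar hv).2.1
  · rw [h.locAt_ΛMax_of_notMem hv]
    exact le_locAt v _

theorem isMaximalOrderIn_ΛMax (h : x.Admissible p₀) : IsMaximalOrderIn (𝓞 E) E x.ΛMax :=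
  isMaximalOrderIn_of_forall_isLocallyMaximal (RingOfIntegers.not_isField E) x.ΛMax_fg
    (eq_top_iff.2 (h.span_Λ.ge.trans (Submodule.span_mono h.Λ_le_ΛMax))) h.isLocallyMaximal_ΛMax

theorem isMaximalOrderIn_localize (h : x.Admissible p₀) {N : Submodule (𝓞 E) x.D} (hN : N.FG)
    (hle : locAt v x.Λ ≤ locAt v N) (hmax : IsLocallyMaximal v N) :
    IsMaximalOrderIn (v.adicCompletionIntegers E) (v.adicCompletion E) (x.localize v N) :=
  hmax.isMaximalOrderIn hN (span_eq_top_of_le_locAt h.span_Λ ((le_locAt v _).trans hle))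

end Admissible

end CyclicData

theorem mainTheorem6
    -- the quadratic field `E = ℚ(√-7)`, the quintic field `M` and their compositum `L`
    (E M L : Type*) [Field E] [NumberField E] [Field M] [NumberField M]
    [Field L] [NumberField L] [Algebra E L] [Algebra M L]
    (p₀ : ℕ) (hp₀ : p₀.Prime) (hp₀_odd : p₀ ≠ 2)
    (hp₀_split : p₀ % 7 = 1 ∨ p₀ % 7 = 2 ∨ p₀ % 7 = 4)
    (x : CyclicData E M L)
    (hE : Module.finrank ℚ E = 2) (hsqrt : x.sqrtNegSeven ^ 2 = -7)
    (hM_galois : IsGalois ℚ M) (hM_deg : Module.finrank ℚ M = 5)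
    (hM_discr : NumberField.discr M = (p₀ : ℤ) ^ 4)
    (hM_inert : (Ideal.span {(2 : 𝓞 M)}).IsPrime)
    (hL : (algebraMap E L).fieldRange ⊔ (algebraMap M L).fieldRange = ⊤)
    (hconj : x.conj ≠ 1)
    (hρ : x.ρ * x.ρbar = (p₀ : 𝓞 E))
    (hρ_norm : ∀ z : L, Algebra.norm E z ≠ (x.ρ : E))
    (hρbar_norm : ∀ z : L, Algebra.norm E z ≠ (x.ρbar : E))
    (hδ : Algebra.norm ℚ (x.δ : M) = (p₀ : ℚ))
    (hd_lt : x.d < 5)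
    (hd : ∃ c : 𝓞 E,
      CongrMod x.ρ ((c : E) ^ 5) (x.ρ₂ / (x.ρ₂bar * (x.ρbar : E) ^ (2 * x.d))))
    (he_pos : 0 < x.e) (he_lt : x.e < 5)
    (hb_two : (2 : 𝓞 E) ∣ x.b)
    (hb_conj : (p₀ : 𝓞 E) ∣ x.conjInt x.b * x.b - 1)
    (hb_ρbar : CongrMod x.ρbar ((x.b : E) ^ 5) ((p₀ : E) ^ (x.d * x.e) * x.a))
    (hb_ρ : CongrMod x.ρ ((x.b : E) ^ 5) (((p₀ : E) ^ (x.d * x.e))⁻¹ * x.a)) :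
    -- `D` is a division algebra
    (∀ z : x.D, z ≠ 0 → IsUnit z) ∧
    -- (1) the finite places not dividing `p₀`
    (∀ v : HeightOneSpectrum (𝓞 E), (p₀ : 𝓞 E) ∉ v.asIdeal →
      x.localize v x.ΛPlusMax = x.localize v x.Λ ∧
      x.localize v x.ΛMinusMax = x.localize v x.Λ ∧
      x.localize v x.ΛPlus = x.localize v x.Λ ∧
      x.localize v x.ΛMinus = x.localize v x.Λ ∧
      x.localize v x.ΛMax = x.localize v x.Λ ∧
      IsMaximalOrderIn (v.adicCompletionIntegers E) (v.adicCompletion E) (x.localize v x.Λ)) ∧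
    -- (2) the place `ρ̄_{p₀}`
    (∀ v : HeightOneSpectrum (𝓞 E), v.asIdeal = Ideal.span {x.ρbar} →
      IsMaximalOrderIn (v.adicCompletionIntegers E) (v.adicCompletion E)
        (x.localize v x.ΛPlusMax) ∧
      x.localize v x.Λ ≤ x.localize v x.ΛPlusMax ∧
      x.localize v x.ΛPlus ≤ x.localize v x.ΛPlusMax ∧
      x.localize v x.ΛMinus ≤ x.localize v x.ΛPlusMax ∧
      x.localize v x.ΛMinusMax ≤ x.localize v x.ΛPlusMax ∧
      x.localize v x.ΛMax = x.localize v x.ΛPlusMax) ∧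
    -- (3) the place `ρ_{p₀}`
    (∀ v : HeightOneSpectrum (𝓞 E), v.asIdeal = Ideal.span {x.ρ} →
      IsMaximalOrderIn (v.adicCompletionIntegers E) (v.adicCompletion E)
        (x.localize v x.ΛMinusMax) ∧
      x.localize v x.Λ ≤ x.localize v x.ΛMinusMax ∧
      x.localize v x.ΛPlus ≤ x.localize v x.ΛMinusMax ∧
      x.localize v x.ΛMinus ≤ x.localize v x.ΛMinusMax ∧
      x.localize v x.ΛPlusMax ≤ x.localize v x.ΛMinusMax ∧
      x.localize v x.ΛMax = x.localize v x.ΛMinusMax) ∧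
    -- (4) the global statement
    IsMaximalOrderIn (𝓞 E) E x.ΛMax ∧ x.Λ ≤ x.ΛMax := by
  have h : x.Admissible p₀ := ⟨hp₀, hp₀_odd, hp₀_split, hE, hsqrt, hM_galois, hM_deg, hM_discr,
    hM_inert, hL, hconj, hρ, hδ, he_pos, he_lt, hb_two, hb_ρbar, hb_ρ⟩
  refine ⟨fun z hz => h.isUnit_of_ne_zero hz, fun v hv => ?_, fun v hv => ?_, fun v hv => ?_,
    h.isMaximalOrderIn_ΛMax, h.Λ_le_ΛMax⟩
  · have hΛ := h.locAt_Λ hv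
    exact ⟨completedSpan_congr ((h.locAt_ΛPlusMax hv).trans hΛ.symm),
      completedSpan_congr ((h.locAt_ΛMinusMax hv).trans hΛ.symm),
      completedSpan_congr ((h.locAt_ΛPlus hv).trans hΛ.symm),
      completedSpan_congr ((h.locAt_ΛMinus hv).trans hΛ.symm),
      completedSpan_congr (h.locAt_ΛMax_of_notMem hv),
      h.isMaximalOrderIn_localize (x.powerLattice_fg _ _) le_rfl (h.isLocallyMaximal_Λ hv)⟩
  · obtain ⟨h1, h2, h3, h4, h5⟩ := h.localization_ρbar hv
    exact ⟨h.isMaximalOrderIn_localize (x.powerLattice_fg _ _) h2 h1, completedSpan_mono h2,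
      completedSpan_mono h3, completedSpan_mono h4, completedSpan_mono h5,
      completedSpan_congr (h.locAt_ΛMax_of_ρbar hv)⟩
  · obtain ⟨h1, h2, h3, h4, h5⟩ := h.localization_ρ hv
    exact ⟨h.isMaximalOrderIn_localize (x.powerLattice_fg _ _) h2 h1, completedSpan_mono h2,
      completedSpan_mono h3, completedSpan_mono h4, completedSpan_mono h5,
      completedSpan_congr (h.locAt_ΛMax_of_ρ hv)⟩
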